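/- Let $\alpha\in[1,2)$, $r\ge 2$ an integer, $R>0$, and let $\phi\in C^\infty(\mathbb R)$ satisfy $1\le\phi\le 2+2R$, $0\le\phi_x\le 1$, $\phi_x=1$ for $|x|<R$, $\phi_x=0$ for $|x|\ge R+1$, and $\sqrt{\phi_x}\in C_c^\infty(\mathbb R)$. Write $\langle\cdot,\cdot\rangle$ for the $L^2(\mathbb R)$ inner product and $\mathcal D^{\sigma}=(-\partial_x^2)^{\sigma/2}$ (Fourier multiplier $|\xi|^\sigma$). For $\Delta x>0$ let $$S_{\Delta x}=\{v\in H^{1+\alpha}(\mathbb R): v|_{[(j-1)\Delta x,\,j\Delta x]}\text{ is a polynomial of degree}\le r\text{ for every }j\in\mathbb Z\}.$$ Given $u_0\in L^2(\mathbb R)$ and $\Delta t>0$, let $u^0$ be the $L^2$-orthogonal projection of $u_0$ onto $S_{\Delta x}$, and let $u^{n+1}\in S_{\Delta x}$ be the solution of the Crank--Nicolson Galerkin scheme $$\langle u^{n+1},\phi v\rangle-\Delta t\Big\langle\tfrac{(u^{n+1/2})^2}{2},(\phi v)_x\Big\rangle+\Delta t\big\langle\mathcal D^{\alpha/2}u^{n+1/2},\mathcal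 D^{\alpha/2}(\phi v)_x\big\rangle=\langle u^n,\phi v\rangle\qquad\text{for all }v\in S_{\Delta x},$$ where $u^{n+1/2}=(u^{n+1}+u^n)/2$, that is obtained as the $L^2$-limit $u^{n+1}=\lim_{\ell\to\infty}w^\ell$ of the iteration $w^0=u^n$, $w^{\ell}\in S_{\Delta x}$ and $$\langle w^{\ell+1},\phi v\rangle-\tfrac{\Delta t}{2}\Big\langle\big(\tfrac{w^\ell+u^n}{2}\big)^2,(\phi v)_x\Big\rangle+\Delta t\Big\langle\mathcal D^{\alpha/2}\tfrac{w^{\ell+1}+u^n}{2},\mathcal D^{\alpha/2}(\phi v)_x\Big\rangle=\langle u^n,\phi v\rangle\qquad\text{for all }v\in S_{\Delta x}.$$ Let $0<L<1$ and $K=\frac{5-L}{1-L}$. Call $C_2>0$ an inverse constant if $\|v_x\|_{L^\infty(\mathbb R)}\le C_2^{1/2}\Delta x^{-3/2}\|v\|_{L^2(\mathbb R)}$ for all $\Delta x>0$ and all $v\in S_{\Delta x}$. Then an inverse constant exists. Moreover, with $\alpha,r,R,\phi,L$ fixed, there are $Y>0$, $T>0$ and $C$ depending only on $\|u_0\|_{L^2(\mathbb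 R)}$ such that the following holds for every inverse constant $C_2$. If $\Delta x,\Delta t>0$ satisfy the CFL condition $$\lambda=\frac{\Delta t}{\Delta x^{3/2}}\le\frac{L}{2\sqrt{C_2}\,K\sqrt{Y}},$$ then the numerical solution $u^0$ and $u^{n+1}$, for all $n\ge 0$ with $(n+\frac12)\Delta t\le T$, exists, and $$\|u^n\|_{L^2(\mathbb R)}\le C\quad\text{for all }n\ge 0\text{ with }n\Delta t\le T,\qquad \Delta t\sum_{(n+\frac12)\Delta t\le T}\big\|\mathcal D^{\alpha/2}u^{n+1/2}\big\|_{L^2([-R,R])}^2\le C.$$ -/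

import Mathlib

open MeasureTheory Filter Topology Set
open scoped ContDiff FourierTransform SchwartzMap

namespace FracKdV

noncomputable section

/-- `v` belongs to `H^s(ℝ)` (in particular it is square integrable). -/
def MemH (s : ℝ) (v : ℝ → ℝ) : Prop :=
  ∃ h : MemLp (fun x => (v x : ℂ)) 2 (volume : Measure ℝ),
    TemperedDistribution.MemSobolev s 2
      (Lp.toTemperedDistribution (h.toLp (fun x => (v x : ℂ))) : 𝓢'(ℝ, ℂ))

open Classical in
/-- The fractional derivative `D^σ v = (-∂ₓ²)^{σ/2} v` of a square integrable `v`, as the `L²`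
function obtained from the Fourier multiplier `(2π|ξ|)^σ`; with Mathlib's normalisation
`∫ e^{-2πixξ} v(x) dx` of the Fourier transform, this is the usual multiplier `|ξ|^σ`.
The value is `0` if `(2π|ξ|)^σ v̂` is not square integrable. -/
def fracDLp (σ : ℝ) (v : ℝ → ℝ) : Lp ℂ 2 (volume : Measure ℝ) :=
  if h : MemLp (fun x => (v x : ℂ)) 2 (volume : Measure ℝ) then
    if h' : MemLp (fun ξ : ℝ => (((2 * Real.pi * |ξ|) ^ σ : ℝ) : ℂ) *
        (𝓕 (h.toLp (fun x => (v x : ℂ))) : Lp ℂ 2 (volume : Measure ℝ)) ξ) 2 volume then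
      𝓕⁻ (h'.toLp _)
    else 0
  else 0

/-- `D^σ v` as a real function (for real `v` the function `fracDLp σ v` is real a.e.). -/
def fracD (σ : ℝ) (v : ℝ → ℝ) : ℝ → ℝ := fun x => (fracDLp σ v x).re

/-- The `L²(ℝ)` inner product. -/
def dot (f g : ℝ → ℝ) : ℝ := ∫ x, f x * g x

/-- The cut-off functions `φ` used as weights. -/
structure IsCutoff (R : ℝ) (φ : ℝ → ℝ) : Prop where
  smooth : ContDiff ℝ ∞ φ
  one_le : ∀ x, 1 ≤ φ x
  le : ∀ x, φ x ≤ 2 + 2 * R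
  deriv_eq_one : ∀ x, |x| < R → deriv φ x = 1
  deriv_eq_zero : ∀ x, R + 1 ≤ |x| → deriv φ x = 0
  deriv_nonneg : ∀ x, 0 ≤ deriv φ x
  deriv_le_one : ∀ x, deriv φ x ≤ 1
  sqrt_smooth : ContDiff ℝ ∞ (fun x => √(deriv φ x))
  sqrt_compact : HasCompactSupport (fun x => √(deriv φ x))

/-- The finite element space `S_{Δx}`: functions in `H^{1+α}(ℝ)` that are polynomials of degree
at most `r` on every cell `[(j-1)Δx, jΔx]`. -/
def feSpace (α : ℝ) (r : ℕ) (Δx : ℝ) : Set (ℝ → ℝ) :=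
  {v | MemH (1 + α) v ∧ ∀ j : ℤ, ∃ p : Polynomial ℝ, p.natDegree ≤ r ∧
    ∀ x ∈ Icc (((j : ℝ) - 1) * Δx) ((j : ℝ) * Δx), v x = p.eval x}

/-- `C₂` is a constant of the inverse inequality
`‖vₓ‖_{L^∞} ≤ C₂^{1/2} Δx^{-3/2} ‖v‖_{L²}` on the spaces `S_{Δx}`, uniformly in `Δx`. -/
def IsInverseConstant (α : ℝ) (r : ℕ) (C₂ : ℝ) : Prop :=
  0 < C₂ ∧ ∀ Δx : ℝ, 0 < Δx → ∀ v ∈ feSpace α r Δx, ∀ x : ℝ,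
    |deriv v x| ≤ √C₂ / Δx ^ (3 / 2 : ℝ) * (eLpNorm v 2 volume).toReal

/-- `u⁰` is the `L²`-orthogonal projection of `u₀` onto `S_{Δx}`. -/
def IsL2Projection (α : ℝ) (r : ℕ) (Δx : ℝ) (u₀ u : ℝ → ℝ) : Prop :=
  u ∈ feSpace α r Δx ∧ ∀ v ∈ feSpace α r Δx, dot u v = dot u₀ v

/-- `u'` is a Crank-Nicolson Galerkin step from `u`: with `w = (u' + u)/2`,
`⟨u', φv⟩ - Δt⟨w²/2, (φv)ₓ⟩ + Δt⟨D^{α/2}w, D^{α/2}(φv)ₓ⟩ = ⟨u, φv⟩` for all `v ∈ S_{Δx}`. -/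
def IsSchemeStep (α : ℝ) (r : ℕ) (φ : ℝ → ℝ) (Δx Δt : ℝ) (u u' : ℝ → ℝ) : Prop :=
  u' ∈ feSpace α r Δx ∧ ∀ v ∈ feSpace α r Δx,
    dot u' (fun x => φ x * v x)
      - Δt * dot (fun x => ((u' x + u x) / 2) ^ 2 / 2) (deriv (fun x => φ x * v x))
      + Δt * dot (fracD (α / 2) (fun x => (u' x + u x) / 2))
          (fracD (α / 2) (deriv (fun x => φ x * v x)))
      = dot u (fun x => φ x * v x)

/-- `w⁰, w¹, …` are the iterates by which a time step starting from `u` is solved: `w⁰ = u` and,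
for all `v ∈ S_{Δx}`, `⟨w^{ℓ+1}, φv⟩ - (Δt/2)⟨((w^ℓ + u)/2)², (φv)ₓ⟩
  + Δt⟨D^{α/2}((w^{ℓ+1} + u)/2), D^{α/2}(φv)ₓ⟩ = ⟨u, φv⟩`. -/
def IsIteration (α : ℝ) (r : ℕ) (φ : ℝ → ℝ) (Δx Δt : ℝ) (u : ℝ → ℝ) (w : ℕ → ℝ → ℝ) : Prop :=
  w 0 = u ∧ ∀ l : ℕ, w (l + 1) ∈ feSpace α r Δx ∧ ∀ v ∈ feSpace α r Δx,
    dot (w (l + 1)) (fun x => φ x * v x)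
      - Δt / 2 * dot (fun x => ((w l x + u x) / 2) ^ 2) (deriv (fun x => φ x * v x))
      + Δt * dot (fracD (α / 2) (fun x => (w (l + 1) x + u x) / 2))
          (fracD (α / 2) (deriv (fun x => φ x * v x)))
      = dot u (fun x => φ x * v x)

/-- `(uⁿ)` is the numerical solution with initial datum `u₀` up to time `T`: `u⁰` is the projection
of `u₀`, and for all `n` with `(n + 1/2)Δt ≤ T` the function `u^{n+1}` solves the implicit scheme
and is the `L²`-limit of the iteration that starts from `uⁿ`. -/
def IsNumericalSolution (α : ℝ) (r : ℕ) (φ : ℝ → ℝ) (Δx Δt T : ℝ) (u₀ : ℝ → ℝ)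
    (u : ℕ → ℝ → ℝ) : Prop :=
  IsL2Projection α r Δx u₀ (u 0) ∧
  ∀ n : ℕ, ((n : ℝ) + 1 / 2) * Δt ≤ T →
    IsSchemeStep α r φ Δx Δt (u n) (u (n + 1)) ∧
    ∃ w : ℕ → ℝ → ℝ, IsIteration α r φ Δx Δt (u n) w ∧
      Tendsto (fun l => eLpNorm (fun x => w l x - u (n + 1) x) 2 volume) atTop (𝓝 0)

end

end FracKdV

/-! The proof is a local smoothing energy argument. Testing a time step with its midpoint w =
u^{n+1/2}, and writing E(u) = ⟨u, φu⟩ (which controls ‖u‖² because φ ≥ 1), one finds E(u^{n+1}) -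
E(u^n) = Δt ((2/3) ∫ φₓ w³ - 2 ⟨D^{α/2} w, D^{α/2} (φw)ₓ⟩). Two estimates, with constants
independent of the mesh, close this identity.

The dispersive term gains half of α derivatives where φₓ > 0 (`le_dot_fracD`): it is at least
(1+α)/2 ∫ φₓ (D^{α/2} w)² - C ‖w‖². On the Fourier side the symmetrised form has the symbol ξ|ξ|^α -
η|η|^α, and subtracting (1+α)(ξ-η)|ξ|^{α/2}|η|^{α/2} leaves at most 7|ξ-η|^{1+α} (`abs_symRem_le`).
The remainder is therefore a kernel dominated by an integrable function of ξ-η, and Schur's test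
bounds it on L². As φ is not compactly supported, this is done for φ(x) - φ(x-n), and n tends to
infinity.

The cubic term is absorbed by this gain (`IsCutoff.abs_integral_cube_le`). With χ = √φₓ it is ∫
(χw)² w, which an H^{3/8} norm of χw and the L² norm of w control. Since 3/8 < 1/2 ≤ α/2,
interpolation makes the coefficient of ‖D^{α/2}(χw)‖² as small as wanted, and commuting D^{α/2} with
χ costs only ‖w‖².

Together, E(u^{n+1}) + Δt ∫ φₓ (D^{α/2} w)² ≤ E(u^n) + Δt C' as long as the functions involved stay
in a fixed ball (`StepHyp.energy_step`). With N² = (2+2R) M² + 1 for an initial norm M, and T so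
small that the total growth is at most 1, induction keeps E below N² up to time T and bounds the sum
of the smoothing terms.

Solvability of a step uses the CFL condition, which says that Δt ‖(φv)ₓ‖_∞ ≤ ε ‖v‖ with εN ≤ 1/8.
The linear problem for each iterate is solved by Lax–Milgram, the iterates stay in the ball of
radius 2N and the iteration contracts (`StepHyp.iterate_bound`, `StepHyp.contraction`). The same
argument bounds any limit of the iteration, so the estimates hold for every numerical solution.

All of this needs a concrete description of S_{Δx}. A piecewise polynomial in L² lies in H^σ for
every σ < 1/2, while a jump excludes it from H^{1/2}. Hence H^{1+α} regularity amounts to continuity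
of v and vₓ at the nodes, and of vₓₓ when α ≥ 3/2 (`exists_feRep`, `FERep.mem_feSpace`). These are
conditions on coefficients, which give closedness in L² and the inverse inequalities. -/

namespace FracKdV

/-! ### The L² Fourier transform as a relation between functions. -/

section

open scoped ComplexConjugate

/-- `F` represents the `L²` Fourier transform of the square integrable function `f`. -/
def IsFT (f F : ℝ → ℂ) : Prop :=
  ∃ h : MemLp f 2 (volume : Measure ℝ), F =ᵐ[volume] (𝓕 (h.toLp f) : Lp ℂ 2 (volume : Measure ℝ))

namespace IsFT

variable {f g F G : ℝ → ℂ}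

theorem memLp_left (h : IsFT f F) : MemLp f 2 volume := h.1

theorem memLp_right (h : IsFT f F) : MemLp F 2 volume :=
  (memLp_congr_ae h.2).2 (Lp.memLp _)

theorem exists_of_memLp (h : MemLp f 2 volume) : ∃ F, IsFT f F := ⟨_, h, ae_eq_rfl⟩

theorem exists_of_memLp_right (h : MemLp F 2 volume) : ∃ f, IsFT f F := by
  refine ⟨(𝓕⁻ (h.toLp F) : Lp ℂ 2 (volume : Measure ℝ)), Lp.memLp _, ?_⟩
  rw [Lp.toLp_coeFn, FourierTransform.fourier_fourierInv_eq]
  exact h.coeFn_toLp.symm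

theorem congr_right (h : IsFT f F) (hG : F =ᵐ[volume] G) : IsFT f G :=
  ⟨h.1, hG.symm.trans h.2⟩

theorem congr_left (h : IsFT f F) (hg : f =ᵐ[volume] g) : IsFT g F := by
  obtain ⟨hf, hF⟩ := h
  refine ⟨(memLp_congr_ae hg).1 hf, ?_⟩
  rwa [← (MemLp.toLp_eq_toLp_iff hf ((memLp_congr_ae hg).1 hf)).2 hg]

theorem unique_right (h : IsFT f F) (h' : IsFT f G) : F =ᵐ[volume] G :=
  h.2.trans h'.2.symm

theorem unique_left (h : IsFT f F) (h' : IsFT g F) : f =ᵐ[volume] g := by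
  obtain ⟨hf, hF⟩ := h
  obtain ⟨hg, hG⟩ := h'
  have h1 : (𝓕 (hf.toLp f) : Lp ℂ 2 (volume : Measure ℝ)) = 𝓕 (hg.toLp g) :=
    Lp.ext (hF.symm.trans hG)
  have h2 := congrArg (fun u : Lp ℂ 2 (volume : Measure ℝ) => 𝓕⁻ u) h1
  simp only [FourierTransform.fourierInv_fourier_eq] at h2
  exact (MemLp.toLp_eq_toLp_iff hf hg).1 h2

theorem add (h : IsFT f F) (h' : IsFT g G) : IsFT (fun x => f x + g x) (fun x => F x + G x) := by
  obtain ⟨hf, hF⟩ := h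
  obtain ⟨hg, hG⟩ := h'
  refine ⟨hf.add hg, ?_⟩
  change _ =ᵐ[volume] (𝓕 ((hf.add hg).toLp (f + g)) : Lp ℂ 2 (volume : Measure ℝ))
  rw [MemLp.toLp_add hf hg, FourierTransform.fourier_add]
  filter_upwards [hF, hG, Lp.coeFn_add (𝓕 (hf.toLp f) : Lp ℂ 2 (volume : Measure ℝ))
    (𝓕 (hg.toLp g))] with x h1 h2 h3
  rw [h3, h1, h2]; rfl

theorem const_mul (h : IsFT f F) (c : ℂ) : IsFT (fun x => c * f x) (fun x => c * F x) := by
  obtain ⟨hf, hF⟩ := h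
  refine ⟨hf.const_smul c, ?_⟩
  change _ =ᵐ[volume] (𝓕 ((hf.const_smul c).toLp (c • f)) : Lp ℂ 2 (volume : Measure ℝ))
  rw [MemLp.toLp_const_smul c hf, FourierTransform.fourier_smul]
  filter_upwards [hF, Lp.coeFn_smul c (𝓕 (hf.toLp f) : Lp ℂ 2 (volume : Measure ℝ))] with x h1 h3
  rw [h3, h1]; rfl

theorem sub (h : IsFT f F) (h' : IsFT g G) : IsFT (fun x => f x - g x) (fun x => F x - G x) := by
  have := h.add (h'.const_mul (-1))
  simpa [sub_eq_add_neg] using this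

theorem eLpNorm_eq (h : IsFT f F) : eLpNorm F 2 volume = eLpNorm f 2 volume := by
  obtain ⟨hf, hF⟩ := h
  rw [eLpNorm_congr_ae hF]
  have h1 := Lp.norm_fourier_eq (hf.toLp f)
  rw [Lp.norm_def, Lp.norm_def, ENNReal.toReal_eq_toReal_iff' (Lp.eLpNorm_ne_top _)
    (Lp.eLpNorm_ne_top _)] at h1
  rw [h1, eLpNorm_congr_ae hf.coeFn_toLp]

/-- Plancherel's identity. -/
theorem integral_mul_conj (h : IsFT f F) (h' : IsFT g G) :
    ∫ x, f x * conj (g x) = ∫ ξ, F ξ * conj (G ξ) := by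
  obtain ⟨hf, hF⟩ := h
  obtain ⟨hg, hG⟩ := h'
  have h1 := Lp.inner_fourier_eq (hg.toLp g) (hf.toLp f)
  rw [L2.inner_def, L2.inner_def] at h1
  simp only [RCLike.inner_apply] at h1
  have h2 : ∫ x, f x * conj (g x) = ∫ x, (hf.toLp f) x * conj ((hg.toLp g) x) := by
    apply integral_congr_ae
    filter_upwards [hf.coeFn_toLp, hg.coeFn_toLp] with x h3 h4
    rw [h3, h4]
  rw [h2, ← h1]
  apply integral_congr_ae
  filter_upwards [hF, hG] with x h3 h4
  rw [h3, h4]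

theorem integral_schwartz (h : IsFT f F) (s : 𝓢(ℝ, ℂ)) :
    ∫ x, (𝓕 s : 𝓢(ℝ, ℂ)) x * f x = ∫ x, s x * F x := by
  obtain ⟨hf, hF⟩ := h
  have h1 := congrArg (fun T : 𝓢'(ℝ, ℂ) => T s) (Lp.fourier_toTemperedDistribution_eq (hf.toLp f))
  simp only [TemperedDistribution.fourier_apply, Lp.toTemperedDistribution_apply, smul_eq_mul] at h1
  have h2 : ∫ x, (𝓕 s : 𝓢(ℝ, ℂ)) x * f x = ∫ x, (𝓕 s : 𝓢(ℝ, ℂ)) x * hf.toLp f x := by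
    apply integral_congr_ae
    filter_upwards [hf.coeFn_toLp] with x h3
    rw [h3]
  rw [h2, h1]
  apply integral_congr_ae
  filter_upwards [hF] with x h3
  rw [h3]

end IsFT

/-- Locally integrable functions are determined by their integrals against Schwartz functions. -/
theorem ae_eq_of_integral_schwartz {F G : ℝ → ℂ} (hF : LocallyIntegrable F volume)
    (hG : LocallyIntegrable G volume) (h : ∀ s : 𝓢(ℝ, ℂ), ∫ x, s x * F x = ∫ x, s x * G x) :
    F =ᵐ[volume] G := by
  have h0 : ∀ᵐ x, (F - G) x = 0 := by
    apply ae_eq_zero_of_integral_contDiff_smul_eq_zero (hF.sub hG)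
    intro g g_smooth g_cpt
    have hg₁ : HasCompactSupport (Complex.ofRealCLM ∘ g) := g_cpt.comp_left rfl
    have hg₂ : ContDiff ℝ ∞ (Complex.ofRealCLM ∘ g) := by fun_prop
    have h1 := h (hg₁.toSchwartzMap hg₂)
    simp only [HasCompactSupport.toSchwartzMap_toFun, Function.comp_apply, Complex.ofRealCLM_apply] at h1
    have e1 := hF.integrable_smul_left_of_hasCompactSupport g_smooth.continuous g_cpt
    have e2 := hG.integrable_smul_left_of_hasCompactSupport g_smooth.continuous g_cpt
    simp only [Complex.real_smul] at e1 e2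
    simp only [Pi.sub_apply, Complex.real_smul, mul_sub]
    rw [integral_sub e1 e2]
    rw [sub_eq_zero]; exact h1
  filter_upwards [h0] with x hx
  simpa [sub_eq_zero] using hx

/-- The multiplication formula determines the transform. As `F` is only assumed locally integrable,
its square integrability is part of the conclusion; this is how multipliers such as ξ are seen to
map into L². -/
theorem IsFT.of_integral_schwartz {f F : ℝ → ℂ} (hf : MemLp f 2 volume)
    (hF : LocallyIntegrable F volume)
    (h : ∀ s : 𝓢(ℝ, ℂ), ∫ x, (𝓕 s : 𝓢(ℝ, ℂ)) x * f x = ∫ x, s x * F x) : IsFT f F := by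
  obtain ⟨G, hG⟩ := IsFT.exists_of_memLp hf
  refine hG.congr_right ?_
  apply ae_eq_of_integral_schwartz (hG.memLp_right.locallyIntegrable (by norm_num)) hF
  intro s
  rw [← hG.integral_schwartz, h s]

/-- On `L¹ ∩ L²` the two Fourier transforms agree. -/
theorem IsFT.of_integrable {f : ℝ → ℂ} (hf : MemLp f 2 volume) (hf1 : Integrable f volume) :
    IsFT f (𝓕 f) := by
  apply IsFT.of_integral_schwartz hf
  · apply Continuous.locallyIntegrable
    exact VectorFourier.fourierIntegral_continuous Real.continuous_fourierChar
      (by exact continuous_inner) hf1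
  · intro s
    have := VectorFourier.integral_fourierIntegral_smul_eq_flip (μ := (volume : Measure ℝ))
      (ν := (volume : Measure ℝ)) (L := innerₗ ℝ)
      Real.continuous_fourierChar continuous_inner s.integrable hf1
    simp only [flip_innerₗ, smul_eq_mul] at this
    simp only [SchwartzMap.fourier_coe]
    exact this

/-- For spectra in L¹ ∩ L² this gives a representative defined by an absolutely convergent integral,
so that Fubini applies to products of such functions. -/
theorem IsFT.fourierInv_of_integrable {F : ℝ → ℂ} (hF : MemLp F 2 volume)
    (hF1 : Integrable F volume) : IsFT (𝓕⁻ F) F := by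
  obtain ⟨f, hf⟩ := IsFT.exists_of_memLp_right hF
  refine hf.congr_left ?_
  apply ae_eq_of_integral_schwartz (hf.memLp_left.locallyIntegrable (by norm_num))
  · apply Continuous.locallyIntegrable
    have : Continuous (fun x => 𝓕 F (-x)) := by
      have h1 : Continuous (𝓕 F) := VectorFourier.fourierIntegral_continuous
        Real.continuous_fourierChar (by exact continuous_inner) hF1
      exact h1.comp continuous_neg
    convert this using 1
    ext x
    exact Real.fourierInv_eq_fourier_neg F x
  · intro s
    have h1 := hf.integral_schwartz (𝓕⁻ s : 𝓢(ℝ, ℂ))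
    rw [FourierTransform.fourier_fourierInv_eq] at h1
    rw [h1]
    have := VectorFourier.integral_fourierIntegral_smul_eq_flip (μ := (volume : Measure ℝ))
      (ν := (volume : Measure ℝ)) (L := -innerₗ ℝ)
      Real.continuous_fourierChar (by exact (continuous_inner (𝕜 := ℝ) (E := ℝ)).neg) s.integrable hF1
    have e : (-innerₗ ℝ : ℝ →ₗ[ℝ] ℝ →ₗ[ℝ] ℝ).flip = -innerₗ ℝ := by
      ext; simp
    rw [e] at this
    simp only [smul_eq_mul] at this
    simp only [SchwartzMap.fourierInv_coe]
    exact this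

end

end FracKdV

/-! ### Square integrable derivatives and translates in Fourier space. -/

namespace FracKdV

section

open scoped ComplexConjugate

/-- `f` is continuous and has the derivative `g` off a countable set; both are square integrable. -/
structure L2Deriv (f g : ℝ → ℝ) : Prop where
  cont : Continuous f
  deriv : ∃ N : Set ℝ, N.Countable ∧ ∀ x ∉ N, HasDerivAt f (g x) x
  memLp : MemLp f 2 volume
  memLp_deriv : MemLp g 2 volume

/-- A continuous integrable function whose derivative off a countable set is `k` has `∫ k = 0`. -/
theorem integral_eq_zero_of_hasDerivAt_off_countable {E : Type*} [NormedAddCommGroup E]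
    [NormedSpace ℝ E] [CompleteSpace E] {h k : ℝ → E} (hc : Continuous h)
    {N : Set ℝ} (hN : N.Countable) (hd : ∀ x ∉ N, HasDerivAt h (k x) x)
    (hh : Integrable h) (hk : Integrable k) : ∫ x, k x = 0 := by
  have ftc : ∀ a b : ℝ, ∫ x in a..b, k x = h b - h a := fun a b =>
    integral_eq_of_hasDerivAt_off_countable h k hN hc.continuousOn
      (fun x hx => hd x hx.2) hk.intervalIntegrable
  -- The fundamental theorem of calculus gives limits at both ends, and an integrable function can
  -- only have the limit 0.
  have h1 : Tendsto h atTop (𝓝 (h 0 + ∫ x in Ioi (0 : ℝ), k x)) := by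
    have := (intervalIntegral_tendsto_integral_Ioi 0 hk.integrableOn tendsto_id).const_add (h 0)
    refine this.congr fun b => ?_
    rw [ftc]; simp
  have h2 : Tendsto h atBot (𝓝 (h 0 - ∫ x in Iic (0 : ℝ), k x)) := by
    have := (intervalIntegral_tendsto_integral_Iic 0 hk.integrableOn tendsto_id).const_sub (h 0)
    refine this.congr fun b => ?_
    rw [ftc]; simp
  have z1 : h 0 + ∫ x in Ioi (0 : ℝ), k x = 0 := by
    apply (hh.integrableAtFilter atTop).eq_zero_of_tendsto _ h1
    intro s hs
    obtain ⟨a, ha⟩ := mem_atTop_sets.1 hs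
    rw [eq_top_iff, ← Real.volume_Ici (a := a)]
    exact measure_mono fun x hx => ha x hx
  have z2 : h 0 - ∫ x in Iic (0 : ℝ), k x = 0 := by
    apply (hh.integrableAtFilter atBot).eq_zero_of_tendsto _ h2
    intro s hs
    obtain ⟨a, ha⟩ := mem_atBot_sets.1 hs
    rw [eq_top_iff, ← Real.volume_Iic (a := a)]
    exact measure_mono fun x hx => ha x hx
  rw [← intervalIntegral.integral_Iic_add_Ioi (b := 0) hk.integrableOn hk.integrableOn]
  have z3 : h 0 = ∫ x in Iic (0 : ℝ), k x := sub_eq_zero.1 z2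
  rw [← z3, z1]

namespace L2Deriv

variable {f g f' g' : ℝ → ℝ}

theorem ftc (h : L2Deriv f g) (a b : ℝ) : ∫ x in a..b, g x = f b - f a := by
  obtain ⟨N, hN, hd⟩ := h.deriv
  exact integral_eq_of_hasDerivAt_off_countable f g hN h.cont.continuousOn
    (fun x hx => hd x hx.2)
    (intervalIntegrable_iff.2 (((h.memLp_deriv.locallyIntegrable (by norm_num)).integrableOn_isCompact
      isCompact_uIcc).mono_set uIoc_subset_uIcc))

theorem hasDerivAt (h : L2Deriv f g) (hg : Continuous g) (x : ℝ) : HasDerivAt f (g x) x := by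
  have h1 : f = fun y => f 0 + ∫ t in (0 : ℝ)..y, g t := by
    ext y; rw [h.ftc]; ring
  rw [h1]
  exact (intervalIntegral.integral_hasDerivAt_right (hg.intervalIntegrable _ _)
    hg.stronglyMeasurable.stronglyMeasurableAtFilter hg.continuousAt).const_add _

/-- The Fourier transform of a derivative. -/
theorem isFT (h : L2Deriv f g) {F : ℝ → ℂ} (hF : IsFT (fun x => (f x : ℂ)) F) :
    IsFT (fun x => (g x : ℂ)) (fun ξ => 2 * Real.pi * Complex.I * ξ * F ξ) := by
  have hloc : LocallyIntegrable F volume := hF.memLp_right.locallyIntegrable (by norm_num)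
  have hloc' : LocallyIntegrable (fun ξ : ℝ => 2 * Real.pi * Complex.I * ξ * F ξ) volume := by
    have := (hloc.locallyIntegrableOn univ).continuousOn_smul isOpen_univ.isLocallyClosed
      (g := fun ξ : ℝ => (2 * Real.pi * Complex.I * ξ : ℂ)) (by fun_prop)
    rw [locallyIntegrableOn_univ] at this
    simpa using this
  apply IsFT.of_integral_schwartz h.memLp_deriv.ofReal hloc'
  intro s
  -- The symbol is moved to the test function: the derivative of `𝓕 s` is `-𝓕 m`, so the claim
  -- becomes an integration by parts without boundary terms.
  set m : 𝓢(ℝ, ℂ) := SchwartzMap.smulLeftCLM ℂ (fun ξ : ℝ => (2 * Real.pi * Complex.I * ξ : ℂ)) s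
    with hm
  have mval : ∀ ξ : ℝ, m ξ = 2 * Real.pi * Complex.I * ξ * s ξ := fun ξ => by
    rw [hm, SchwartzMap.smulLeftCLM_apply (by fun_prop)]; simp
  have hder : ∀ x : ℝ, HasDerivAt (𝓕 s : 𝓢(ℝ, ℂ)) (-(𝓕 m : 𝓢(ℝ, ℂ)) x) x := by
    intro x
    have := Real.hasDerivAt_fourier (f := s) s.integrable (by
      have := m.integrable (μ := volume)
      have h2 : Integrable (fun ξ : ℝ => (2 * Real.pi * Complex.I)⁻¹ * m ξ) := this.const_mul _
      refine h2.congr (ae_of_all _ fun ξ => ?_)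
      simp only [mval, Complex.real_smul]
      have : (2 * Real.pi * Complex.I : ℂ) ≠ 0 := by simp [Real.pi_ne_zero]
      field_simp) x
    suffices e : -(𝓕 m : 𝓢(ℝ, ℂ)) x
        = 𝓕 (fun x : ℝ => (-2 * Real.pi * Complex.I * x : ℂ) • s x) x by
      rw [e]; exact this
    rw [SchwartzMap.fourier_coe, Real.fourier_eq, Real.fourier_eq, ← integral_neg]
    congr 1
    ext ξ
    simp [mval, Circle.smul_def]
  obtain ⟨N, hN, hd⟩ := h.deriv
  have i1 : Integrable (fun x => (𝓕 s : 𝓢(ℝ, ℂ)) x * (g x : ℂ)) :=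
    ((𝓕 s : 𝓢(ℝ, ℂ)).memLp 2 volume).integrable_mul h.memLp_deriv.ofReal
  have i2 : Integrable (fun x => -(𝓕 m : 𝓢(ℝ, ℂ)) x * (f x : ℂ)) :=
    ((𝓕 m : 𝓢(ℝ, ℂ)).memLp 2 volume).neg.integrable_mul h.memLp.ofReal
  have i3 : Integrable (fun x => (𝓕 s : 𝓢(ℝ, ℂ)) x * (f x : ℂ)) :=
    ((𝓕 s : 𝓢(ℝ, ℂ)).memLp 2 volume).integrable_mul h.memLp.ofReal
  have key := integral_eq_zero_of_hasDerivAt_off_countable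
    (h := fun x => (𝓕 s : 𝓢(ℝ, ℂ)) x * (f x : ℂ))
    (k := fun x => -(𝓕 m : 𝓢(ℝ, ℂ)) x * (f x : ℂ) + (𝓕 s : 𝓢(ℝ, ℂ)) x * (g x : ℂ))
    ((𝓕 s : 𝓢(ℝ, ℂ)).continuous.mul (Complex.continuous_ofReal.comp h.cont)) hN
    (fun x hx => (hder x).mul (hd x hx).ofReal_comp) i3 (i2.add i1)
  rw [integral_add i2 i1] at key
  have h3 := hF.integral_schwartz m
  simp only [neg_mul, integral_neg, mval] at key h3
  rw [neg_add_eq_zero] at key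
  change ∫ x, (𝓕 s : 𝓢(ℝ, ℂ)) x * (g x : ℂ) = _
  rw [← key, h3]
  congr 1
  ext ξ
  ring

end L2Deriv

/-- This allows L² norms of differences v(x+h) - v(x) to be read off from the spectrum, which is how
the regularity of piecewise polynomials is measured. -/
theorem IsFT.comp_add_right {f F : ℝ → ℂ} (hF : IsFT f F) (h : ℝ) :
    IsFT (fun x => f (x + h)) (fun ξ => Complex.exp (2 * Real.pi * Complex.I * h * ξ) * F ξ) := by
  have hloc : LocallyIntegrable F volume := hF.memLp_right.locallyIntegrable (by norm_num)
  have hloc' : LocallyIntegrable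
      (fun ξ : ℝ => Complex.exp (2 * Real.pi * Complex.I * h * ξ) * F ξ) volume := by
    have := (hloc.locallyIntegrableOn univ).continuousOn_smul isOpen_univ.isLocallyClosed
      (g := fun ξ : ℝ => Complex.exp (2 * Real.pi * Complex.I * h * ξ)) (by fun_prop)
    rw [locallyIntegrableOn_univ] at this
    simpa using this
  apply IsFT.of_integral_schwartz
    (hF.memLp_left.comp_measurePreserving (measurePreserving_add_right volume h)) hloc'
  intro s
  set u : 𝓢(ℝ, ℂ) := (𝓕 s : 𝓢(ℝ, ℂ)).compSubConstCLM ℂ h with hu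
  have uval : ∀ x, u x = (𝓕 s : 𝓢(ℝ, ℂ)) (x - h) := fun x => by
    rw [hu, SchwartzMap.compSubConstCLM_apply]
  have h1 := hF.integral_schwartz (𝓕⁻ u)
  rw [FourierTransform.fourier_fourierInv_eq] at h1
  have h2 : ∀ ξ : ℝ, (𝓕⁻ u : 𝓢(ℝ, ℂ)) ξ = Complex.exp (2 * Real.pi * Complex.I * h * ξ) * s ξ := by
    intro ξ
    have e : s ξ = (𝓕⁻ (𝓕 s : 𝓢(ℝ, ℂ)) : 𝓢(ℝ, ℂ)) ξ := by
      rw [FourierTransform.fourierInv_fourier_eq]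
    rw [e, SchwartzMap.fourierInv_coe, SchwartzMap.fourierInv_coe, Real.fourierInv_eq',
      Real.fourierInv_eq', ← integral_add_right_eq_self _ h, ← integral_const_mul]
    congr 1
    ext x
    simp only [uval, add_sub_cancel_right, smul_eq_mul, ← mul_assoc, ← Complex.exp_add]
    congr 2
    simp
    ring
  have h3 : ∫ x, (𝓕 s : 𝓢(ℝ, ℂ)) x * f (x + h) = ∫ x, u x * f x := by
    rw [← integral_add_right_eq_self (fun x => u x * f x) h]
    congr 1
    ext x
    rw [uval]; simp
  change ∫ x, (𝓕 s : 𝓢(ℝ, ℂ)) x * f (x + h) = _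
  rw [h3, h1]
  congr 1
  ext ξ
  rw [h2]; ring

end

end FracKdV

/-! ### Sobolev spaces as weighted L² spaces, and the fractional derivative. -/

namespace FracKdV

section

open scoped ComplexConjugate

/-- Both descriptions are equalities of tempered distributions after multiplication by the weight;
since the functions are locally integrable, testing against Schwartz functions identifies them
almost everywhere. -/
theorem memH_iff {s : ℝ} {v : ℝ → ℝ} : MemH s v ↔
    ∃ F : ℝ → ℂ, IsFT (fun x => (v x : ℂ)) F ∧
      MemLp (fun ξ : ℝ => (((1 + ‖ξ‖ ^ 2) ^ (s / 2) : ℝ) : ℂ) * F ξ) 2 volume := by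
  have hw : Function.HasTemperateGrowth
      (fun ξ : ℝ => (((1 + ‖ξ‖ ^ 2) ^ (s / 2) : ℝ) : ℂ)) := by fun_prop
  have hloc : ∀ F : ℝ → ℂ, MemLp F 2 volume →
      LocallyIntegrable (fun ξ : ℝ => (((1 + ‖ξ‖ ^ 2) ^ (s / 2) : ℝ) : ℂ) * F ξ) volume := by
    intro F hF
    have h1 : LocallyIntegrable F volume := hF.locallyIntegrable (by norm_num)
    have := (h1.locallyIntegrableOn univ).continuousOn_smul isOpen_univ.isLocallyClosed
      (g := fun ξ : ℝ => (((1 + ‖ξ‖ ^ 2) ^ (s / 2) : ℝ) : ℂ)) hw.1.continuous.continuousOn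
    rw [locallyIntegrableOn_univ] at this
    simpa using this
  constructor
  · rintro ⟨h, hs⟩
    obtain ⟨f', hf'⟩ := TemperedDistribution.memSobolev_iff_exists_smulLeftCLM_fourier.1 hs
    refine ⟨_, ⟨h, ae_eq_rfl⟩, (memLp_congr_ae ?_).2 (Lp.memLp f')⟩
    apply ae_eq_of_integral_schwartz (hloc _ (Lp.memLp _))
      ((Lp.memLp f').locallyIntegrable (by norm_num))
    intro g
    have h1 := congrArg (fun T : 𝓢'(ℝ, ℂ) => T g) hf'
    simp only [Lp.fourier_toTemperedDistribution_eq, TemperedDistribution.smulLeftCLM_apply_apply,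
      Lp.toTemperedDistribution_apply, SchwartzMap.smulLeftCLM_apply hw, smul_eq_mul] at h1
    rw [← h1]
    congr 1
    ext x
    ring
  · rintro ⟨F, ⟨h, hF⟩, hm⟩
    refine ⟨h, TemperedDistribution.memSobolev_iff_exists_smulLeftCLM_fourier.2 ⟨hm.toLp _, ?_⟩⟩
    ext g
    simp only [Lp.fourier_toTemperedDistribution_eq, TemperedDistribution.smulLeftCLM_apply_apply,
      Lp.toTemperedDistribution_apply, SchwartzMap.smulLeftCLM_apply hw, smul_eq_mul]
    apply integral_congr_ae
    filter_upwards [hF, hm.coeFn_toLp] with x h1 h2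
    rw [h2, ← h1]
    ring

/-- `F` is square integrable against the weight `(1 + ξ²)^s`. -/
def WeightL2 (s : ℝ) (F : ℝ → ℂ) : Prop :=
  MemLp (fun ξ : ℝ => (((1 + ‖ξ‖ ^ 2) ^ (s / 2) : ℝ) : ℂ) * F ξ) 2 volume

namespace WeightL2

variable {s t C : ℝ} {F : ℝ → ℂ} {m : ℝ → ℂ}

theorem aestronglyMeasurable (h : WeightL2 s F) : AEStronglyMeasurable F volume := by
  have h1 : AEStronglyMeasurable (fun ξ : ℝ => (((1 + ‖ξ‖ ^ 2) ^ (-(s / 2)) : ℝ) : ℂ) *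
      ((((1 + ‖ξ‖ ^ 2) ^ (s / 2) : ℝ) : ℂ) * F ξ)) volume := by
    apply AEStronglyMeasurable.mul _ h.1
    exact (by fun_prop : Measurable fun ξ : ℝ =>
      (((1 + ‖ξ‖ ^ 2) ^ (-(s / 2)) : ℝ) : ℂ)).aestronglyMeasurable
  refine h1.congr (ae_of_all _ fun ξ => ?_)
  have h2 : (0 : ℝ) < 1 + ‖ξ‖ ^ 2 := by positivity
  simp only [← mul_assoc, ← Complex.ofReal_mul, ← Real.rpow_add h2]
  simp

theorem memLp_mul (h : WeightL2 s F) (hm : Measurable m)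
    (hb : ∀ ξ, ‖m ξ‖ ≤ C * (1 + ‖ξ‖ ^ 2) ^ (s / 2)) : MemLp (fun ξ => m ξ * F ξ) 2 volume := by
  refine MemLp.of_le_mul (c := C) h (hm.aestronglyMeasurable.mul h.aestronglyMeasurable)
    (ae_of_all _ fun ξ => ?_)
  have h2 : (0 : ℝ) ≤ (1 + ‖ξ‖ ^ 2) ^ (s / 2) := by positivity
  rw [norm_mul, norm_mul, Complex.norm_real, Real.norm_of_nonneg h2, ← mul_assoc]
  gcongr
  exact hb ξ

/-- Cauchy–Schwarz against (1+ξ²)^{-(s-t)/2}, which is square integrable because s - t > 1/2. -/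
theorem integrable_mul (h : WeightL2 s F) (hm : Measurable m)
    (hb : ∀ ξ, ‖m ξ‖ ≤ C * (1 + ‖ξ‖ ^ 2) ^ (t / 2)) (hst : 1 / 2 < s - t) :
    Integrable (fun ξ => m ξ * F ξ) volume := by
  have hk : MemLp (fun ξ : ℝ => (1 + ‖ξ‖ ^ 2) ^ (-((s - t) / 2))) 2 volume := by
    rw [memLp_two_iff_integrable_sq
      (by fun_prop : Measurable fun ξ : ℝ => (1 + ‖ξ‖ ^ 2) ^ (-((s - t) / 2))).aestronglyMeasurable]
    have := integrable_rpow_neg_one_add_norm_sq (E := ℝ) (μ := volume) (r := 2 * (s - t))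
      (by simp; linarith)
    refine this.congr (ae_of_all _ fun ξ => ?_)
    simp only
    rw [← Real.rpow_natCast ((1 + ‖ξ‖ ^ 2) ^ _), ← Real.rpow_mul (by positivity)]
    congr 1
    push_cast
    ring
  have hprod := hk.integrable_mul h.norm
  refine (hprod.const_mul C).mono' (hm.aestronglyMeasurable.mul h.aestronglyMeasurable)
    (ae_of_all _ fun ξ => ?_)
  have h2 : (0 : ℝ) < 1 + ‖ξ‖ ^ 2 := by positivity
  simp only [Pi.mul_apply, norm_mul, Complex.norm_real]
  rw [Real.norm_of_nonneg (by positivity : (0 : ℝ) ≤ (1 + ‖ξ‖ ^ 2) ^ (s / 2)), ← mul_assoc,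
    ← mul_assoc]
  gcongr
  refine (hb ξ).trans (le_of_eq ?_)
  rw [mul_assoc, ← Real.rpow_add h2]
  congr 2
  ring

theorem mono (h : WeightL2 s F) (hts : t ≤ s) : WeightL2 t F := by
  apply h.memLp_mul (C := 1) (by fun_prop)
  intro ξ
  rw [Complex.norm_real, Real.norm_of_nonneg (by positivity), one_mul]
  exact Real.rpow_le_rpow_of_exponent_le (by nlinarith [sq_nonneg ‖ξ‖]) (by linarith)

theorem memLp (h : WeightL2 s F) (hs : 0 ≤ s) : MemLp F 2 volume := by
  have := h.mono hs
  simpa [WeightL2] using this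

theorem integrable (h : WeightL2 s F) (hs : 1 / 2 < s) : Integrable F volume := by
  have := h.integrable_mul (m := fun _ => 1) (t := 0) (C := 1) (by fun_prop) (by simp) (by simpa using hs)
  simpa using this

end WeightL2

theorem norm_rpow_weight_le {σ t ξ : ℝ} (hσ : 0 ≤ σ) (h : σ ≤ t) :
    ‖(((2 * Real.pi * |ξ|) ^ σ : ℝ) : ℂ)‖ ≤ (2 * Real.pi) ^ σ * (1 + ‖ξ‖ ^ 2) ^ (t / 2) := by
  rw [Complex.norm_real, Real.norm_of_nonneg (by positivity),
    Real.mul_rpow (by positivity) (abs_nonneg _)]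
  gcongr
  have h1 : |ξ| ≤ (1 + ‖ξ‖ ^ 2) ^ (1 / 2 : ℝ) := by
    rw [← Real.sqrt_eq_rpow]
    apply Real.le_sqrt_of_sq_le
    rw [Real.norm_eq_abs]; linarith
  calc |ξ| ^ σ ≤ ((1 + ‖ξ‖ ^ 2) ^ (1 / 2 : ℝ)) ^ σ := by gcongr
    _ = (1 + ‖ξ‖ ^ 2) ^ (σ / 2) := by
        rw [← Real.rpow_mul (by positivity)]; congr 1; ring
    _ ≤ _ := Real.rpow_le_rpow_of_exponent_le (by nlinarith [sq_nonneg ‖ξ‖]) (by linarith)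

/-- The symbol of `D^σ`. -/
noncomputable def dsym (σ : ℝ) (ξ : ℝ) : ℂ := (((2 * Real.pi * |ξ|) ^ σ : ℝ) : ℂ)

theorem measurable_dsym (σ : ℝ) : Measurable (dsym σ) := by unfold dsym; fun_prop

theorem fracDLp_isFT {σ : ℝ} {v : ℝ → ℝ} {F : ℝ → ℂ} (h : IsFT (fun x => (v x : ℂ)) F)
    (hm : MemLp (fun ξ => dsym σ ξ * F ξ) 2 volume) :
    IsFT (fracDLp σ v) (fun ξ => dsym σ ξ * F ξ) := by
  obtain ⟨hv, hF⟩ := h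
  have e : (fun ξ => dsym σ ξ * F ξ) =ᵐ[volume] (fun ξ : ℝ => (((2 * Real.pi * |ξ|) ^ σ : ℝ) : ℂ) *
        (𝓕 (hv.toLp (fun x => (v x : ℂ))) : Lp ℂ 2 (volume : Measure ℝ)) ξ) := by
    filter_upwards [hF] with ξ h1
    rw [h1, dsym]
  have hm' := (memLp_congr_ae e).1 hm
  have e2 : fracDLp σ v = 𝓕⁻ (hm'.toLp _) := by
    rw [fracDLp, dif_pos hv, dif_pos hm']
  refine ⟨Lp.memLp _, ?_⟩
  rw [Lp.toLp_coeFn, e2, FourierTransform.fourier_fourierInv_eq]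
  exact e.trans hm'.coeFn_toLp.symm

theorem conj_fourierInv {F : ℝ → ℂ} (x : ℝ) :
    conj (𝓕⁻ F x) = 𝓕⁻ (fun ξ => conj (F (-ξ))) x := by
  rw [Real.fourierInv_eq', Real.fourierInv_eq', ← integral_conj, ← integral_neg_eq_self]
  congr 1
  ext ξ
  simp only [smul_eq_mul, map_mul, ← Complex.exp_conj]
  congr 2
  simp [Complex.conj_ofNat]

/-- The Fourier transform of a real function is Hermitian. -/
theorem IsFT.hermitian {v : ℝ → ℝ} {F : ℝ → ℂ} (h : IsFT (fun x => (v x : ℂ)) F)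
    (hF : Integrable F volume) : (fun ξ => conj (F (-ξ))) =ᵐ[volume] F := by
  have m2 : MemLp (fun ξ => conj (F (-ξ))) 2 volume := by
    have := (h.memLp_right.comp_measurePreserving (Measure.measurePreserving_neg volume)).star
    exact this
  have i2 : Integrable (fun ξ => conj (F (-ξ))) volume := by
    have := (memLp_one_iff_integrable.2 hF.comp_neg).star
    exact memLp_one_iff_integrable.1 this
  have h1 := IsFT.fourierInv_of_integrable m2 i2
  have h2 : (𝓕⁻ (fun ξ => conj (F (-ξ)))) =ᵐ[volume] (fun x => (v x : ℂ)) := by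
    filter_upwards [h.unique_left (IsFT.fourierInv_of_integrable h.memLp_right hF)] with x hx
    rw [← conj_fourierInv, ← hx, Complex.conj_ofReal]
  exact (h1.congr_left h2).unique_right h

/-- Taking the real part loses nothing: the symbol is real and even and the transform of a real
function is Hermitian, so the inverse transform is already real. -/
theorem fracD_ae_eq {σ : ℝ} {v : ℝ → ℝ} {F : ℝ → ℂ} (h : IsFT (fun x => (v x : ℂ)) F)
    (hF : Integrable F volume) (hm : MemLp (fun ξ => dsym σ ξ * F ξ) 2 volume)
    (hi : Integrable (fun ξ => dsym σ ξ * F ξ) volume) :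
    (fun x => (fracD σ v x : ℂ)) =ᵐ[volume] 𝓕⁻ (fun ξ => dsym σ ξ * F ξ) ∧
    (fun x => (fracD σ v x : ℂ)) =ᵐ[volume] fracDLp σ v := by
  have h1 := (fracDLp_isFT h hm).unique_left (IsFT.fourierInv_of_integrable hm hi)
  have h2 : ∀ x, conj (𝓕⁻ (fun ξ => dsym σ ξ * F ξ) x) = 𝓕⁻ (fun ξ => dsym σ ξ * F ξ) x := by
    intro x
    rw [conj_fourierInv]
    apply Real.fourierInv_congr_ae
    filter_upwards [h.hermitian hF] with ξ hξ
    rw [← hξ]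
    simp [dsym]
  have h3 : (fun x => (fracD σ v x : ℂ)) =ᵐ[volume] 𝓕⁻ (fun ξ => dsym σ ξ * F ξ) := by
    filter_upwards [h1] with x hx
    rw [fracD, hx]
    exact Complex.conj_eq_iff_re.1 (h2 x)
  exact ⟨h3, h3.trans h1.symm⟩

end

end FracKdV

/-! ### Polynomials of bounded degree on one cell. -/

namespace FracKdV

section

open Polynomial

theorem integral_sq_pos {a b : ℝ} (hab : a < b) {p : ℝ[X]} (hp : p ≠ 0) :
    0 < ∫ x in a..b, p.eval x ^ 2 := by
  obtain ⟨x, hx, hx0⟩ : ∃ x ∈ Icc a b, p.eval x ≠ 0 := by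
    by_contra! h
    exact hp (p.eq_zero_of_infinite_isRoot ((Icc_infinite hab).mono h))
  exact intervalIntegral.integral_pos hab (by fun_prop) (fun _ _ => sq_nonneg _)
    ⟨x, hx, by positivity⟩

/-- On polynomials of bounded degree, the coefficients are controlled by the `L²` norm on any
nondegenerate interval. -/
theorem exists_coeff_sq_le (r : ℕ) {a b : ℝ} (hab : a < b) : ∃ C : ℝ, 0 ≤ C ∧
    ∀ p : ℝ[X], p.natDegree ≤ r → ∀ i, p.coeff i ^ 2 ≤ C * ∫ x in a..b, p.eval x ^ 2 := by
  let Φ : (Fin (r + 1) → ℝ) → ℝ[X] := fun c => ∑ i, Polynomial.C (c i) * X ^ (i : ℕ)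
  have Φcoeff : ∀ c (i : Fin (r + 1)), (Φ c).coeff i = c i := by
    intro c i
    simp only [Φ, finsetSum_coeff, coeff_C_mul, coeff_X_pow]
    rw [Finset.sum_eq_single i] <;> simp +contextual [Fin.ext_iff, eq_comm]
  have Φeval : ∀ c x, (Φ c).eval x = ∑ i, c i * x ^ (i : ℕ) := by
    intro c x; simp [Φ, eval_finsetSum]
  have hcont : Continuous fun c => ∫ x in a..b, (Φ c).eval x ^ 2 := by
    apply intervalIntegral.continuous_parametric_intervalIntegral_of_continuous'
    simp only [Function.uncurry_def, Φeval]
    fun_prop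
  -- The integral is a positive definite quadratic form in the coefficients, so its minimum on the
  -- compact unit sphere is positive; homogeneity extends the bound to all coefficient vectors.
  obtain ⟨c₀, hc₀, hmin⟩ := (isCompact_sphere (0 : Fin (r + 1) → ℝ) 1).exists_isMinOn
    (NormedSpace.sphere_nonempty.2 zero_le_one) hcont.continuousOn
  set μ := ∫ x in a..b, (Φ c₀).eval x ^ 2 with hμ
  have μpos : 0 < μ := by
    apply integral_sq_pos hab
    intro h0
    have : c₀ = 0 := by
      ext i; rw [← Φcoeff c₀ i, h0]; simp
    rw [this] at hc₀
    simp at hc₀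
  refine ⟨μ⁻¹, by positivity, fun p hp i => ?_⟩
  rcases lt_or_ge r i with hi | hi
  · rw [coeff_eq_zero_of_natDegree_lt (by omega)]
    have : 0 ≤ ∫ x in a..b, p.eval x ^ 2 :=
      intervalIntegral.integral_nonneg hab.le fun x _ => sq_nonneg _
    have h2 : 0 ≤ μ⁻¹ := by positivity
    simpa using mul_nonneg h2 this
  let c : Fin (r + 1) → ℝ := fun i => p.coeff i
  have hpc : Φ c = p := by
    ext k
    rcases lt_or_ge r k with hk | hk
    · rw [coeff_eq_zero_of_natDegree_lt (p := p) (by omega)]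
      simp only [Φ, finsetSum_coeff, coeff_C_mul, coeff_X_pow]
      apply Finset.sum_eq_zero
      intro j _
      have := j.2
      simp; intro h; omega
    · exact Φcoeff c ⟨k, by omega⟩
  have hci : |p.coeff i| ≤ ‖c‖ := norm_le_pi_norm c ⟨i, by omega⟩
  have hle : μ * ‖c‖ ^ 2 ≤ ∫ x in a..b, p.eval x ^ 2 := by
    rcases eq_or_ne c 0 with h0 | h0
    · rw [h0]; simp
      exact intervalIntegral.integral_nonneg hab.le fun x _ => sq_nonneg _
    have hn : 0 < ‖c‖ := norm_pos_iff.2 h0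
    have h1 : μ ≤ ∫ x in a..b, (Φ (‖c‖⁻¹ • c)).eval x ^ 2 :=
      hmin (by simp [norm_smul, hn.ne'])
    have h2 : ∀ x, (Φ (‖c‖⁻¹ • c)).eval x ^ 2 = (‖c‖ ^ 2)⁻¹ * p.eval x ^ 2 := by
      intro x
      conv_rhs => rw [← hpc]
      simp only [Φeval, Pi.smul_apply, smul_eq_mul, mul_assoc, ← Finset.mul_sum]
      ring
    simp only [h2, intervalIntegral.integral_const_mul] at h1
    rw [inv_mul_eq_div, le_div_iff₀ (by positivity)] at h1
    exact h1
  calc p.coeff i ^ 2 = |p.coeff i| ^ 2 := (sq_abs _).symm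
    _ ≤ ‖c‖ ^ 2 := by gcongr
    _ = μ⁻¹ * (μ * ‖c‖ ^ 2) := by field_simp
    _ ≤ _ := by gcongr

/-- Inverse inequalities on one cell. -/
theorem exists_cell_bound (r : ℕ) : ∃ C : ℝ, 0 ≤ C ∧ ∀ p : ℝ[X], p.natDegree ≤ r →
    ∀ a d : ℝ, 0 < d → ∀ x ∈ Icc a (a + d),
      p.eval x ^ 2 ≤ C / d * ∫ t in a..(a + d), p.eval t ^ 2 ∧
      p.derivative.eval x ^ 2 ≤ C / d ^ 3 * ∫ t in a..(a + d), p.eval t ^ 2 := by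
  obtain ⟨C, hC, h⟩ := exists_coeff_sq_le r (zero_lt_one' ℝ)
  have key : ∀ q : ℝ[X], q.natDegree ≤ r → ∀ t ∈ Icc (0 : ℝ) 1,
      |q.eval t| ≤ ((r : ℝ) + 1) * √(C * ∫ x in (0 : ℝ)..1, q.eval x ^ 2) ∧
      |q.derivative.eval t| ≤ ((r : ℝ) + 1) ^ 2 * √(C * ∫ x in (0 : ℝ)..1, q.eval x ^ 2) := by
    intro q hq t ht
    set S := √(C * ∫ x in (0 : ℝ)..1, q.eval x ^ 2)
    have hS : ∀ i, |q.coeff i| ≤ S := fun i => Real.abs_le_sqrt (h q hq i)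
    have hS0 : 0 ≤ S := Real.sqrt_nonneg _
    have ht1 : ∀ n : ℕ, |t ^ n| ≤ 1 := fun n => by
      rw [abs_pow]
      exact pow_le_one₀ (abs_nonneg _) (abs_le.2 ⟨by linarith [ht.1], ht.2⟩)
    constructor
    · rw [eval_eq_sum_range' (Nat.lt_succ_of_le hq)]
      calc |∑ i ∈ Finset.range (r + 1), q.coeff i * t ^ i|
          ≤ ∑ i ∈ Finset.range (r + 1), |q.coeff i * t ^ i| := Finset.abs_sum_le_sum_abs _ _
        _ ≤ ∑ i ∈ Finset.range (r + 1), S := by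
            apply Finset.sum_le_sum
            intro i _
            rw [abs_mul]
            calc _ ≤ S * 1 := by gcongr; exacts [hS i, ht1 i]
              _ = S := mul_one _
        _ = _ := by simp
    · rw [derivative_eval, sum_over_range' _ (by simp) (r + 1) (Nat.lt_succ_of_le hq)]
      calc |∑ i ∈ Finset.range (r + 1), q.coeff i * i * t ^ (i - 1)|
          ≤ ∑ i ∈ Finset.range (r + 1), |q.coeff i * i * t ^ (i - 1)| :=
            Finset.abs_sum_le_sum_abs _ _
        _ ≤ ∑ i ∈ Finset.range (r + 1), ((r : ℝ) + 1) * S := by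
            apply Finset.sum_le_sum
            intro i hi
            rw [abs_mul, abs_mul, Nat.abs_cast]
            have hi' : (i : ℝ) ≤ r + 1 := by exact_mod_cast (Finset.mem_range.1 hi).le
            calc _ ≤ S * ((r : ℝ) + 1) * 1 := by gcongr; exacts [hS i, ht1 _]
              _ = _ := by ring
        _ = _ := by simp; ring
  -- Everything is rescaled to [0,1]. The fourth power is the square of the factor in the derivative
  -- bound; the values themselves need only the second power.
  refine ⟨((r : ℝ) + 1) ^ 4 * C, by positivity, fun p hp a d hd x hx => ?_⟩
  set q : ℝ[X] := p.comp (Polynomial.C a + Polynomial.C d * X) with hq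
  have hqr : q.natDegree ≤ r := by
    rw [hq, natDegree_comp]
    have : (Polynomial.C a + Polynomial.C d * X).natDegree ≤ 1 := by
      compute_degree
    calc _ ≤ r * 1 := Nat.mul_le_mul hp this
      _ = r := mul_one _
  have hqe : ∀ t, q.eval t = p.eval (a + d * t) := fun t => by simp [hq]
  have hqd : ∀ t, q.derivative.eval t = d * p.derivative.eval (a + d * t) := fun t => by
    rw [hq, derivative_comp]; simp
  have hint : ∫ t in (0 : ℝ)..1, q.eval t ^ 2 = d⁻¹ * ∫ t in a..(a + d), p.eval t ^ 2 := by
    simp only [hqe]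
    rw [intervalIntegral.integral_comp_add_mul (fun y => p.eval y ^ 2) hd.ne']
    simp
  set I := ∫ t in a..(a + d), p.eval t ^ 2 with hI
  have hI0 : 0 ≤ I := intervalIntegral.integral_nonneg (by linarith) fun _ _ => sq_nonneg _
  have ht : (x - a) / d ∈ Icc (0 : ℝ) 1 :=
    ⟨div_nonneg (by linarith [hx.1]) hd.le, (div_le_one hd).2 (by linarith [hx.2])⟩
  have hxe : a + d * ((x - a) / d) = x := by field_simp; ring
  obtain ⟨h1, h2⟩ := key q hqr _ ht
  rw [hqe, hxe, hint] at h1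
  rw [hqd, hxe, hint] at h2
  have hs : √(C * (d⁻¹ * I)) ^ 2 = C * (d⁻¹ * I) := Real.sq_sqrt (by positivity)
  constructor
  · calc p.eval x ^ 2 = |p.eval x| ^ 2 := (sq_abs _).symm
      _ ≤ (((r : ℝ) + 1) * √(C * (d⁻¹ * I))) ^ 2 := by gcongr
      _ = ((r : ℝ) + 1) ^ 2 * (C * (d⁻¹ * I)) := by rw [mul_pow, hs]
      _ ≤ ((r : ℝ) + 1) ^ 4 * (C * (d⁻¹ * I)) := by
          gcongr
          · linarith [(Nat.cast_nonneg r : (0 : ℝ) ≤ r)]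
          · norm_num
      _ = _ := by field_simp
  · have h3 : p.derivative.eval x ^ 2 = (d ^ 2)⁻¹ * |d * p.derivative.eval x| ^ 2 := by
      rw [sq_abs]; field_simp
    rw [h3]
    calc _ ≤ (d ^ 2)⁻¹ * (((r : ℝ) + 1) ^ 2 * √(C * (d⁻¹ * I))) ^ 2 := by gcongr
      _ = (d ^ 2)⁻¹ * (((r : ℝ) + 1) ^ 4 * (C * (d⁻¹ * I))) := by rw [mul_pow, hs]; ring
      _ = _ := by field_simp

end

end FracKdV

/-! ### Piecewise polynomials on the mesh and their L² norms. -/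

namespace FracKdV

section

open Polynomial

/-- The integral of `f²` as an extended real. -/
noncomputable def sqInt (f : ℝ → ℝ) : ENNReal := ∫⁻ x, ENNReal.ofReal (f x ^ 2)

theorem eLpNorm_sq (f : ℝ → ℝ) : eLpNorm f 2 volume ^ 2 = sqInt f := by
  rw [eLpNorm_eq_lintegral_rpow_enorm_toReal (by norm_num) (by norm_num), ← ENNReal.rpow_natCast,
    ← ENNReal.rpow_mul]
  simp only [ENNReal.toReal_ofNat, Nat.cast_ofNat, one_div]
  rw [inv_mul_cancel₀ (by norm_num), ENNReal.rpow_one, sqInt]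
  congr 1
  ext x
  rw [← ofReal_norm, ENNReal.ofReal_rpow_of_nonneg (norm_nonneg _) (by norm_num)]
  congr 1
  rw [Real.rpow_two, Real.norm_eq_abs, sq_abs]

theorem memLp_iff_sqInt {f : ℝ → ℝ} (hf : AEStronglyMeasurable f volume) :
    MemLp f 2 volume ↔ sqInt f < ⊤ := by
  rw [← eLpNorm_sq, MemLp]
  simp [hf]

theorem toReal_eLpNorm_sq {f : ℝ → ℝ} (hf : MemLp f 2 volume) :
    (eLpNorm f 2 volume).toReal ^ 2 = ∫ x, f x ^ 2 := by
  rw [← ENNReal.toReal_pow, eLpNorm_sq, sqInt,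
    ← integral_eq_lintegral_of_nonneg_ae (ae_of_all _ fun x => sq_nonneg _)
      (hf.1.pow 2)]

theorem sqInt_eq_ofReal {f : ℝ → ℝ} (hf : MemLp f 2 volume) :
    sqInt f = ENNReal.ofReal (∫ x, f x ^ 2) := by
  rw [← toReal_eLpNorm_sq hf, ENNReal.ofReal_pow ENNReal.toReal_nonneg,
    ENNReal.ofReal_toReal hf.2.ne, eLpNorm_sq]

/-- The function equal to the polynomial `P j` on the cell `[jΔ, (j+1)Δ)`. -/
noncomputable def pp (Δ : ℝ) (P : ℤ → ℝ[X]) (x : ℝ) : ℝ := (P ⌊x / Δ⌋).eval x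

/-- The polynomials of neighbouring cells agree at the common node. -/
def Matched (Δ : ℝ) (P : ℤ → ℝ[X]) : Prop :=
  ∀ j : ℤ, (P (j - 1)).eval (j * Δ) = (P j).eval (j * Δ)

variable {Δ : ℝ} {P : ℤ → ℝ[X]} {r : ℕ}

theorem floor_div_eq (hΔ : 0 < Δ) {j : ℤ} {x : ℝ} (hx : x ∈ Ico ((j : ℝ) * Δ) ((j + 1 : ℝ) * Δ)) :
    ⌊x / Δ⌋ = j := by
  rw [Int.floor_eq_iff, le_div_iff₀ hΔ, div_lt_iff₀ hΔ]
  exact hx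

theorem pp_eq (hΔ : 0 < Δ) {j : ℤ} {x : ℝ} (hx : x ∈ Ico ((j : ℝ) * Δ) ((j + 1 : ℝ) * Δ)) :
    pp Δ P x = (P j).eval x := by
  rw [pp, floor_div_eq hΔ hx]

theorem mem_cell (hΔ : 0 < Δ) (x : ℝ) :
    x ∈ Ico ((⌊x / Δ⌋ : ℝ) * Δ) ((⌊x / Δ⌋ + 1 : ℝ) * Δ) := by
  constructor
  · rw [← le_div_iff₀ hΔ]; exact Int.floor_le _
  · rw [← div_lt_iff₀ hΔ]; exact Int.lt_floor_add_one _

theorem measurable_pp : Measurable (pp Δ P) := by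
  have h : Measurable fun q : ℤ × ℝ => (P q.1).eval q.2 :=
    measurable_from_prod_countable_right fun j => (P j).continuous.measurable
  exact h.comp ((Int.measurable_floor.comp (measurable_id.div_const Δ)).prodMk measurable_id)

theorem lintegral_cells (hΔ : 0 < Δ) (f : ℝ → ENNReal) :
    ∫⁻ x, f x = ∑' j : ℤ, ∫⁻ x in Ico ((j : ℝ) * Δ) ((j + 1 : ℝ) * Δ), f x := by
  rw [← setLIntegral_univ, ← lintegral_iUnion (fun _ => measurableSet_Ico)]
  · congr 2
    symm
    rw [eq_univ_iff_forall]
    intro x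
    exact mem_iUnion.2 ⟨_, mem_cell hΔ x⟩
  · intro i j hij
    rw [Function.onFun, disjoint_left]
    intro x hi hj
    exact hij ((floor_div_eq hΔ hi).symm.trans (floor_div_eq hΔ hj))

/-- The integral of the squared polynomial over its cell. -/
noncomputable def cellInt (Δ : ℝ) (P : ℤ → ℝ[X]) (j : ℤ) : ℝ :=
  ∫ t in ((j : ℝ) * Δ)..((j : ℝ) * Δ + Δ), (P j).eval t ^ 2

theorem cellInt_nonneg (hΔ : 0 < Δ) (j : ℤ) : 0 ≤ cellInt Δ P j :=
  intervalIntegral.integral_nonneg (by linarith) fun _ _ => sq_nonneg _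

theorem setLIntegral_pp_sq (hΔ : 0 < Δ) (j : ℤ) :
    ∫⁻ x in Ico ((j : ℝ) * Δ) ((j + 1 : ℝ) * Δ), ENNReal.ofReal (pp Δ P x ^ 2)
      = ENNReal.ofReal (cellInt Δ P j) := by
  rw [setLIntegral_congr_fun (g := fun x => ENNReal.ofReal ((P j).eval x ^ 2)) measurableSet_Ico
    (fun x hx => by simp only [pp_eq hΔ hx]), cellInt,
    intervalIntegral.integral_of_le (by linarith), ← integral_Ico_eq_integral_Ioc,
    ofReal_integral_eq_lintegral_ofReal]
  · rw [add_mul, one_mul]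
  · exact (Continuous.integrableOn_Icc (by fun_prop)).mono_set Ico_subset_Icc_self
  · exact ae_of_all _ fun x => sq_nonneg _

theorem sqInt_pp (hΔ : 0 < Δ) : sqInt (pp Δ P) = ∑' j : ℤ, ENNReal.ofReal (cellInt Δ P j) := by
  rw [sqInt, lintegral_cells hΔ]
  congr 1
  ext j
  exact setLIntegral_pp_sq hΔ j

theorem cellInt_le (hΔ : 0 < Δ) (h : MemLp (pp Δ P) 2 volume) (j : ℤ) :
    cellInt Δ P j ≤ ∫ x, pp Δ P x ^ 2 := by
  rw [← ENNReal.ofReal_le_ofReal_iff (integral_nonneg fun _ => sq_nonneg _), ← sqInt_eq_ofReal h,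
    sqInt_pp hΔ]
  exact ENNReal.le_tsum j

/-- A constant for the inverse inequalities on cells. -/
def IsCellConst (r : ℕ) (C : ℝ) : Prop := 0 ≤ C ∧ ∀ p : ℝ[X], p.natDegree ≤ r →
    ∀ a d : ℝ, 0 < d → ∀ x ∈ Icc a (a + d),
      p.eval x ^ 2 ≤ C / d * ∫ t in a..(a + d), p.eval t ^ 2 ∧
      p.derivative.eval x ^ 2 ≤ C / d ^ 3 * ∫ t in a..(a + d), p.eval t ^ 2

variable {C : ℝ}

theorem IsCellConst.eval_sq_le (hC : IsCellConst r C) (hΔ : 0 < Δ)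
    (hP : ∀ j, (P j).natDegree ≤ r) {j : ℤ} {x : ℝ} (hx : x ∈ Icc (j * Δ) (j * Δ + Δ)) :
    (P j).eval x ^ 2 ≤ C / Δ * cellInt Δ P j ∧
      (P j).derivative.eval x ^ 2 ≤ C / Δ ^ 3 * cellInt Δ P j :=
  hC.2 (P j) (hP j) _ Δ hΔ x hx

theorem setLIntegral_ofReal_le {a b c : ℝ} {f : ℝ → ℝ} (hc : ∀ x ∈ Ico a b, f x ≤ c) :
    ∫⁻ x in Ico a b, ENNReal.ofReal (f x) ≤ ENNReal.ofReal c * ENNReal.ofReal (b - a) := by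
  calc _ ≤ ∫⁻ x in Ico a b, ENNReal.ofReal c :=
        setLIntegral_mono' measurableSet_Ico fun x hx => ENNReal.ofReal_le_ofReal (hc x hx)
    _ = _ := by rw [setLIntegral_const, Real.volume_Ico]

theorem cell_subset {j : ℤ} {x : ℝ} (hx : x ∈ Ico ((j : ℝ) * Δ) ((j + 1 : ℝ) * Δ)) :
    x ∈ Icc ((j : ℝ) * Δ) (j * Δ + Δ) := ⟨hx.1, by linarith [hx.2]⟩

theorem sqInt_pp_derivative_le (hC : IsCellConst r C) (hΔ : 0 < Δ)
    (hP : ∀ j, (P j).natDegree ≤ r) :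
    sqInt (pp Δ fun j => derivative (P j)) ≤ ENNReal.ofReal (C / Δ ^ 2) * sqInt (pp Δ P) := by
  rw [sqInt_pp hΔ (P := P), ← ENNReal.tsum_mul_left, sqInt, lintegral_cells hΔ]
  refine ENNReal.tsum_le_tsum fun j => ?_
  have h0 := cellInt_nonneg (P := P) hΔ j
  have hC0 := hC.1
  calc _ ≤ ENNReal.ofReal (C / Δ ^ 3 * cellInt Δ P j) * ENNReal.ofReal ((j + 1 : ℝ) * Δ - j * Δ) := by
        apply setLIntegral_ofReal_le
        intro x hx
        rw [pp_eq hΔ hx]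
        exact (hC.eval_sq_le hΔ hP (cell_subset hx)).2
    _ = ENNReal.ofReal (C / Δ ^ 2) * ENNReal.ofReal (cellInt Δ P j) := by
        rw [← ENNReal.ofReal_mul (by positivity), ← ENNReal.ofReal_mul (by positivity)]
        congr 1
        field_simp
        ring

theorem memLp_pp_derivative (hΔ : 0 < Δ) (hP : ∀ j, (P j).natDegree ≤ r)
    (h : MemLp (pp Δ P) 2 volume) : MemLp (pp Δ fun j => derivative (P j)) 2 volume := by
  obtain ⟨C, hC⟩ := exists_cell_bound r
  rw [memLp_iff_sqInt measurable_pp.aestronglyMeasurable] at h ⊢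
  exact (sqInt_pp_derivative_le hC hΔ hP).trans_lt (ENNReal.mul_lt_top ENNReal.ofReal_lt_top h)

/-- Piecewise polynomials have half a derivative in `L²` in the sense of differences. -/
theorem sqInt_pp_shift_le (hC : IsCellConst r C) (hΔ : 0 < Δ)
    (hP : ∀ j, (P j).natDegree ≤ r) {h : ℝ} (h0 : 0 < h) (h1 : h ≤ Δ) :
    sqInt (fun x => pp Δ P (x + h) - pp Δ P x) ≤ ENNReal.ofReal (5 * C * h / Δ) * sqInt (pp Δ P) := by
  have hC0 := hC.1
  have hcell : ∀ j : ℤ, ∫⁻ x in Ico ((j : ℝ) * Δ) ((j + 1 : ℝ) * Δ),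
      ENNReal.ofReal ((pp Δ P (x + h) - pp Δ P x) ^ 2) ≤
      ENNReal.ofReal (3 * C * h / Δ) * ENNReal.ofReal (cellInt Δ P j) +
      ENNReal.ofReal (2 * C * h / Δ) * ENNReal.ofReal (cellInt Δ P (j + 1)) := by
    intro j
    have i0 := cellInt_nonneg (P := P) hΔ j
    have i1 := cellInt_nonneg (P := P) hΔ (j + 1)
    have hsplit : Ico ((j : ℝ) * Δ) ((j + 1 : ℝ) * Δ) =
        Ico ((j : ℝ) * Δ) ((j + 1 : ℝ) * Δ - h) ∪ Ico ((j + 1 : ℝ) * Δ - h) ((j + 1 : ℝ) * Δ) := by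
      rw [Ico_union_Ico_eq_Ico] <;> linarith
    rw [hsplit]
    refine (lintegral_union_le _ _ _).trans ?_
    -- Here `x` and `x + h` lie in the same cell, and the mean value theorem applies to a single
    -- polynomial.
    have b1 : ∀ x ∈ Ico ((j : ℝ) * Δ) ((j + 1 : ℝ) * Δ - h),
        (pp Δ P (x + h) - pp Δ P x) ^ 2 ≤ h ^ 2 * (C / Δ ^ 3 * cellInt Δ P j) := by
      intro x hx
      rw [pp_eq hΔ (j := j) ⟨by linarith [hx.1], by linarith [hx.2]⟩,
        pp_eq hΔ (j := j) ⟨by linarith [hx.1], by linarith [hx.2]⟩]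
      have := Convex.norm_image_sub_le_of_norm_hasDerivWithin_le
        (f := fun x => (P j).eval x) (f' := fun x => (P j).derivative.eval x)
        (s := Icc ((j : ℝ) * Δ) (j * Δ + Δ)) (C := √(C / Δ ^ 3 * cellInt Δ P j))
        (x := x) (y := x + h) (fun y _ => ((P j).hasDerivAt y).hasDerivWithinAt)
        (fun y hy => by
          apply Real.abs_le_sqrt
          exact (hC.eval_sq_le hΔ hP hy).2) (convex_Icc _ _)
        ⟨by linarith [hx.1], by linarith [hx.2]⟩ ⟨by linarith [hx.1], by linarith [hx.2]⟩
      rw [add_sub_cancel_left, Real.norm_eq_abs, Real.norm_eq_abs, abs_of_pos h0] at this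
      calc _ = |(P j).eval (x + h) - (P j).eval x| ^ 2 := (sq_abs _).symm
        _ ≤ (√(C / Δ ^ 3 * cellInt Δ P j) * h) ^ 2 := by gcongr
        _ = _ := by rw [mul_pow, Real.sq_sqrt (by positivity)]; ring
    -- In this strip the shift crosses a node, where there may be a jump. Only the sup bounds of the
    -- two cells are available, and the factor `h` comes from the width of the strip.
    have b2 : ∀ x ∈ Ico ((j + 1 : ℝ) * Δ - h) ((j + 1 : ℝ) * Δ),
        (pp Δ P (x + h) - pp Δ P x) ^ 2 ≤
          2 * (C / Δ * cellInt Δ P (j + 1)) + 2 * (C / Δ * cellInt Δ P j) := by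
      intro x hx
      rw [pp_eq hΔ (j := j + 1) (x := x + h) ⟨by push_cast; linarith [hx.1], by push_cast; linarith [hx.2]⟩,
        pp_eq hΔ (j := j) ⟨by linarith [hx.1], by linarith [hx.2]⟩]
      have e1 := (hC.eval_sq_le (P := P) (j := j + 1) (x := x + h) hΔ hP
        ⟨by push_cast; linarith [hx.1], by push_cast; linarith [hx.2]⟩).1
      have e2 := (hC.eval_sq_le (P := P) (j := j) (x := x) hΔ hP
        ⟨by linarith [hx.1], by linarith [hx.2]⟩).1
      nlinarith [sq_nonneg ((P (j + 1)).eval (x + h) + (P j).eval x)]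
    refine (add_le_add (setLIntegral_ofReal_le b1) (setLIntegral_ofReal_le b2)).trans ?_
    rw [← ENNReal.ofReal_mul (by positivity), ← ENNReal.ofReal_mul (by positivity),
      ← ENNReal.ofReal_mul (by positivity), ← ENNReal.ofReal_mul (by positivity),
      ← ENNReal.ofReal_add (by apply mul_nonneg (by positivity); linarith)
        (by apply mul_nonneg (by positivity); linarith),
      ← ENNReal.ofReal_add (by positivity) (by positivity)]
    apply ENNReal.ofReal_le_ofReal
    -- The part inside the cell is of order h²; since h ≤ Δ it is also of order h, which is all that
    -- the strip allows.
    have e1 : h ^ 2 * (C / Δ ^ 3 * cellInt Δ P j) * ((j + 1 : ℝ) * Δ - h - j * Δ) ≤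
        C * h / Δ * cellInt Δ P j := by
      calc _ ≤ h ^ 2 * (C / Δ ^ 3 * cellInt Δ P j) * Δ := by gcongr; linarith
        _ = (C * h / Δ * cellInt Δ P j) * (h / Δ) := by field_simp
        _ ≤ (C * h / Δ * cellInt Δ P j) * 1 := by
            gcongr; exact (div_le_one hΔ).2 h1
        _ = _ := mul_one _
    calc _ ≤ C * h / Δ * cellInt Δ P j +
          (2 * (C / Δ * cellInt Δ P (j + 1)) + 2 * (C / Δ * cellInt Δ P j)) * h := by
          have e2 : (j + 1 : ℝ) * Δ - ((j + 1 : ℝ) * Δ - h) = h := by ring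
          rw [e2]; linarith
      _ = _ := by ring
  rw [sqInt, lintegral_cells hΔ]
  refine (ENNReal.tsum_le_tsum hcell).trans ?_
  have hshift := (Equiv.addRight (1 : ℤ)).tsum_eq (fun j => ENNReal.ofReal (cellInt Δ P j))
  simp only [Equiv.coe_addRight] at hshift
  rw [ENNReal.tsum_add, ENNReal.tsum_mul_left, ENNReal.tsum_mul_left,
    hshift, ← sqInt_pp hΔ,
    ← add_mul, ← ENNReal.ofReal_add (by positivity) (by positivity)]
  apply le_of_eq
  congr 2
  ring

theorem pp_eq_of_matched (hΔ : 0 < Δ) (hP : Matched Δ P) {j : ℤ} {x : ℝ}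
    (hx : x ∈ Icc ((j : ℝ) * Δ) ((j + 1 : ℝ) * Δ)) : pp Δ P x = (P j).eval x := by
  rcases hx.2.lt_or_eq with h | h
  · exact pp_eq hΔ ⟨hx.1, h⟩
  · rw [pp_eq hΔ (j := j + 1) (by rw [h]; push_cast; exact ⟨le_rfl, by linarith⟩)]
    have := hP (j + 1)
    push_cast at this
    rw [add_sub_cancel_right] at this
    rw [h, this]

theorem continuous_pp (hΔ : 0 < Δ) (hP : Matched Δ P) : Continuous (pp Δ P) := by
  rw [continuous_iff_continuousAt]
  intro x
  have hx := mem_cell hΔ x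
  set j := ⌊x / Δ⌋
  rw [continuousAt_iff_continuous_left'_right']
  constructor
  · rcases hx.1.lt_or_eq with h | h
    · apply ContinuousAt.continuousWithinAt
      apply ((P j).continuousAt (a := x)).congr
      filter_upwards [Ioo_mem_nhds h hx.2] with y hy
      rw [pp_eq hΔ ⟨hy.1.le, hy.2⟩]
    · have c1 : ContinuousWithinAt (fun y => (P (j - 1)).eval y) (Iio x) x :=
        (P (j - 1)).continuousWithinAt
      refine c1.congr_of_eventuallyEq ?_ ?_
      · have : Ioo (x - Δ) x ∈ 𝓝[<] x := Ioo_mem_nhdsLT (by linarith)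
        filter_upwards [this] with y hy
        rw [pp_eq hΔ (j := j - 1)]
        push_cast
        exact ⟨by linarith [hy.1], by linarith [hy.2]⟩
      · rw [pp_eq hΔ hx, ← h, hP j]
  · have c1 : ContinuousWithinAt (fun y => (P j).eval y) (Ioi x) x := (P j).continuousWithinAt
    refine c1.congr_of_eventuallyEq ?_ (pp_eq hΔ hx)
    have : Ioo x ((j + 1 : ℝ) * Δ) ∈ 𝓝[>] x := Ioo_mem_nhdsGT hx.2
    filter_upwards [this] with y hy
    rw [pp_eq hΔ (j := j) ⟨by linarith [hy.1, hx.1], hy.2⟩]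

theorem l2Deriv_pp (hΔ : 0 < Δ) (hP : Matched Δ P) (hr : ∀ j, (P j).natDegree ≤ r)
    (h : MemLp (pp Δ P) 2 volume) : L2Deriv (pp Δ P) (pp Δ fun j => derivative (P j)) where
  cont := continuous_pp hΔ hP
  memLp := h
  memLp_deriv := memLp_pp_derivative hΔ hr h
  deriv := by
    refine ⟨range fun j : ℤ => (j : ℝ) * Δ, countable_range _, fun x hx => ?_⟩
    have h1 := mem_cell hΔ x
    set j := ⌊x / Δ⌋
    have h2 : (j : ℝ) * Δ < x := lt_of_le_of_ne h1.1 fun h => hx ⟨j, h⟩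
    rw [pp_eq hΔ h1]
    refine ((P j).hasDerivAt x).congr_of_eventuallyEq ?_
    filter_upwards [Ioo_mem_nhds h2 h1.2] with y hy
    rw [pp_eq hΔ ⟨hy.1.le, hy.2⟩]

end

end FracKdV

/-! ### Sobolev regularity of piecewise polynomials: below 1/2 always, at 1/2 only without jumps. -/

namespace FracKdV

section

open Polynomial

theorem eLpNorm_sq_complex (f : ℝ → ℂ) :
    eLpNorm f 2 volume ^ 2 = ∫⁻ x, ENNReal.ofReal (‖f x‖ ^ 2) := by
  rw [← eLpNorm_norm, eLpNorm_sq, sqInt]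

theorem memLp_iff_lintegral {f : ℝ → ℂ} (hf : AEStronglyMeasurable f volume) :
    MemLp f 2 volume ↔ ∫⁻ x, ENNReal.ofReal (‖f x‖ ^ 2) < ⊤ := by
  rw [← eLpNorm_sq_complex, MemLp]
  simp [hf]

theorem IsFT.sqInt_eq {v : ℝ → ℝ} {F : ℝ → ℂ} (h : IsFT (fun x => (v x : ℂ)) F) :
    sqInt v = ∫⁻ ξ, ENNReal.ofReal (‖F ξ‖ ^ 2) := by
  rw [← eLpNorm_sq_complex, h.eLpNorm_eq, eLpNorm_sq_complex, sqInt]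
  congr 1
  ext x
  rw [Complex.norm_real, Real.norm_eq_abs, sq_abs]

theorem norm_exp_sub_one_sq (h ξ : ℝ) :
    ‖Complex.exp (2 * Real.pi * Complex.I * h * ξ) - 1‖ ^ 2 = 2 - 2 * Real.cos (2 * Real.pi * h * ξ) := by
  have e : (2 * Real.pi * Complex.I * h * ξ : ℂ) = ((2 * Real.pi * h * ξ : ℝ) : ℂ) * Complex.I := by
    push_cast; ring
  have key : ∀ c s : ℝ, ‖(c : ℂ) + s * Complex.I - 1‖ ^ 2 = (c - 1) ^ 2 + s ^ 2 := by
    intro c s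
    rw [← Complex.normSq_eq_norm_sq, Complex.normSq_apply]
    simp
    ring
  rw [e, Complex.exp_mul_I, ← Complex.ofReal_cos, ← Complex.ofReal_sin, key]
  nlinarith [Real.sin_sq_add_cos_sq (2 * Real.pi * h * ξ)]

theorem norm_exp_sub_one_sq_le (h ξ : ℝ) :
    ‖Complex.exp (2 * Real.pi * Complex.I * h * ξ) - 1‖ ^ 2 ≤ (2 * Real.pi * h * ξ) ^ 2 := by
  have e : (2 * Real.pi * Complex.I * h * ξ : ℂ) = Complex.I * ((2 * Real.pi * h * ξ : ℝ) : ℂ) := by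
    push_cast; ring
  rw [e, ← sq_abs (2 * Real.pi * h * ξ)]
  gcongr
  exact Real.norm_exp_I_mul_ofReal_sub_one_le

theorem IsFT.sqInt_shift {v : ℝ → ℝ} {F : ℝ → ℂ} (h : IsFT (fun x => (v x : ℂ)) F) (t : ℝ) :
    sqInt (fun x => v (x + t) - v x) = ∫⁻ ξ : ℝ, ENNReal.ofReal
      (‖Complex.exp (2 * Real.pi * Complex.I * t * ξ) - 1‖ ^ 2 * ‖F ξ‖ ^ 2) := by
  have h1 := (h.comp_add_right t).sub h
  rw [IsFT.sqInt_eq (v := fun x => v (x + t) - v x) (by push_cast; exact h1)]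
  congr 1
  ext ξ
  rw [← mul_pow, ← norm_mul, sub_mul, one_mul]

theorem weightL2_iff {s : ℝ} {F : ℝ → ℂ} (hF : AEStronglyMeasurable F volume) :
    WeightL2 s F ↔ ∫⁻ ξ, ENNReal.ofReal ((1 + ‖ξ‖ ^ 2) ^ s * ‖F ξ‖ ^ 2) < ⊤ := by
  rw [WeightL2, memLp_iff_lintegral]
  · apply iff_of_eq
    congr 3
    ext ξ
    rw [norm_mul, mul_pow, Complex.norm_real, Real.norm_of_nonneg (by positivity),
      ← Real.rpow_natCast ((1 + ‖ξ‖ ^ 2) ^ _), ← Real.rpow_mul (by positivity)]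
    congr 3
    push_cast
    ring
  · exact (by fun_prop : Measurable fun ξ : ℝ =>
      (((1 + ‖ξ‖ ^ 2) ^ (s / 2) : ℝ) : ℂ)).aestronglyMeasurable.mul hF

/-- For |ξ| ≥ 1/(2Δ) some `k` puts Δ|ξ|/2^k into [1/4, 1/2]. The angle of the translation factor is
then between π/2 and π in absolute value, so the squared factor is at least 2, while |ξ| is
comparable with 2^k/Δ. Translations by Δ/2^k thus detect every high frequency. -/
theorem exists_dyadic_shift {σ Δ : ℝ} (hΔ : 0 < Δ) (h0 : 0 ≤ σ) (h1 : σ ≤ 1) (ξ : ℝ) :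
    (1 + ‖ξ‖ ^ 2) ^ σ ≤ 2 * (1 + (2 * Δ)⁻¹ ^ (2 * σ)) ∨ ∃ k : ℕ,
    (1 + ‖ξ‖ ^ 2) ^ σ ≤ 2 * (1 + (2 * Δ)⁻¹ ^ (2 * σ)) + (2 * Δ)⁻¹ ^ (2 * σ) *
      ((2 ^ k : ℝ) ^ (2 * σ) *
        ‖Complex.exp (2 * Real.pi * Complex.I * (Δ / 2 ^ k : ℝ) * ξ) - 1‖ ^ 2) := by
  have hpow : (1 + ‖ξ‖ ^ 2) ^ σ ≤ 1 + |ξ| ^ (2 * σ) := by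
    rcases eq_or_lt_of_le h0 with h | h
    · rw [← h]; simp
    calc (1 + ‖ξ‖ ^ 2) ^ σ ≤ 1 ^ σ + (‖ξ‖ ^ 2) ^ σ := Real.rpow_add_le_add_rpow zero_le_one (by positivity) h.le h1
      _ = _ := by
        rw [Real.one_rpow, Real.rpow_mul (abs_nonneg _), Real.norm_eq_abs, Real.rpow_two]
  have hA : 0 ≤ (2 * Δ)⁻¹ ^ (2 * σ) := by positivity
  rcases lt_or_ge (|ξ| * Δ * 2) 1 with h | h
  · left
    have : |ξ| ^ (2 * σ) ≤ (2 * Δ)⁻¹ ^ (2 * σ) := by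
      gcongr
      rw [← one_div, le_div_iff₀ (by positivity)]
      linarith
    linarith
  · right
    obtain ⟨n, hn1, hn2⟩ := exists_nat_pow_near h one_lt_two
    refine ⟨n + 1, ?_⟩
    rw [norm_exp_sub_one_sq]
    have hcos : Real.cos (2 * Real.pi * (Δ / 2 ^ (n + 1) : ℝ) * ξ) ≤ 0 := by
      rw [← Real.cos_abs]
      have e : |2 * Real.pi * (Δ / 2 ^ (n + 1) : ℝ) * ξ| = Real.pi * ((|ξ| * Δ * 2) / 2 ^ (n + 1)) := by
        rw [abs_mul, abs_of_pos (by positivity)]; ring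
      have l1 : 1 / 2 ≤ (|ξ| * Δ * 2) / 2 ^ (n + 1) := by
        rw [le_div_iff₀ (by positivity), pow_succ]; linarith
      have l2 : (|ξ| * Δ * 2) / 2 ^ (n + 1) ≤ 1 := by
        rw [div_le_one (by positivity)]; exact hn2.le
      rw [e]
      apply Real.cos_nonpos_of_pi_div_two_le_of_le <;> nlinarith [Real.pi_pos]
    have l3 : |ξ| ^ (2 * σ) ≤ (2 * Δ)⁻¹ ^ (2 * σ) * (2 ^ (n + 1) : ℝ) ^ (2 * σ) := by
      rw [← Real.mul_rpow (by positivity) (by positivity)]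
      gcongr
      rw [inv_mul_eq_div, le_div_iff₀ (by positivity)]
      linarith
    have l4 : 0 ≤ (2 * Δ)⁻¹ ^ (2 * σ) * (2 ^ (n + 1) : ℝ) ^ (2 * σ) := by positivity
    nlinarith

/-- Square integrable piecewise polynomials belong to `H^σ` for `σ < 1/2`. -/
theorem weightL2_pp {Δ σ : ℝ} {P : ℤ → ℝ[X]} {r : ℕ} {F : ℝ → ℂ} (hΔ : 0 < Δ)
    (hP : ∀ j, (P j).natDegree ≤ r) (hF : IsFT (fun x => (pp Δ P x : ℂ)) F) (h0 : 0 ≤ σ)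
    (h1 : σ < 1 / 2) : WeightL2 σ F := by
  obtain ⟨C, hC⟩ := exists_cell_bound r
  have hC0 := hC.1
  have hmeas := hF.memLp_right.1
  rw [weightL2_iff hmeas]
  set A : ℝ := (2 * Δ)⁻¹ ^ (2 * σ) with hA
  have hA0 : 0 ≤ A := by positivity
  have hfin : sqInt (pp Δ P) < ⊤ :=
    (memLp_iff_sqInt measurable_pp.aestronglyMeasurable).1 (by
      have := hF.memLp_left.re
      simpa using this)
  -- The index `k` found above depends on ξ; summing over all `k` removes this dependence.
  let T : ℕ → ℝ → ENNReal := fun k ξ => ENNReal.ofReal ((2 ^ k : ℝ) ^ (2 * σ)) * ENNReal.ofReal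
    (‖Complex.exp (2 * Real.pi * Complex.I * (Δ / 2 ^ k : ℝ) * ξ) - 1‖ ^ 2 * ‖F ξ‖ ^ 2)
  have hT : ∀ k, AEMeasurable (T k) volume := by
    intro k
    apply AEMeasurable.const_mul
    apply AEMeasurable.ennreal_ofReal
    apply AEMeasurable.mul
    · fun_prop
    · exact (hmeas.norm.aemeasurable.pow_const 2)
  have hptw : ∀ ξ, ENNReal.ofReal ((1 + ‖ξ‖ ^ 2) ^ σ * ‖F ξ‖ ^ 2) ≤
      ENNReal.ofReal (2 * (1 + A)) * ENNReal.ofReal (‖F ξ‖ ^ 2) +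
      ENNReal.ofReal A * ∑' k, T k ξ := by
    intro ξ
    rcases exists_dyadic_shift hΔ h0 (by linarith) ξ with h | ⟨k, h⟩
    · refine le_trans ?_ le_self_add
      rw [← ENNReal.ofReal_mul (by positivity)]
      gcongr
    · refine le_trans ?_ (add_le_add le_rfl (mul_le_mul_right (ENNReal.le_tsum k) _))
      simp only [T]
      rw [← ENNReal.ofReal_mul (by positivity), ← ENNReal.ofReal_mul (by positivity),
        ← ENNReal.ofReal_mul (by positivity), ← ENNReal.ofReal_add (by positivity) (by positivity)]
      apply ENNReal.ofReal_le_ofReal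
      have := mul_le_mul_of_nonneg_right h (sq_nonneg ‖F ξ‖)
      refine this.trans (le_of_eq ?_)
      ring
  -- The weight 2^{2σk} meets the gain 2^{-k} from a shift by Δ/2^k. The ratio 2^{2σ-1} of the
  -- resulting geometric series is below 1 because σ < 1/2.
  have hk : ∀ k, ∫⁻ ξ, T k ξ ≤ ENNReal.ofReal (5 * C * ((2 : ℝ) ^ (2 * σ - 1)) ^ k) * sqInt (pp Δ P) := by
    intro k
    simp only [T]
    rw [lintegral_const_mul' _ _ ENNReal.ofReal_ne_top, ← hF.sqInt_shift]
    calc _ ≤ ENNReal.ofReal ((2 ^ k : ℝ) ^ (2 * σ)) *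
          (ENNReal.ofReal (5 * C * (Δ / 2 ^ k) / Δ) * sqInt (pp Δ P)) := by
          gcongr
          exact sqInt_pp_shift_le hC hΔ hP (by positivity)
            (div_le_self hΔ.le (one_le_pow₀ one_le_two))
      _ = _ := by
          rw [← mul_assoc, ← ENNReal.ofReal_mul (by positivity)]
          congr 2
          rw [← Real.rpow_natCast, ← Real.rpow_natCast, ← Real.rpow_mul zero_le_two,
            ← Real.rpow_mul zero_le_two]
          have : (2 * σ - 1) * k = k * (2 * σ) - k := by ring
          rw [this, Real.rpow_sub zero_lt_two]
          field_simp
  calc ∫⁻ ξ, ENNReal.ofReal ((1 + ‖ξ‖ ^ 2) ^ σ * ‖F ξ‖ ^ 2)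
      ≤ ∫⁻ ξ, (ENNReal.ofReal (2 * (1 + A)) * ENNReal.ofReal (‖F ξ‖ ^ 2) +
        ENNReal.ofReal A * ∑' k, T k ξ) := lintegral_mono hptw
    _ = ENNReal.ofReal (2 * (1 + A)) * sqInt (pp Δ P) + ENNReal.ofReal A * ∑' k, ∫⁻ ξ, T k ξ := by
        rw [lintegral_add_left', lintegral_const_mul' _ _ ENNReal.ofReal_ne_top,
          lintegral_const_mul' _ _ ENNReal.ofReal_ne_top, lintegral_tsum hT, hF.sqInt_eq]
        exact ((hmeas.norm.aemeasurable.pow_const 2).ennreal_ofReal).const_mul _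
    _ ≤ ENNReal.ofReal (2 * (1 + A)) * sqInt (pp Δ P) + ENNReal.ofReal A *
          ∑' k : ℕ, ENNReal.ofReal (5 * C * ((2 : ℝ) ^ (2 * σ - 1)) ^ k) * sqInt (pp Δ P) := by
        gcongr with k
        exact hk k
    _ < ⊤ := by
        rw [ENNReal.tsum_mul_right]
        refine ENNReal.add_lt_top.2 ⟨ENNReal.mul_lt_top ENNReal.ofReal_lt_top hfin,
          ENNReal.mul_lt_top ENNReal.ofReal_lt_top (ENNReal.mul_lt_top ?_ hfin)⟩
        have hq : (2 : ℝ) ^ (2 * σ - 1) < 1 :=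
          Real.rpow_lt_one_of_one_lt_of_neg one_lt_two (by linarith)
        have hs : Summable fun k : ℕ => 5 * C * ((2 : ℝ) ^ (2 * σ - 1)) ^ k :=
          (summable_geometric_of_lt_one (by positivity) hq).mul_left _
        rw [← ENNReal.ofReal_tsum_of_nonneg (fun k => by positivity) hs]
        exact ENNReal.ofReal_lt_top

/-- A piecewise polynomial in `H^{1/2}` has no jumps. -/
theorem matched_of_weightL2 {Δ : ℝ} {P : ℤ → ℝ[X]} {F : ℝ → ℂ} (hΔ : 0 < Δ)
    (hF : IsFT (fun x => (pp Δ P x : ℂ)) F) (hw : WeightL2 (1 / 2) F) : Matched Δ P := by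
  intro j
  by_contra hne
  set x₀ : ℝ := j * Δ with hx₀
  set J : ℝ := |(P j).eval x₀ - (P (j - 1)).eval x₀| with hJ
  have hJ0 : 0 < J := abs_pos.2 (sub_ne_zero.2 (Ne.symm hne))
  have hcont : ContinuousAt (fun q : ℝ × ℝ => |(P j).eval q.1 - (P (j - 1)).eval q.2|) (x₀, x₀) := by
    fun_prop
  have hev := hcont.eventually (lt_mem_nhds (a := J / 2) (by simp only []; linarith))
  rw [Metric.eventually_nhds_iff] at hev
  obtain ⟨δ, hδ, hδ'⟩ := hev
  -- Dividing by n + 2 rather than n keeps the shifts well defined and strictly below both δ and Δ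
  -- from the start.
  let h : ℕ → ℝ := fun n => min δ Δ / (n + 2)
  have hmin : 0 < min δ Δ := lt_min hδ hΔ
  have h0 : ∀ n, 0 < h n := fun n => by positivity
  have hlt : ∀ n, h n < min δ Δ := fun n =>
    div_lt_self hmin (by linarith [(Nat.cast_nonneg n : (0 : ℝ) ≤ n)])
  -- Just before the node, on a strip of width `h n`, the shifted difference exceeds half of the
  -- jump. Hence ‖v(·+h) - v‖²/h stays bounded below, whereas in H^{1/2} it must tend to 0.
  have hlow : ∀ n, ENNReal.ofReal (J ^ 2 / 4) ≤
      ∫⁻ ξ : ℝ, ENNReal.ofReal (‖Complex.exp (2 * Real.pi * Complex.I * h n * ξ) - 1‖ ^ 2 / h n * ‖F ξ‖ ^ 2) := by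
    intro n
    have hδn : h n < δ := (hlt n).trans_le (min_le_left _ _)
    have hΔn : h n < Δ := (hlt n).trans_le (min_le_right _ _)
    have e : ∀ ξ : ℝ, ENNReal.ofReal (‖Complex.exp (2 * Real.pi * Complex.I * h n * ξ) - 1‖ ^ 2 / h n * ‖F ξ‖ ^ 2)
        = ENNReal.ofReal (h n)⁻¹ * ENNReal.ofReal (‖Complex.exp (2 * Real.pi * Complex.I * h n * ξ) - 1‖ ^ 2 * ‖F ξ‖ ^ 2) := by
      intro ξ
      rw [← ENNReal.ofReal_mul (inv_nonneg.2 (h0 n).le)]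
      congr 1; ring
    simp only [e]
    rw [lintegral_const_mul' _ _ ENNReal.ofReal_ne_top, ← hF.sqInt_shift]
    have hsub : ENNReal.ofReal (J ^ 2 / 4) * ENNReal.ofReal (h n) ≤
        sqInt (fun x => pp Δ P (x + h n) - pp Δ P x) := by
      calc _ = ∫⁻ x in Ico (x₀ - h n) x₀, ENNReal.ofReal (J ^ 2 / 4) := by
            rw [setLIntegral_const, Real.volume_Ico, sub_sub_cancel]
        _ ≤ ∫⁻ x in Ico (x₀ - h n) x₀, ENNReal.ofReal ((pp Δ P (x + h n) - pp Δ P x) ^ 2) := by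
            refine setLIntegral_mono' measurableSet_Ico fun x hx => ?_
            apply ENNReal.ofReal_le_ofReal
            rw [pp_eq (j := j) (x := x + h n) hΔ ⟨by linarith [hx.1], by linarith [hx.2]⟩,
              pp_eq (j := j - 1) (x := x) hΔ
                ⟨by push_cast; linarith [hx.1], by push_cast; linarith [hx.2]⟩]
            have := hδ' (y := (x + h n, x)) (by
              rw [Prod.dist_eq, max_lt_iff, Real.dist_eq, Real.dist_eq, abs_lt, abs_lt]
              simp only
              exact ⟨⟨by linarith [hx.1], by linarith [hx.2]⟩, ⟨by linarith [hx.1], by linarith [hx.2]⟩⟩)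
            simp only at this
            rw [← sq_abs ((P j).eval (x + h n) - _)]
            nlinarith
        _ ≤ _ := setLIntegral_le_lintegral _ _
    calc ENNReal.ofReal (J ^ 2 / 4)
        = ENNReal.ofReal (h n)⁻¹ * (ENNReal.ofReal (J ^ 2 / 4) * ENNReal.ofReal (h n)) := by
          rw [← ENNReal.ofReal_mul (by positivity), ← ENNReal.ofReal_mul (inv_nonneg.2 (h0 n).le)]
          congr 1
          field_simp [(h0 n).ne']
      _ ≤ _ := by gcongr
  have htend : Tendsto (fun n => ∫⁻ ξ : ℝ, ENNReal.ofReal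
      (‖Complex.exp (2 * Real.pi * Complex.I * h n * ξ) - 1‖ ^ 2 / h n * ‖F ξ‖ ^ 2)) atTop
      (𝓝 (∫⁻ ξ : ℝ, 0)) := by
    have hh : Tendsto h atTop (𝓝 0) := by
      apply Tendsto.div_atTop tendsto_const_nhds
      exact tendsto_atTop_add_const_right _ _ tendsto_natCast_atTop_atTop
    -- The bound is the product of |e^{iθ} - 1| ≤ 2 and |e^{iθ} - 1| ≤ |θ| for θ = 2πhξ. After
    -- division by `h` it is 4π|ξ|, which is integrable against |F|² in H^{1/2}.
    apply tendsto_lintegral_of_dominated_convergence'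
      (bound := fun ξ => ENNReal.ofReal (4 * Real.pi) *
        ENNReal.ofReal ((1 + ‖ξ‖ ^ 2) ^ (1 / 2 : ℝ) * ‖F ξ‖ ^ 2))
    · intro n
      apply AEMeasurable.ennreal_ofReal
      apply AEMeasurable.mul
      · fun_prop
      · exact (hw.aestronglyMeasurable.norm.aemeasurable.pow_const 2)
    · intro n
      refine ae_of_all _ fun ξ => ?_
      beta_reduce
      rw [← ENNReal.ofReal_mul (by positivity)]
      apply ENNReal.ofReal_le_ofReal
      rw [← mul_assoc]
      gcongr
      have b1 := norm_exp_sub_one_sq_le (h n) ξ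
      have b2 : ‖Complex.exp (2 * Real.pi * Complex.I * h n * ξ) - 1‖ ^ 2 ≤ 2 ^ 2 := by
        rw [norm_exp_sub_one_sq]; linarith [Real.neg_one_le_cos (2 * Real.pi * h n * ξ)]
      set X := ‖Complex.exp (2 * Real.pi * Complex.I * h n * ξ) - 1‖
      have c1 : X ≤ |2 * Real.pi * h n * ξ| := abs_le_of_sq_le_sq' (by rwa [sq_abs]) (abs_nonneg _) |>.2
      have c2 : X ≤ 2 := abs_le_of_sq_le_sq' b2 zero_le_two |>.2
      have c3 : |2 * Real.pi * h n * ξ| = 2 * Real.pi * |ξ| * h n := by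
        rw [abs_mul, abs_of_pos (mul_pos Real.two_pi_pos (h0 n))]; ring
      have c4 : |ξ| ≤ (1 + ‖ξ‖ ^ 2) ^ (1 / 2 : ℝ) := by
        rw [← Real.sqrt_eq_rpow]
        apply Real.le_sqrt_of_sq_le
        rw [Real.norm_eq_abs]; linarith
      rw [div_le_iff₀ (h0 n)]
      have c5 : 2 * Real.pi * |ξ| * h n ≤ 2 * Real.pi * (1 + ‖ξ‖ ^ 2) ^ (1 / 2 : ℝ) * h n := by
        have := (h0 n).le
        gcongr
      nlinarith [norm_nonneg (Complex.exp (2 * Real.pi * Complex.I * h n * ξ) - 1)]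
    · rw [lintegral_const_mul' _ _ ENNReal.ofReal_ne_top]
      exact (ENNReal.mul_lt_top ENNReal.ofReal_lt_top
        ((weightL2_iff hw.aestronglyMeasurable).1 hw)).ne
    · refine ae_of_all _ fun ξ => ?_
      rw [← ENNReal.ofReal_zero]
      apply ENNReal.tendsto_ofReal
      have hup : Tendsto (fun n => (2 * Real.pi * ξ) ^ 2 * h n * ‖F ξ‖ ^ 2) atTop (𝓝 0) := by
        have := (hh.const_mul ((2 * Real.pi * ξ) ^ 2)).mul_const (‖F ξ‖ ^ 2)
        simpa using this
      refine squeeze_zero (fun n => by have := h0 n; positivity) (fun n => ?_) hup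
      gcongr
      rw [div_le_iff₀ (h0 n)]
      calc _ ≤ _ := norm_exp_sub_one_sq_le (h n) ξ
        _ = _ := by ring
  rw [lintegral_zero] at htend
  have := ge_of_tendsto' htend hlow
  rw [nonpos_iff_eq_zero, ENNReal.ofReal_eq_zero] at this
  have : 0 < J ^ 2 / 4 := by positivity
  linarith

end

end FracKdV

/-! ### The finite element space described by matching conditions at the nodes. -/

namespace FracKdV

section

open Polynomial

theorem weightL2_zero {F : ℝ → ℂ} : WeightL2 0 F ↔ MemLp F 2 volume := by simp [WeightL2]

theorem abs_le_weight (ξ : ℝ) : |ξ| ≤ (1 + ‖ξ‖ ^ 2) ^ (1 / 2 : ℝ) := by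
  rw [← Real.sqrt_eq_rpow]
  apply Real.le_sqrt_of_sq_le
  rw [Real.norm_eq_abs]; linarith

theorem weight_half_le (ξ : ℝ) : (1 + ‖ξ‖ ^ 2) ^ (1 / 2 : ℝ) ≤ 1 + |ξ| := by
  rw [← Real.sqrt_eq_rpow]
  apply Real.sqrt_le_iff.2
  refine ⟨by positivity, ?_⟩
  rw [Real.norm_eq_abs]
  nlinarith [abs_nonneg ξ]

theorem WeightL2.deriv {s : ℝ} {F : ℝ → ℂ} (h : WeightL2 (s + 1) F) :
    WeightL2 s (fun ξ => 2 * Real.pi * Complex.I * ξ * F ξ) := by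
  have := h.memLp_mul (C := 2 * Real.pi)
    (m := fun ξ : ℝ => (((1 + ‖ξ‖ ^ 2) ^ (s / 2) : ℝ) : ℂ) * (2 * Real.pi * Complex.I * ξ))
    (by fun_prop) (fun ξ => by
      rw [norm_mul, Complex.norm_real, Real.norm_of_nonneg (by positivity)]
      have e : ‖(2 * Real.pi * Complex.I * ξ : ℂ)‖ = 2 * Real.pi * |ξ| := by
        simp [abs_of_pos Real.pi_pos]
      rw [e]
      have h2 : (0 : ℝ) < 1 + ‖ξ‖ ^ 2 := by positivity
      have e2 : (1 + ‖ξ‖ ^ 2) ^ ((s + 1) / 2) = (1 + ‖ξ‖ ^ 2) ^ (s / 2) * (1 + ‖ξ‖ ^ 2) ^ (1 / 2 : ℝ) := by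
        rw [← Real.rpow_add h2]; congr 1; ring
      rw [e2]
      calc _ ≤ (1 + ‖ξ‖ ^ 2) ^ (s / 2) * (2 * Real.pi * (1 + ‖ξ‖ ^ 2) ^ (1 / 2 : ℝ)) := by
            gcongr; exact abs_le_weight ξ
        _ = _ := by ring)
  refine (memLp_congr_ae (ae_of_all _ fun ξ => ?_)).1 this
  simp only []
  ring

theorem WeightL2.of_deriv {s : ℝ} {F : ℝ → ℂ} (h : WeightL2 s F)
    (h' : WeightL2 s (fun ξ => 2 * Real.pi * Complex.I * ξ * F ξ)) : WeightL2 (s + 1) F := by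
  refine MemLp.of_le (h.norm.add h'.norm) ?_ (ae_of_all _ fun ξ => ?_)
  · exact (by fun_prop : Measurable fun ξ : ℝ =>
      (((1 + ‖ξ‖ ^ 2) ^ ((s + 1) / 2) : ℝ) : ℂ)).aestronglyMeasurable.mul h.aestronglyMeasurable
  · have h2 : (0 : ℝ) < 1 + ‖ξ‖ ^ 2 := by positivity
    have e2 : (1 + ‖ξ‖ ^ 2) ^ ((s + 1) / 2) = (1 + ‖ξ‖ ^ 2) ^ (s / 2) * (1 + ‖ξ‖ ^ 2) ^ (1 / 2 : ℝ) := by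
      rw [← Real.rpow_add h2]; congr 1; ring
    have e : ‖(2 * Real.pi * Complex.I * ξ : ℂ)‖ = 2 * Real.pi * |ξ| := by
      simp [abs_of_pos Real.pi_pos]
    have hA : (0 : ℝ) ≤ (1 + ‖ξ‖ ^ 2) ^ (s / 2) := by positivity
    have hp : |ξ| ≤ 2 * Real.pi * |ξ| := by nlinarith [Real.pi_gt_three, abs_nonneg ξ]
    refine le_trans ?_ (Real.le_norm_self _)
    simp only [norm_mul _ (F ξ), Complex.norm_real, Pi.add_apply, norm_mul (((1 + ‖ξ‖ ^ 2) ^ (s / 2) : ℝ) : ℂ), e]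
    rw [Real.norm_of_nonneg (by positivity : (0:ℝ) ≤ (1 + ‖ξ‖ ^ 2) ^ ((s + 1) / 2)), Real.norm_of_nonneg hA, e2]
    calc (1 + ‖ξ‖ ^ 2) ^ (s / 2) * (1 + ‖ξ‖ ^ 2) ^ (1 / 2 : ℝ) * ‖F ξ‖
        ≤ (1 + ‖ξ‖ ^ 2) ^ (s / 2) * (1 + 2 * Real.pi * |ξ|) * ‖F ξ‖ := by
          gcongr
          exact (weight_half_le ξ).trans (by linarith)
      _ = _ := by ring

/-- A description of the finite element space by classical smoothness at the nodes. -/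
structure FERep (α : ℝ) (r : ℕ) (Δ : ℝ) (v : ℝ → ℝ) (P : ℤ → ℝ[X]) : Prop where
  degree : ∀ j, (P j).natDegree ≤ r
  eq : v = pp Δ P
  memLp : MemLp v 2 volume
  matched : Matched Δ P
  matched' : Matched Δ fun j => derivative (P j)
  matched'' : 3 / 2 ≤ α → Matched Δ fun j => derivative (derivative (P j))

theorem natDegree_derivative_le_of_le {p : ℝ[X]} {r : ℕ} (h : p.natDegree ≤ r) :
    (derivative p).natDegree ≤ r :=
  (natDegree_derivative_le p).trans (by omega)

/-- The derivative lies in H^α and the second one in H^{α-1}. As H^{1/2} admits no jumps, vₓ is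
continuous because α ≥ 1/2, and vₓₓ is continuous once α - 1 ≥ 1/2. -/
theorem exists_feRep {α Δ : ℝ} {r : ℕ} (hα₁ : 1 ≤ α) (hΔ : 0 < Δ) {v : ℝ → ℝ}
    (hv : v ∈ feSpace α r Δ) : ∃ P, FERep α r Δ v P := by
  obtain ⟨hH, hp⟩ := hv
  choose p hdeg hpv using hp
  -- The index shift passes from the cells [(j-1)Δ, jΔ] of `feSpace` to the cells [jΔ, (j+1)Δ) of
  -- `pp`.
  let P : ℤ → ℝ[X] := fun j => p (j + 1)
  have hPv : ∀ j : ℤ, ∀ x ∈ Icc ((j : ℝ) * Δ) ((j + 1 : ℝ) * Δ), v x = (P j).eval x := by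
    intro j x hx
    apply hpv (j + 1)
    push_cast
    rwa [add_sub_cancel_right]
  have hr : ∀ j, (P j).natDegree ≤ r := fun j => hdeg _
  have hr' : ∀ j, (derivative (P j)).natDegree ≤ r := fun j => natDegree_derivative_le_of_le (hr j)
  have hvP : v = pp Δ P := by
    ext x
    rw [hPv _ x ⟨(mem_cell hΔ x).1, (mem_cell hΔ x).2.le⟩, pp_eq hΔ (mem_cell hΔ x)]
  have hmatch : Matched Δ P := by
    intro j
    rw [← hPv j _ ⟨le_rfl, by linarith⟩, ← hPv (j - 1)]
    push_cast
    exact ⟨by linarith, by linarith⟩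
  obtain ⟨F, hF, hW⟩ := memH_iff.1 hH
  change WeightL2 (1 + α) F at hW
  have hL2 : MemLp v 2 volume := by
    have := hF.memLp_left.re
    simpa using this
  have d1 : L2Deriv (pp Δ P) _ := l2Deriv_pp hΔ hmatch hr (hvP ▸ hL2)
  have F1 := d1.isFT (hvP ▸ hF)
  have W1 : WeightL2 α (fun ξ => 2 * Real.pi * Complex.I * ξ * F ξ) :=
    WeightL2.deriv (by rwa [add_comm])
  have m1 : Matched Δ fun j => derivative (P j) :=
    matched_of_weightL2 hΔ F1 (W1.mono (by linarith))
  refine ⟨P, hr, hvP, hL2, hmatch, m1, fun h => ?_⟩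
  have d2 := l2Deriv_pp hΔ m1 hr' d1.memLp_deriv
  exact matched_of_weightL2 hΔ (d2.isFT F1)
    ((WeightL2.deriv (s := α - 1) (by rwa [sub_add_cancel])).mono (by linarith))

namespace FERep

variable {α Δ : ℝ} {r : ℕ} {v : ℝ → ℝ} {P : ℤ → ℝ[X]}

theorem l2Deriv (h : FERep α r Δ v P) (hΔ : 0 < Δ) : L2Deriv v (pp Δ fun j => derivative (P j)) := by
  have := l2Deriv_pp hΔ h.matched h.degree (h.eq ▸ h.memLp)
  rwa [← h.eq] at this

theorem l2Deriv' (h : FERep α r Δ v P) (hΔ : 0 < Δ) : L2Deriv (pp Δ fun j => derivative (P j))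
    (pp Δ fun j => derivative (derivative (P j))) :=
  l2Deriv_pp hΔ h.matched' (fun j => natDegree_derivative_le_of_le (h.degree j))
    (h.l2Deriv hΔ).memLp_deriv

/-- It suffices to have vₓₓ in H^{α-1}. For α < 3/2 this holds for any square integrable piecewise
polynomial, since α - 1 < 1/2; for α ≥ 3/2 the second derivative is continuous, hence in H¹, and α -
1 < 1. Each integration then gains one order. -/
theorem mem_feSpace (h : FERep α r Δ v P) (hα₁ : 1 ≤ α) (hα₂ : α < 2) (hΔ : 0 < Δ) :
    v ∈ feSpace α r Δ := by
  refine ⟨memH_iff.2 ?_, fun j => ⟨P (j - 1), h.degree _, fun x hx => ?_⟩⟩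
  · obtain ⟨F, hF⟩ := IsFT.exists_of_memLp (f := fun x => (v x : ℂ)) h.memLp.ofReal
    refine ⟨F, hF, ?_⟩
    change WeightL2 (1 + α) F
    have d1 := h.l2Deriv hΔ
    have d2 := h.l2Deriv' hΔ
    have F1 := d1.isFT hF
    have F2 := d2.isFT F1
    have hr'' : ∀ j, (derivative (derivative (P j))).natDegree ≤ r := fun j =>
      natDegree_derivative_le_of_le (natDegree_derivative_le_of_le (h.degree j))
    have W2 : WeightL2 (α - 1)
        (fun ξ => 2 * Real.pi * Complex.I * ξ * (2 * Real.pi * Complex.I * ξ * F ξ)) := by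
      rcases lt_or_ge α (3 / 2) with hα | hα
      · exact weightL2_pp hΔ hr'' F2 (by linarith) (by linarith)
      · have d3 := l2Deriv_pp hΔ (h.matched'' hα) hr'' d2.memLp_deriv
        have F3 := d3.isFT F2
        exact (WeightL2.of_deriv (weightL2_zero.2 F2.memLp_right)
          (weightL2_zero.2 F3.memLp_right)).mono (by linarith)
    have W1 := (WeightL2.of_deriv (weightL2_zero.2 F1.memLp_right) (weightL2_zero.2 F2.memLp_right))
    have W1' := WeightL2.of_deriv (W1.mono (by linarith : α - 1 ≤ 0 + 1)) W2
    have W0 := WeightL2.of_deriv (weightL2_zero.2 hF.memLp_right) (weightL2_zero.2 F1.memLp_right)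
    have W0' := WeightL2.of_deriv W0 (W1.mono (by linarith))
    have := WeightL2.of_deriv (W0'.mono (by linarith : α - 1 + 1 ≤ 0 + 1 + 1)) W1'
    refine this.mono (by linarith)
  · rw [h.eq, pp_eq_of_matched (j := j - 1) hΔ h.matched]
    push_cast
    rw [sub_add_cancel]
    exact hx

theorem hasDerivAt (h : FERep α r Δ v P) (hΔ : 0 < Δ) (x : ℝ) :
    HasDerivAt v (pp Δ (fun j => derivative (P j)) x) x :=
  (h.l2Deriv hΔ).hasDerivAt (h.l2Deriv' hΔ).cont x

theorem deriv_eq (h : FERep α r Δ v P) (hΔ : 0 < Δ) :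
    deriv v = pp Δ fun j => derivative (P j) := by
  ext x
  exact (h.hasDerivAt hΔ x).deriv

theorem add (h : FERep α r Δ v P) {w : ℝ → ℝ} {Q : ℤ → ℝ[X]} (h' : FERep α r Δ w Q) :
    FERep α r Δ (v + w) (P + Q) where
  degree j := (natDegree_add_le _ _).trans (max_le (h.degree j) (h'.degree j))
  eq := by ext x; simp [h.eq, h'.eq, pp]
  memLp := h.memLp.add h'.memLp
  matched j := by simp [h.matched j, h'.matched j]
  matched' j := by simp [h.matched' j, h'.matched' j]
  matched'' hα j := by simp [h.matched'' hα j, h'.matched'' hα j]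

theorem smul (h : FERep α r Δ v P) (c : ℝ) : FERep α r Δ (c • v) (fun j => c • P j) where
  degree j := (natDegree_smul_le _ _).trans (h.degree j)
  eq := by ext x; simp [h.eq, pp]
  memLp := h.memLp.const_smul c
  matched j := by simp [h.matched j]
  matched' j := by simp [h.matched' j]
  matched'' hα j := by simp [h.matched'' hα j]

end FERep

/-- The derivative at a point is controlled by the L² norm on its own cell, with the scaling Δ^{-3}
after squaring, and a cell carries at most the whole norm. -/
theorem exists_isInverseConstant {α : ℝ} (hα₁ : 1 ≤ α) (r : ℕ) :
    ∃ C₂, IsInverseConstant α r C₂ := by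
  obtain ⟨C, hC⟩ := exists_cell_bound r
  have hC0 := hC.1
  refine ⟨C + 1, by linarith, fun Δ hΔ v hv x => ?_⟩
  obtain ⟨P, hP⟩ := exists_feRep hα₁ hΔ hv
  rw [hP.deriv_eq hΔ, pp_eq hΔ (mem_cell hΔ x)]
  set j := ⌊x / Δ⌋
  set n := (eLpNorm v 2 volume).toReal with hn
  have h1 := (IsCellConst.eval_sq_le hC hΔ hP.degree (cell_subset (mem_cell hΔ x))).2
  have h2 : cellInt Δ P j ≤ n ^ 2 := by
    rw [hn, toReal_eLpNorm_sq hP.memLp]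
    have := cellInt_le (P := P) hΔ (hP.eq ▸ hP.memLp) j
    rwa [← hP.eq] at this
  have h3 : (Δ ^ (3 / 2 : ℝ)) ^ 2 = Δ ^ 3 := by
    rw [← Real.rpow_natCast, ← Real.rpow_mul hΔ.le, ← Real.rpow_natCast]
    norm_num
  apply abs_le_of_sq_le_sq _ (by positivity)
  rw [mul_pow, div_pow, Real.sq_sqrt (by positivity), h3]
  have h4 : 0 ≤ cellInt Δ P j := cellInt_nonneg hΔ j
  calc _ ≤ C / Δ ^ 3 * cellInt Δ P j := h1
    _ ≤ (C + 1) / Δ ^ 3 * n ^ 2 := by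
        gcongr
        linarith

end

end FracKdV

/-! ### Closedness of the finite element space in L². -/

namespace FracKdV

section

open Polynomial

theorem tendsto_eval_of_coeff {r : ℕ} {p : ℕ → ℝ[X]} {q : ℝ[X]} (hp : ∀ n, (p n).natDegree ≤ r)
    (hq : q.natDegree ≤ r) (h : ∀ i, Tendsto (fun n => (p n).coeff i) atTop (𝓝 (q.coeff i)))
    (x : ℝ) : Tendsto (fun n => (p n).eval x) atTop (𝓝 (q.eval x)) := by
  rw [eval_eq_sum_range' (Nat.lt_succ_of_le hq)]
  simp only [fun n => eval_eq_sum_range' (Nat.lt_succ_of_le (hp n)) x]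
  exact tendsto_finsetSum _ fun i _ => (h i).mul_const _

theorem tendsto_coeff_derivative {p : ℕ → ℝ[X]} {q : ℝ[X]}
    (h : ∀ i, Tendsto (fun n => (p n).coeff i) atTop (𝓝 (q.coeff i))) (i : ℕ) :
    Tendsto (fun n => (derivative (p n)).coeff i) atTop (𝓝 ((derivative q).coeff i)) := by
  simp only [coeff_derivative]
  exact (h _).mul_const _

theorem matched_of_tendsto {Δ : ℝ} {r : ℕ} {P : ℕ → ℤ → ℝ[X]} {Q : ℤ → ℝ[X]}
    (hm : ∀ n, Matched Δ (P n)) (hP : ∀ n j, (P n j).natDegree ≤ r) (hQ : ∀ j, (Q j).natDegree ≤ r)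
    (h : ∀ j i, Tendsto (fun n => (P n j).coeff i) atTop (𝓝 ((Q j).coeff i))) : Matched Δ Q := by
  intro j
  refine tendsto_nhds_unique
    (tendsto_eval_of_coeff (fun n => hP n (j - 1)) (hQ _) (h (j - 1)) _) ?_
  simp only [fun n => hm n j]
  exact tendsto_eval_of_coeff (fun n => hP n j) (hQ _) (h j) _

/-- The finite element space is closed in `L²`. -/
theorem exists_mem_feSpace_of_tendsto {α Δ : ℝ} {r : ℕ} (hα₁ : 1 ≤ α) (hα₂ : α < 2) (hΔ : 0 < Δ)
    {v : ℕ → ℝ → ℝ} (hv : ∀ n, v n ∈ feSpace α r Δ) {f : ℝ → ℝ} (hf : MemLp f 2 volume)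
    (hlim : Tendsto (fun n => eLpNorm (v n - f) 2 volume) atTop (𝓝 0)) :
    ∃ w ∈ feSpace α r Δ, w =ᵐ[volume] f := by
  choose P hP using fun n => exists_feRep hα₁ hΔ (hv n)
  -- On each cell the coefficients are bounded by the L² norm, so L² convergence makes them Cauchy;
  -- degree bounds and matching conditions pass to the limit.
  have hcoeff : ∀ j i, ∃ c, Tendsto (fun n => (P n j).coeff i) atTop (𝓝 c) := by
    intro j i
    apply cauchySeq_tendsto_of_complete
    obtain ⟨C, hC, hCb⟩ := exists_coeff_sq_le r (a := (j : ℝ) * Δ) (b := j * Δ + Δ) (by linarith)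
    let b : ℕ → ℝ := fun n => (eLpNorm (v n - f) 2 volume).toReal
    have hfin : ∀ n, eLpNorm (v n - f) 2 volume ≠ ⊤ := fun n => ((hP n).memLp.sub hf).2.ne
    have hb : Tendsto b atTop (𝓝 0) := by
      have := (ENNReal.tendsto_toReal ENNReal.zero_ne_top).comp hlim
      rw [ENNReal.toReal_zero] at this
      exact this
    have key : ∀ n m, |(P n j).coeff i - (P m j).coeff i| ≤ √C * (b n + b m) := by
      intro n m
      have hrep := (hP n).add ((hP m).smul (-1))
      have e1 := hCb _ (hrep.degree j) i
      have e2 := cellInt_le (P := P n + fun j => (-1 : ℝ) • P m j) hΔ (hrep.eq ▸ hrep.memLp) j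
      rw [← hrep.eq, ← toReal_eLpNorm_sq hrep.memLp] at e2
      have e3 : (eLpNorm (v n + (-1 : ℝ) • v m) 2 volume).toReal ≤ b n + b m := by
        have : v n + (-1 : ℝ) • v m = (v n - f) - (v m - f) := by ext x; simp; ring
        rw [this]
        have h1 := eLpNorm_sub_le (p := 2) ((hP n).memLp.sub hf).1 ((hP m).memLp.sub hf).1 (by norm_num)
        have h2 := ENNReal.toReal_mono (ENNReal.add_ne_top.2 ⟨hfin n, hfin m⟩) h1
        rwa [ENNReal.toReal_add (hfin n) (hfin m)] at h2
      apply abs_le_of_sq_le_sq _ (by positivity)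
      rw [mul_pow, Real.sq_sqrt hC]
      have e4 : (P n j).coeff i - (P m j).coeff i = ((P n + fun j => (-1 : ℝ) • P m j) j).coeff i := by
        simp; ring
      rw [e4]
      refine e1.trans ?_
      gcongr
      refine e2.trans ?_
      gcongr
    rw [Metric.cauchySeq_iff]
    intro ε hε
    have hε' : 0 < ε / (2 * (√C + 1)) := by positivity
    obtain ⟨N, hN⟩ := eventually_atTop.1 (hb.eventually (gt_mem_nhds hε'))
    refine ⟨N, fun m hm n hn => ?_⟩
    rw [Real.dist_eq]
    have h1 := hN m hm
    have h2 := hN n hn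
    rw [lt_div_iff₀ (by positivity)] at h1 h2
    have h3 : 0 ≤ b m := ENNReal.toReal_nonneg
    have h4 : 0 ≤ b n := ENNReal.toReal_nonneg
    calc _ ≤ √C * (b m + b n) := key m n
      _ ≤ (√C + 1) * (b m + b n) := by gcongr; linarith
      _ < ε := by nlinarith
  choose c hc using hcoeff
  let Q : ℤ → ℝ[X] := fun j => ∑ i ∈ Finset.range (r + 1), Polynomial.C (c j i) * X ^ i
  have hQr : ∀ j, (Q j).natDegree ≤ r := by
    intro j
    apply natDegree_sum_le_of_forall_le
    intro i hi
    exact (natDegree_C_mul_X_pow_le _ _).trans (Nat.lt_succ_iff.1 (Finset.mem_range.1 hi))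
  have hQc : ∀ j i, Tendsto (fun n => (P n j).coeff i) atTop (𝓝 ((Q j).coeff i)) := by
    intro j i
    rcases le_or_gt i r with hi | hi
    · have : (Q j).coeff i = c j i := by
        simp only [Q, finsetSum_coeff, coeff_C_mul, coeff_X_pow]
        rw [Finset.sum_eq_single i] <;> simp +contextual [eq_comm]
        omega
      rw [this]
      exact hc j i
    · rw [coeff_eq_zero_of_natDegree_lt ((hQr j).trans_lt hi)]
      simp only [fun n => coeff_eq_zero_of_natDegree_lt (((hP n).degree j).trans_lt hi)]
      exact tendsto_const_nhds
  have hptw : ∀ x, Tendsto (fun n => v n x) atTop (𝓝 (pp Δ Q x)) := by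
    intro x
    simp only [fun n => (hP n).eq]
    exact tendsto_eval_of_coeff (fun n => (hP n).degree _) (hQr _) (hQc _) x
  -- A subsequence converges almost everywhere to `f`, while the whole sequence converges pointwise
  -- to the piecewise polynomial with the limit coefficients.
  have hae : pp Δ Q =ᵐ[volume] f := by
    have hm := tendstoInMeasure_of_tendsto_eLpNorm (p := 2) (by norm_num)
      (fun n => (hP n).memLp.1) hf.1 hlim
    obtain ⟨ns, hns, hns'⟩ := hm.exists_seq_tendsto_ae
    filter_upwards [hns'] with x hx
    exact tendsto_nhds_unique ((hptw x).comp hns.tendsto_atTop) hx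
  have hrep : FERep α r Δ (pp Δ Q) Q := by
    refine ⟨hQr, rfl, (memLp_congr_ae hae).2 hf, ?_, ?_, fun hα => ?_⟩
    · exact matched_of_tendsto (fun n => (hP n).matched) (fun n j => (hP n).degree j) hQr hQc
    · exact matched_of_tendsto (fun n => (hP n).matched')
        (fun n j => natDegree_derivative_le_of_le ((hP n).degree j))
        (fun j => natDegree_derivative_le_of_le (hQr j)) (fun j => tendsto_coeff_derivative (hQc j))
    · exact matched_of_tendsto (fun n => (hP n).matched'' hα)
        (fun n j => natDegree_derivative_le_of_le (natDegree_derivative_le_of_le ((hP n).degree j)))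
        (fun j => natDegree_derivative_le_of_le (natDegree_derivative_le_of_le (hQr j)))
        (fun j => tendsto_coeff_derivative (tendsto_coeff_derivative (hQc j)))
  exact ⟨_, hrep.mem_feSpace hα₁ hα₂ hΔ, hae⟩

end

end FracKdV

/-! ### Elementary inequalities for the symbols. -/

namespace FracKdV

section

theorem convexOn_sinh : ConvexOn ℝ (Ici 0) Real.sinh := by
  apply convexOn_of_deriv2_nonneg (convex_Ici 0) Real.continuous_sinh.continuousOn
    Real.differentiable_sinh.differentiableOn
  · rw [Real.deriv_sinh]; exact Real.differentiable_cosh.differentiableOn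
  · intro x hx
    rw [interior_Ici] at hx
    simp only [Function.iterate_succ, Function.iterate_zero, Function.comp_apply, Real.deriv_sinh,
      Real.deriv_cosh, id]
    exact Real.sinh_nonneg_iff.2 (le_of_lt hx)

/-- The lower bound is convexity together with sinh 0 = 0. For the upper one, if sinh s ≤ 1 then
interpolating β between 2 and 3 leaves a remainder of order sinh³ s ≤ sinh^β s; if sinh s ≥ 1 then
e^s ≤ 3 sinh s, and 27/2 ≤ 14 gives the constant. -/
theorem sinh_mul_bounds {β s : ℝ} (h2 : 2 ≤ β) (h3 : β ≤ 3) (hs : 0 ≤ s) :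
    0 ≤ Real.sinh (β * s) - β * Real.sinh s ∧
      Real.sinh (β * s) - β * Real.sinh s ≤ 14 * Real.sinh s ^ β := by
  have hS : 0 ≤ Real.sinh s := Real.sinh_nonneg_iff.2 hs
  have hlow : β * Real.sinh s ≤ Real.sinh (β * s) := by
    have := convexOn_sinh.2 (mem_Ici.2 (le_refl (0 : ℝ)))
      (mem_Ici.2 (by positivity : 0 ≤ β * s))
      (sub_nonneg.2 (inv_le_one_of_one_le₀ (by linarith : 1 ≤ β)))
      (by positivity : 0 ≤ β⁻¹) (by ring)
    simp only [smul_eq_mul, mul_zero, zero_add, Real.sinh_zero] at this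
    rw [inv_mul_cancel_left₀ (by positivity), inv_mul_eq_div, le_div_iff₀ (by positivity)] at this
    linarith
  refine ⟨by linarith, ?_⟩
  rcases le_total (Real.sinh s) 1 with h | h
  · have hc := convexOn_sinh.2 (mem_Ici.2 (by positivity : 0 ≤ 2 * s))
      (mem_Ici.2 (by positivity : 0 ≤ 3 * s)) (sub_nonneg.2 h3) (sub_nonneg.2 h2) (by ring)
    simp only [smul_eq_mul] at hc
    have e : (3 - β) * (2 * s) + (β - 2) * (3 * s) = β * s := by ring
    rw [e, Real.sinh_two_mul, Real.sinh_three_mul] at hc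
    have hC1 : 1 ≤ Real.cosh s := Real.one_le_cosh s
    have hsq := Real.cosh_sq s
    have hC : Real.cosh s - 1 ≤ Real.sinh s ^ 2 := by nlinarith
    have h5 : Real.sinh (β * s) - β * Real.sinh s ≤ 6 * Real.sinh s ^ 3 := by
      have a1 : Real.sinh s * (Real.cosh s - 1) ≤ Real.sinh s * Real.sinh s ^ 2 := by gcongr
      have a2 : (3 - β) * (2 * (Real.sinh s * (Real.cosh s - 1))) ≤ 1 * (2 * (Real.sinh s * Real.sinh s ^ 2)) := by
        gcongr
        linarith
      have a3 : (β - 2) * (4 * Real.sinh s ^ 3) ≤ 1 * (4 * Real.sinh s ^ 3) := by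
        gcongr; linarith
      nlinarith
    have h6 : Real.sinh s ^ 3 ≤ Real.sinh s ^ β := by
      rw [← Real.rpow_natCast]
      rcases hS.eq_or_lt with h0 | h0
      · rw [← h0, Real.zero_rpow (by norm_num), Real.zero_rpow (by linarith)]
      · exact Real.rpow_le_rpow_of_exponent_ge h0 h (by exact_mod_cast h3)
    have : 0 ≤ Real.sinh s ^ β := by positivity
    linarith
  · have h7 : Real.exp s ≤ 3 * Real.sinh s := by
      have e1 := Real.cosh_sub_sinh s
      have e2 := Real.cosh_add_sinh s
      have e3 : Real.exp (-s) ≤ 1 := Real.exp_le_one_iff.2 (by linarith)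
      linarith
    have h8 : Real.exp (β * s) ≤ 27 * Real.sinh s ^ β := by
      calc Real.exp (β * s) = Real.exp s ^ β := by rw [← Real.exp_mul, mul_comm]
        _ ≤ (3 * Real.sinh s) ^ β := by gcongr
        _ = 3 ^ β * Real.sinh s ^ β := Real.mul_rpow (by norm_num) hS
        _ ≤ 3 ^ (3 : ℝ) * Real.sinh s ^ β := by
            gcongr; norm_num
        _ = _ := by norm_num
    have h9 : Real.sinh (β * s) ≤ Real.exp (β * s) / 2 := by
      rw [Real.sinh_eq]; linarith [Real.exp_pos (-(β * s))]
    have : 0 ≤ β * Real.sinh s := by positivity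
    have : 0 ≤ Real.sinh s ^ β := by positivity
    linarith

/-- The remainder of the symbol of the commutator `[∂ₓ D^α, φ]`. -/
noncomputable def symRem (α ξ η : ℝ) : ℝ :=
  ξ * |ξ| ^ α - η * |η| ^ α - (1 + α) * (ξ - η) * (|ξ| ^ (α / 2) * |η| ^ (α / 2))

theorem symRem_swap (α ξ η : ℝ) : symRem α η ξ = -symRem α ξ η := by
  simp only [symRem]; ring

theorem symRem_neg (α ξ η : ℝ) : symRem α (-ξ) (-η) = -symRem α ξ η := by
  simp only [symRem, abs_neg]; ring

theorem mul_rpow_self {α ξ : ℝ} (hα : 1 ≤ α) (hξ : 0 ≤ ξ) : ξ * ξ ^ α = ξ ^ (1 + α) := by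
  rw [Real.rpow_add_of_nonneg hξ zero_le_one (by linarith), Real.rpow_one]

/-- With ξ = e^{t+s} and η = e^{t-s} the remainder equals 2e^{(1+α)t} (sinh((1+α)s) - (1+α) sinh s),
and ξ - η = 2e^t sinh s. The claim is `sinh_mul_bounds` with β = 1 + α; the constant is 2·14/4, as
2^{1+α} ≥ 4. -/
theorem abs_symRem_le_of_pos {α ξ η : ℝ} (hα₁ : 1 ≤ α) (hα₂ : α ≤ 2) (hη : 0 < η) (h : η ≤ ξ) :
    |symRem α ξ η| ≤ 7 * |ξ - η| ^ (1 + α) := by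
  have hξ : 0 < ξ := hη.trans_le h
  set s := (Real.log ξ - Real.log η) / 2 with hs
  set t := (Real.log ξ + Real.log η) / 2 with ht
  have hs0 : 0 ≤ s := by
    have := Real.log_le_log hη h
    rw [hs]; linarith
  have e1 : ξ = Real.exp (t + s) := by
    rw [hs, ht]; ring_nf; rw [Real.exp_log hξ]
  have e2 : η = Real.exp (t - s) := by
    rw [hs, ht]; ring_nf; rw [Real.exp_log hη]
  have hd : ξ - η = 2 * Real.exp t * Real.sinh s := by
    rw [e1, e2, Real.sinh_eq, Real.exp_add, sub_eq_add_neg t s, Real.exp_add]; ring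
  obtain ⟨b1, b2⟩ := sinh_mul_bounds (β := 1 + α) (by linarith) (by linarith) hs0
  have hf : symRem α ξ η = 2 * Real.exp ((1 + α) * t) *
      (Real.sinh ((1 + α) * s) - (1 + α) * Real.sinh s) := by
    rw [symRem, hd, abs_of_pos hξ, abs_of_pos hη, mul_rpow_self hα₁ hξ.le, mul_rpow_self hα₁ hη.le,
      e1, e2, ← Real.exp_mul, ← Real.exp_mul, ← Real.exp_mul, ← Real.exp_mul, ← Real.exp_add,
      Real.sinh_eq ((1 + α) * s)]
    have p1 : Real.exp ((t + s) * (1 + α)) = Real.exp ((1 + α) * t) * Real.exp ((1 + α) * s) := by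
      rw [← Real.exp_add]; ring_nf
    have p2 : Real.exp ((t - s) * (1 + α)) = Real.exp ((1 + α) * t) * Real.exp (-((1 + α) * s)) := by
      rw [← Real.exp_add]; ring_nf
    have p3 : Real.exp ((1 + α) * t) = Real.exp t * Real.exp ((t + s) * (α / 2) + (t - s) * (α / 2)) := by
      rw [← Real.exp_add]; ring_nf
    rw [p1, p2, p3]
    ring
  have hS : 0 ≤ Real.sinh s := Real.sinh_nonneg_iff.2 hs0
  rw [hf, abs_of_nonneg (by positivity), hd, abs_of_nonneg (by positivity),
    Real.mul_rpow (by positivity) hS, Real.mul_rpow (by norm_num) (by positivity), ← Real.exp_mul,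
    mul_comm t]
  have h4 : (4 : ℝ) ≤ 2 ^ (1 + α) := by
    calc (4 : ℝ) = 2 ^ (2 : ℝ) := by norm_num
      _ ≤ _ := Real.rpow_le_rpow_of_exponent_le (by norm_num) (by linarith)
  calc _ ≤ 2 * Real.exp ((1 + α) * t) * (14 * Real.sinh s ^ (1 + α)) := by gcongr
    _ = 7 * (4 * Real.exp ((1 + α) * t) * Real.sinh s ^ (1 + α)) := by ring
    _ ≤ _ := by gcongr

/-- For opposite signs there is no cancellation to exploit: |ξ| and |η| are both at most |ξ-η|, so
each term is bounded separately. -/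
theorem abs_symRem_le_of_nonpos {α ξ η : ℝ} (hα₁ : 1 ≤ α) (hα₂ : α ≤ 2) (hη : η ≤ 0) (h : 0 ≤ ξ) :
    |symRem α ξ η| ≤ 7 * |ξ - η| ^ (1 + α) := by
  obtain ⟨y, rfl⟩ : ∃ y, η = -y := ⟨-η, by ring⟩
  have hy : 0 ≤ y := by linarith
  rw [symRem, abs_neg, abs_of_nonneg h, abs_of_nonneg hy, sub_neg_eq_add, abs_of_nonneg (by linarith : 0 ≤ ξ + y)]
  rw [neg_mul, sub_neg_eq_add, mul_rpow_self hα₁ h, mul_rpow_self hα₁ hy]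
  have a1 : ξ ^ (1 + α) ≤ (ξ + y) ^ (1 + α) := by gcongr; linarith
  have a2 : y ^ (1 + α) ≤ (ξ + y) ^ (1 + α) := by gcongr; linarith
  have a3 : ξ ^ (α / 2) * y ^ (α / 2) ≤ (ξ + y) ^ α := by
    calc _ ≤ (ξ + y) ^ (α / 2) * (ξ + y) ^ (α / 2) := by gcongr <;> linarith
      _ = _ := by rw [← Real.rpow_add_of_nonneg (by linarith) (by linarith) (by linarith)]; ring_nf
  have a4 : (1 + α) * (ξ + y) * (ξ ^ (α / 2) * y ^ (α / 2)) ≤ 3 * (ξ + y) ^ (1 + α) := by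
    calc _ ≤ 3 * (ξ + y) * (ξ + y) ^ α := by gcongr; linarith
      _ = _ := by rw [mul_assoc, mul_rpow_self hα₁ (by linarith)]
  have a5 : 0 ≤ (1 + α) * (ξ + y) * (ξ ^ (α / 2) * y ^ (α / 2)) := by positivity
  have a6 : 0 ≤ ξ ^ (1 + α) := by positivity
  have a7 : 0 ≤ y ^ (1 + α) := by positivity
  have a8 : 0 ≤ (ξ + y) ^ (1 + α) := by positivity
  rw [abs_le]
  constructor <;> linarith

theorem abs_symRem_le {α : ℝ} (hα₁ : 1 ≤ α) (hα₂ : α ≤ 2) (ξ η : ℝ) :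
    |symRem α ξ η| ≤ 7 * |ξ - η| ^ (1 + α) := by
  wlog h : η ≤ ξ generalizing ξ η
  · have := this η ξ (by linarith)
    rwa [symRem_swap, abs_neg, abs_sub_comm] at this
  rcases lt_or_ge 0 η with h1 | h1
  · exact abs_symRem_le_of_pos hα₁ hα₂ h1 h
  rcases le_or_gt 0 ξ with h2 | h2
  · exact abs_symRem_le_of_nonpos hα₁ hα₂ h1 h2
  · have := abs_symRem_le_of_pos (ξ := -η) (η := -ξ) hα₁ hα₂ (by linarith) (by linarith)
    rw [symRem_neg, symRem_swap, abs_neg, abs_neg] at this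
    rwa [show -η - -ξ = ξ - η by ring] at this

/-- Subadditivity of t ↦ t^a for exponents at most 1. -/
theorem abs_rpow_sub_rpow_le {a : ℝ} (h0 : 0 < a) (h1 : a ≤ 1) (ξ η : ℝ) :
    |(|ξ| ^ a - |η| ^ a)| ≤ |ξ - η| ^ a := by
  have key : ∀ x y : ℝ, |x| ^ a ≤ |x - y| ^ a + |y| ^ a := by
    intro x y
    calc |x| ^ a ≤ (|x - y| + |y|) ^ a := by
          gcongr
          have := abs_add_le (x - y) y
          rwa [sub_add_cancel] at this
      _ ≤ _ := Real.rpow_add_le_add_rpow (abs_nonneg _) (abs_nonneg _) h0.le h1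
  have k1 := key ξ η
  have k2 := key η ξ
  rw [abs_sub_comm] at k2
  rw [abs_le]
  constructor <;> linarith

end

end FracKdV

/-! ### Bilinear integrals in Fourier space and Schur's test. -/

namespace FracKdV

section

open scoped ComplexConjugate

theorem continuous_fourier {g : ℝ → ℂ} (hg : Integrable g) : Continuous (𝓕 g) :=
  VectorFourier.fourierIntegral_continuous Real.continuous_fourierChar
    (by exact continuous_inner) hg

theorem norm_fourier_le (g : ℝ → ℂ) (ξ : ℝ) : ‖𝓕 g ξ‖ ≤ ∫ x, ‖g x‖ :=
  VectorFourier.norm_fourierIntegral_le_integral_norm _ _ _ _ _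

theorem integrable_conj {f : ℝ → ℂ} (hf : Integrable f) : Integrable fun x => conj (f x) :=
  memLp_one_iff_integrable.1 (memLp_one_iff_integrable.2 hf).star

theorem integrable_fourier_kernel {g F₁ F₂ : ℝ → ℂ} (hg : Integrable g) (h₁ : Integrable F₁)
    (h₂ : Integrable F₂) :
    Integrable (fun p : ℝ × ℝ => 𝓕 g (p.1 - p.2) * (F₁ p.2 * conj (F₂ p.1)))
      (volume.prod volume) := by
  have hp : Integrable (fun p : ℝ × ℝ => F₁ p.2 * conj (F₂ p.1)) (volume.prod volume) := by
    have := (integrable_conj h₂).mul_prod h₁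
    refine this.congr (ae_of_all _ fun p => ?_)
    simp only []
    ring
  refine hp.bdd_mul (c := ∫ x, ‖g x‖) ?_ (ae_of_all _ fun p => norm_fourier_le _ _)
  exact ((continuous_fourier hg).comp (continuous_fst.sub continuous_snd)).aestronglyMeasurable

/-- A trilinear form of Parseval's identity. -/
theorem integral_mul_fourierInv_mul_conj {g F₁ F₂ : ℝ → ℂ} (hg : Integrable g)
    (h₁ : Integrable F₁) (h₂ : Integrable F₂) :
    ∫ x, g x * (𝓕⁻ F₁ x * conj (𝓕⁻ F₂ x)) =
      ∫ p : ℝ × ℝ, 𝓕 g (p.1 - p.2) * (F₁ p.2 * conj (F₂ p.1)) ∂(volume.prod volume) := by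
  have hp : Integrable (fun p : ℝ × ℝ => F₁ p.2 * conj (F₂ p.1)) (volume.prod volume) := by
    have := (integrable_conj h₂).mul_prod h₁
    refine this.congr (ae_of_all _ fun p => ?_)
    simp only []
    ring
  let T : ℝ → ℝ × ℝ → ℂ := fun x p =>
    Complex.exp ((2 * Real.pi * x * (p.2 - p.1) : ℝ) * Complex.I) * (g x * (F₁ p.2 * conj (F₂ p.1)))
  have hT : Integrable (Function.uncurry T) (volume.prod (volume.prod volume)) := by
    have h3 := hg.mul_prod hp
    refine h3.bdd_mul (c := 1) ?_ (ae_of_all _ fun q => ?_)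
    · exact (by fun_prop : Continuous fun q : ℝ × ℝ × ℝ =>
        Complex.exp ((2 * Real.pi * q.1 * (q.2.2 - q.2.1) : ℝ) * Complex.I)).aestronglyMeasurable
    · rw [Complex.norm_exp_ofReal_mul_I]
  have hswap := integral_integral_swap hT
  have e1 : ∀ x, ∫ p, T x p ∂(volume.prod volume) = g x * (𝓕⁻ F₁ x * conj (𝓕⁻ F₂ x)) := by
    intro x
    have e2 : ∀ p : ℝ × ℝ, T x p = g x * (conj (Complex.exp ((2 * Real.pi * (p.1 * x) : ℝ) * Complex.I) * F₂ p.1) *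
        (Complex.exp ((2 * Real.pi * (p.2 * x) : ℝ) * Complex.I) * F₁ p.2)) := by
      intro p
      simp only [T, map_mul, ← Complex.exp_conj, Complex.conj_ofReal, Complex.conj_I]
      have : Complex.exp ((2 * Real.pi * x * (p.2 - p.1) : ℝ) * Complex.I) =
          Complex.exp ((2 * Real.pi * (p.1 * x) : ℝ) * -Complex.I) *
          Complex.exp ((2 * Real.pi * (p.2 * x) : ℝ) * Complex.I) := by
        rw [← Complex.exp_add]; congr 1; push_cast; ring
      rw [this]
      ring
    simp only [e2]
    rw [integral_const_mul, integral_prod_mul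
      (fun ξ : ℝ => conj (Complex.exp ((2 * Real.pi * (ξ * x) : ℝ) * Complex.I) * F₂ ξ))
      (fun η : ℝ => Complex.exp ((2 * Real.pi * (η * x) : ℝ) * Complex.I) * F₁ η),
      Real.fourierInv_eq', Real.fourierInv_eq', integral_conj]
    simp only [smul_eq_mul, RCLike.inner_apply, conj_trivial]
    simp only [mul_comm x]
    ring
  have e3 : ∀ p : ℝ × ℝ, ∫ x, T x p = 𝓕 g (p.1 - p.2) * (F₁ p.2 * conj (F₂ p.1)) := by
    intro p
    rw [Real.fourier_eq', ← integral_mul_const]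
    congr 1
    ext x
    simp only [T, smul_eq_mul, RCLike.inner_apply, conj_trivial]
    rw [← mul_assoc (Complex.exp _)]
    congr 3
    push_cast
    ring
  simp only [e1, e3] at hswap
  exact hswap

theorem integrable_sub_mul_snd {ρ f : ℝ → ℝ} (hρ : Integrable ρ) (hf : Integrable f) :
    Integrable (fun p : ℝ × ℝ => ρ (p.1 - p.2) * f p.2) (volume.prod volume) := by
  have := hf.convolution_integrand (ContinuousLinearMap.mul ℝ ℝ) hρ
  refine this.congr (ae_of_all _ fun p => ?_)
  simp [mul_comm]

theorem integrable_sub_mul_fst {ρ f : ℝ → ℝ} (hρ : Integrable ρ) (hf : Integrable f) :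
    Integrable (fun p : ℝ × ℝ => ρ (p.1 - p.2) * f p.1) (volume.prod volume) := by
  have := (hf.convolution_integrand (ContinuousLinearMap.mul ℝ ℝ) hρ.comp_neg).swap
  refine this.congr (ae_of_all _ fun p => ?_)
  simp [mul_comm]

theorem integral_sub_mul_snd {ρ f : ℝ → ℝ} (hρ : Integrable ρ) (hf : Integrable f) :
    ∫ p : ℝ × ℝ, ρ (p.1 - p.2) * f p.2 ∂(volume.prod volume) = (∫ x, ρ x) * ∫ x, f x := by
  rw [integral_prod_symm _ (integrable_sub_mul_snd hρ hf), ← integral_const_mul]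
  congr 1
  ext y
  simp only []
  rw [integral_mul_const, integral_sub_right_eq_self ρ y]

theorem integral_sub_mul_fst {ρ f : ℝ → ℝ} (hρ : Integrable ρ) (hf : Integrable f) :
    ∫ p : ℝ × ℝ, ρ (p.1 - p.2) * f p.1 ∂(volume.prod volume) = (∫ x, ρ x) * ∫ x, f x := by
  rw [integral_prod _ (integrable_sub_mul_fst hρ hf), ← integral_const_mul]
  congr 1
  ext y
  simp only []
  rw [integral_mul_const, integral_sub_left_eq_self ρ volume y]

theorem integrable_schur {ρ : ℝ → ℝ} {f : ℝ → ℝ} (hρ : Integrable ρ) (hf : Integrable f) :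
    Integrable (fun p : ℝ × ℝ => ρ (p.1 - p.2) * (f p.2 + f p.1)) (volume.prod volume) ∧
    ∫ p : ℝ × ℝ, ρ (p.1 - p.2) * (f p.2 + f p.1) ∂(volume.prod volume) =
      2 * ((∫ x, ρ x) * ∫ x, f x) := by
  simp only [mul_add]
  refine ⟨(integrable_sub_mul_snd hρ hf).add (integrable_sub_mul_fst hρ hf), ?_⟩
  rw [integral_add (integrable_sub_mul_snd hρ hf) (integrable_sub_mul_fst hρ hf),
    integral_sub_mul_snd hρ hf, integral_sub_mul_fst hρ hf]
  ring

/-- Schur's test: the product of the two values of |F| is split by the arithmetic-geometric mean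
inequality, and each half integrates to ∫ρ · ∫|F|². -/
theorem norm_integral_kernel_le {ρ : ℝ → ℝ} {F : ℝ → ℂ} {k : ℝ × ℝ → ℂ} (hρ : Integrable ρ)
    (hρ0 : ∀ x, 0 ≤ ρ x)
    (hF : MemLp F 2 volume) (hk : ∀ p, ‖k p‖ ≤ ρ (p.1 - p.2) * (‖F p.2‖ * ‖F p.1‖)) :
    ‖∫ p, k p ∂(volume.prod volume)‖ ≤ (∫ x, ρ x) * ∫ x, ‖F x‖ ^ 2 := by
  have hf : Integrable fun x => ‖F x‖ ^ 2 := (memLp_two_iff_integrable_sq_norm hF.1).1 hF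
  obtain ⟨i, e⟩ := integrable_schur hρ hf
  have := norm_integral_le_of_norm_le (i.const_mul (1 / 2)) (f := k) (ae_of_all _ fun p => by
    refine (hk p).trans ?_
    have h1 := hρ0 (p.1 - p.2)
    have h2 : ‖F p.2‖ * ‖F p.1‖ ≤ (‖F p.2‖ ^ 2 + ‖F p.1‖ ^ 2) / 2 := by
      nlinarith [sq_nonneg (‖F p.2‖ - ‖F p.1‖)]
    calc _ ≤ ρ (p.1 - p.2) * ((‖F p.2‖ ^ 2 + ‖F p.1‖ ^ 2) / 2) := by gcongr
      _ = _ := by ring)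
  rw [integral_const_mul, e] at this
  linarith

theorem conj_fourier_ofReal (Φ : ℝ → ℝ) (ξ : ℝ) :
    conj (𝓕 (fun x => (Φ x : ℂ)) ξ) = 𝓕 (fun x => (Φ x : ℂ)) (-ξ) := by
  rw [Real.fourier_eq', Real.fourier_eq', ← integral_conj]
  congr 1
  ext x
  simp only [smul_eq_mul, map_mul, ← Complex.exp_conj, Complex.conj_ofReal, Complex.conj_I]
  congr 2
  simp

end

end FracKdV

/-! ### The commutator of the dispersion with a weight. -/

namespace FracKdV

section

open scoped ComplexConjugate

theorem integrable_norm_fourier_mul_rpow {g : ℝ → ℂ} (hg : ContDiff ℝ ∞ g)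
    (hc : HasCompactSupport g) {s : ℝ} (hs : 0 ≤ s) :
    Integrable fun ζ : ℝ => ‖𝓕 g ζ‖ * |ζ| ^ s := by
  let S : 𝓢(ℝ, ℂ) := hc.toSchwartzMap hg
  have h0 := (𝓕 S).integrable_pow_mul volume 0
  have h1 := (𝓕 S).integrable_pow_mul volume ⌈s⌉₊
  have e : ((𝓕 S : 𝓢(ℝ, ℂ)) : ℝ → ℂ) = 𝓕 g := by
    rw [SchwartzMap.fourier_coe]; rfl
  rw [e] at h0 h1
  have hcont : Continuous (𝓕 g) := by rw [← e]; exact (𝓕 S).continuous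
  refine (h0.add h1).mono' ?_ (ae_of_all _ fun ζ => ?_)
  · exact hcont.norm.aestronglyMeasurable.mul (by fun_prop : Measurable fun ζ : ℝ => |ζ| ^ s).aestronglyMeasurable
  · rw [Real.norm_of_nonneg (by positivity)]
    simp only [Pi.add_apply, pow_zero, one_mul, Real.norm_eq_abs]
    have : |ζ| ^ s ≤ 1 + |ζ| ^ ⌈s⌉₊ := by
      rcases le_total |ζ| 1 with h | h
      · have := Real.rpow_le_one (abs_nonneg ζ) h hs
        have : 0 ≤ |ζ| ^ ⌈s⌉₊ := by positivity
        linarith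
      · rw [← Real.rpow_natCast]
        have := Real.rpow_le_rpow_of_exponent_le h (Nat.le_ceil s)
        linarith
    nlinarith [norm_nonneg (𝓕 g ζ)]

section

variable {α : ℝ} {F : ℝ → ℂ}

theorem WeightL2.integrable_deriv (hα₁ : 1 ≤ α) (W : WeightL2 (1 + α) F) :
    Integrable fun ξ : ℝ => 2 * Real.pi * Complex.I * ξ * F ξ :=
  (WeightL2.deriv (s := α) (by rwa [add_comm])).integrable (by linarith)

theorem WeightL2.memLp_deriv (hα₁ : 1 ≤ α) (W : WeightL2 (1 + α) F) :
    MemLp (fun ξ : ℝ => 2 * Real.pi * Complex.I * ξ * F ξ) 2 volume :=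
  (WeightL2.deriv (s := α) (by rwa [add_comm])).memLp (by linarith)

theorem WeightL2.integrable_dsym {σ : ℝ} (hσ : 0 ≤ σ) (hσα : σ ≤ α) (W : WeightL2 (1 + α) F) :
    Integrable fun ξ : ℝ => dsym σ ξ * F ξ :=
  W.integrable_mul (t := α) (measurable_dsym σ) (fun _ => norm_rpow_weight_le hσ hσα)
    (by norm_num)

theorem WeightL2.memLp_dsym {σ s : ℝ} (hσ : 0 ≤ σ) (hσs : σ ≤ s) (W : WeightL2 s F) :
    MemLp (fun ξ : ℝ => dsym σ ξ * F ξ) 2 volume :=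
  W.memLp_mul (measurable_dsym σ) (fun _ => norm_rpow_weight_le hσ hσs)

theorem dsym_eq {σ : ℝ} (ξ : ℝ) : dsym σ ξ = (((2 * Real.pi) ^ σ * |ξ| ^ σ : ℝ) : ℂ) := by
  rw [dsym, Real.mul_rpow (by positivity) (abs_nonneg _)]

theorem fourier_ofReal_deriv {Φ : ℝ → ℝ} (hΦ : ContDiff ℝ ∞ Φ) (hc : HasCompactSupport Φ) (ζ : ℝ) :
    𝓕 (fun x => ((deriv Φ x : ℝ) : ℂ)) ζ = 2 * Real.pi * Complex.I * ζ * 𝓕 (fun x => (Φ x : ℂ)) ζ := by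
  have h1 : ContDiff ℝ ∞ (fun x => (Φ x : ℂ)) := Complex.ofRealCLM.contDiff.comp hΦ
  have hd : deriv (fun x => (Φ x : ℂ)) = fun x => ((deriv Φ x : ℝ) : ℂ) := by
    ext x
    exact ((hΦ.differentiable (by simp)) x).hasDerivAt.ofReal_comp.deriv
  have hc1 : HasCompactSupport (fun x => (Φ x : ℂ)) := hc.comp_left (g := fun t : ℝ => (t : ℂ)) rfl
  have := Real.fourier_deriv (f := fun x => (Φ x : ℂ)) (h1.continuous.integrable_of_hasCompactSupport hc1)
    (h1.differentiable (by simp)) (by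
      exact (h1.continuous_deriv (by simp)).integrable_of_hasCompactSupport hc1.deriv)
  rw [← hd, this]
  simp

/-- The kernel of the symmetrised commutator. -/
noncomputable def commKernel (α : ℝ) (Φ : ℝ → ℝ) (F : ℝ → ℂ) (p : ℝ × ℝ) : ℂ :=
  𝓕 (fun x => ((deriv Φ x : ℝ) : ℂ)) (p.1 - p.2) * (dsym α p.2 * F p.2 * conj (F p.1)) +
    𝓕 (fun x => (Φ x : ℂ)) (p.1 - p.2) *
      (dsym α p.2 * F p.2 * conj (2 * Real.pi * Complex.I * p.1 * F p.1))

/-- In `commKernel` the factors ξ-η and -ξ add up to -η, leaving -2πi η|η|^α. Swapping the variables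
and conjugating adds 2πi ξ|ξ|^α with the same factor Φ̂(ξ-η), because Φ is real. Subtracting the
main term leaves exactly `symRem`. -/
theorem commKernel_add_conj {Φ : ℝ → ℝ} (hΦ : ContDiff ℝ ∞ Φ) (hc : HasCompactSupport Φ) (ξ η : ℝ) :
    commKernel α Φ F (ξ, η) + conj (commKernel α Φ F (η, ξ)) - (1 + α) *
      (𝓕 (fun x => ((deriv Φ x : ℝ) : ℂ)) (ξ - η) *
        (dsym (α / 2) η * F η * conj (dsym (α / 2) ξ * F ξ))) =
      ((2 * Real.pi * (2 * Real.pi) ^ α * symRem α ξ η : ℝ) : ℂ) * Complex.I *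
        𝓕 (fun x => (Φ x : ℂ)) (ξ - η) * (F η * conj (F ξ)) := by
  simp only [commKernel, fourier_ofReal_deriv hΦ hc]
  have e2 : conj (𝓕 (fun x => (Φ x : ℂ)) (η - ξ)) = 𝓕 (fun x => (Φ x : ℂ)) (ξ - η) := by
    rw [conj_fourier_ofReal, neg_sub]
  have e3 : (2 * Real.pi : ℝ) ^ α = (2 * Real.pi) ^ (α / 2) * (2 * Real.pi) ^ (α / 2) := by
    rw [← Real.rpow_add (by positivity)]; congr 1; ring
  simp only [map_add, map_mul, e2, Complex.conj_conj, Complex.conj_I, Complex.conj_ofReal, dsym_eq,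
    map_ofNat, symRem, e3, map_neg, neg_neg]
  generalize 𝓕 (fun x => (Φ x : ℂ)) (ξ - η) = A
  push_cast
  ring

/-- One of the 1 + α powers of |ξ-η| turns the transform of Φ into that of Φ'. The bound therefore
does not see the size of Φ itself, which is what makes it uniform in the shifts of the cutoff below.
-/
theorem norm_commKernel_le (hα₁ : 1 ≤ α) (hα₂ : α ≤ 2) {Φ : ℝ → ℝ} (hΦ : ContDiff ℝ ∞ Φ)
    (hc : HasCompactSupport Φ) (ξ η : ℝ) :
    ‖commKernel α Φ F (ξ, η) + conj (commKernel α Φ F (η, ξ)) - (1 + α) *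
      (𝓕 (fun x => ((deriv Φ x : ℝ) : ℂ)) (ξ - η) *
        (dsym (α / 2) η * F η * conj (dsym (α / 2) ξ * F ξ)))‖ ≤
      7 * (2 * Real.pi) ^ α * (‖𝓕 (fun x => ((deriv Φ x : ℝ) : ℂ)) (ξ - η)‖ * |ξ - η| ^ α) *
        (‖F η‖ * ‖F ξ‖) := by
  rw [commKernel_add_conj hΦ hc, fourier_ofReal_deriv hΦ hc]
  generalize 𝓕 (fun x => (Φ x : ℂ)) (ξ - η) = A
  simp only [norm_mul, Complex.norm_I, Complex.norm_real, Real.norm_eq_abs, RCLike.norm_conj,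
    mul_one, abs_of_pos Real.pi_pos, abs_of_pos (by positivity : (0:ℝ) < (2 * Real.pi) ^ α),
    abs_of_pos (by norm_num : (0:ℝ) < 2), Complex.norm_ofNat]
  have h7 := abs_symRem_le hα₁ hα₂ ξ η
  rw [← mul_rpow_self hα₁ (abs_nonneg _)] at h7
  calc _ ≤ 2 * Real.pi * (2 * Real.pi) ^ α * (7 * (|ξ - η| * |ξ - η| ^ α)) *
        ‖A‖ * (‖F η‖ * ‖F ξ‖) := by gcongr
    _ = _ := by ring

theorem integrable_commKernel {Φ : ℝ → ℝ} (i1 : Integrable fun x => (Φ x : ℂ))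
    (i2 : Integrable fun x => ((deriv Φ x : ℝ) : ℂ)) (hF : Integrable F)
    (hFh : Integrable fun ξ => dsym α ξ * F ξ)
    (hFx : Integrable fun ξ : ℝ => 2 * Real.pi * Complex.I * ξ * F ξ) :
    Integrable (commKernel α Φ F) (volume.prod volume) := by
  have := (integrable_fourier_kernel i2 hFh hF).add (integrable_fourier_kernel i1 hFh hFx)
  unfold commKernel
  exact this

theorem integral_add_eq_integral_commKernel {Φ : ℝ → ℝ} (i1 : Integrable fun x => (Φ x : ℂ))
    (i2 : Integrable fun x => ((deriv Φ x : ℝ) : ℂ)) (hF : Integrable F)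
    (hFh : Integrable fun ξ => dsym α ξ * F ξ)
    (hFx : Integrable fun ξ : ℝ => 2 * Real.pi * Complex.I * ξ * F ξ) :
    (∫ x, ((deriv Φ x : ℝ) : ℂ) * (𝓕⁻ (fun ξ : ℝ => dsym α ξ * F ξ) x * conj (𝓕⁻ F x))) +
      ∫ x, (Φ x : ℂ) * (𝓕⁻ (fun ξ : ℝ => dsym α ξ * F ξ) x *
        conj (𝓕⁻ (fun ξ : ℝ => 2 * Real.pi * Complex.I * ξ * F ξ) x)) =
      ∫ p, commKernel α Φ F p ∂(volume.prod volume) := by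
  rw [integral_mul_fourierInv_mul_conj i2 hFh hF, integral_mul_fourierInv_mul_conj i1 hFh hFx,
    ← integral_add (integrable_fourier_kernel i2 hFh hF) (integrable_fourier_kernel i1 hFh hFx)]
  unfold commKernel
  rfl

/-- The first bracket is ⟨D^α w, (Φw)ₓ⟩, whose double real part is symmetrised in the two
frequencies; the remaining kernel is handled by Schur's test. -/
theorem norm_commutator_le (hα₁ : 1 ≤ α) (hα₂ : α ≤ 2) (W : WeightL2 (1 + α) F) {Φ : ℝ → ℝ}
    (hΦ : ContDiff ℝ ∞ Φ) (hc : HasCompactSupport Φ) {w wx h d : ℝ → ℂ}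
    (hw : w = 𝓕⁻ F) (hwx : wx = 𝓕⁻ (fun ξ : ℝ => 2 * Real.pi * Complex.I * ξ * F ξ))
    (hh : h = 𝓕⁻ (fun ξ : ℝ => dsym α ξ * F ξ))
    (hd : d = 𝓕⁻ (fun ξ : ℝ => dsym (α / 2) ξ * F ξ)) :
    ‖((∫ x, ((deriv Φ x : ℝ) : ℂ) * (h x * conj (w x))) + ∫ x, (Φ x : ℂ) * (h x * conj (wx x))) +
      conj ((∫ x, ((deriv Φ x : ℝ) : ℂ) * (h x * conj (w x))) + ∫ x, (Φ x : ℂ) * (h x * conj (wx x))) -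
      (1 + α) * ∫ x, ((deriv Φ x : ℝ) : ℂ) * (d x * conj (d x))‖ ≤
    (7 * (2 * Real.pi) ^ α * ∫ ζ, ‖𝓕 (fun x => ((deriv Φ x : ℝ) : ℂ)) ζ‖ * |ζ| ^ α) * ∫ ξ, ‖F ξ‖ ^ 2 := by
  have hF : Integrable F := W.integrable (by linarith)
  have hFx := W.integrable_deriv hα₁
  have hFh := W.integrable_dsym (σ := α) (by linarith) le_rfl
  have hFd := W.integrable_dsym (σ := α / 2) (by linarith) (by linarith)
  have hΦd : ContDiff ℝ ∞ (deriv Φ) := hΦ.deriv' 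
  have c1 : HasCompactSupport (fun x => (Φ x : ℂ)) := hc.comp_left (g := fun t : ℝ => (t : ℂ)) rfl
  have c2 : HasCompactSupport (fun x => ((deriv Φ x : ℝ) : ℂ)) :=
    hc.deriv.comp_left (g := fun t : ℝ => (t : ℂ)) rfl
  have s1 : ContDiff ℝ ∞ (fun x => (Φ x : ℂ)) := Complex.ofRealCLM.contDiff.comp hΦ
  have s2 : ContDiff ℝ ∞ (fun x => ((deriv Φ x : ℝ) : ℂ)) := Complex.ofRealCLM.contDiff.comp hΦd
  have i1 : Integrable (fun x => (Φ x : ℂ)) := s1.continuous.integrable_of_hasCompactSupport c1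
  have i2 : Integrable (fun x => ((deriv Φ x : ℝ) : ℂ)) := s2.continuous.integrable_of_hasCompactSupport c2
  subst hw hwx hh hd
  have ik : Integrable (commKernel α Φ F) (volume.prod volume) :=
    integrable_commKernel i1 i2 hF hFh hFx
  have ik' : Integrable (fun p => conj (commKernel α Φ F p)) (volume.prod volume) :=
    memLp_one_iff_integrable.1 (memLp_one_iff_integrable.2 ik).star
  -- Only after exchanging the two frequencies in the conjugate do the kernels cancel pointwise.
  have eswap : ∫ p, conj (commKernel α Φ F p) ∂(volume.prod volume) =
      ∫ p, conj (commKernel α Φ F p.swap) ∂(volume.prod volume) :=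
    (integral_prod_swap (μ := volume) (ν := volume) (fun p => conj (commKernel α Φ F p))).symm
  have id := integrable_fourier_kernel i2 hFd hFd
  rw [integral_add_eq_integral_commKernel i1 i2 hF hFh hFx,
    integral_mul_fourierInv_mul_conj i2 hFd hFd, ← integral_conj]
  have ik'' : Integrable (fun p : ℝ × ℝ => conj (commKernel α Φ F p.swap)) (volume.prod volume) :=
    ik'.swap
  have ia : Integrable (fun p : ℝ × ℝ => commKernel α Φ F p + conj (commKernel α Φ F p.swap))
      (volume.prod volume) := ik.add ik''
  rw [eswap, ← integral_const_mul, ← integral_add ik ik'', ← integral_sub ia (id.const_mul _)]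
  have iρ := (integrable_norm_fourier_mul_rpow s2 c2 (s := α) (by linarith)).const_mul (7 * (2 * Real.pi) ^ α)
  rw [← integral_const_mul (7 * (2 * Real.pi) ^ α)]
  exact norm_integral_kernel_le (F := F) iρ (fun x => by positivity)
    (W.memLp (by linarith)) (fun p => norm_commKernel_le hα₁ hα₂ hΦ hc p.1 p.2)

end

theorem norm_fourier_comp_sub (g : ℝ → ℂ) (c ζ : ℝ) : ‖𝓕 (fun x => g (x - c)) ζ‖ = ‖𝓕 g ζ‖ := by
  have := congrFun (VectorFourier.fourierIntegral_comp_add_right Real.fourierChar volume (innerₗ ℝ) g (-c)) ζ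
  have e : 𝓕 (fun x => g (x - c)) ζ =
      VectorFourier.fourierIntegral Real.fourierChar volume (innerₗ ℝ) (g ∘ fun v => v + -c) ζ := rfl
  rw [e, this, Circle.norm_smul]
  rfl

theorem eq_of_forall_deriv_eq_zero {φ : ℝ → ℝ} (hφ : ContDiff ℝ ∞ φ) {a b : ℝ}
    (h : ∀ t ∈ uIcc a b, deriv φ t = 0) : φ b = φ a := by
  have h1 := intervalIntegral.integral_deriv_eq_sub (f := φ) (a := a) (b := b)
    (fun x _ => hφ.differentiable (by simp) x)
    ((hφ.continuous_deriv (by simp)).intervalIntegrable _ _)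
  rw [intervalIntegral.integral_congr (g := fun _ => (0 : ℝ)) (fun t ht => h t ht)] at h1
  simp at h1
  linarith

namespace IsCutoff

variable {R : ℝ} {φ : ℝ → ℝ}

theorem eq_of_le_neg (hR : 0 < R) (hφ : IsCutoff R φ) {x : ℝ} (hx : x ≤ -(R + 1)) :
    φ x = φ (-(R + 1)) := by
  refine (eq_of_forall_deriv_eq_zero hφ.smooth fun t ht => hφ.deriv_eq_zero t ?_).symm
  rw [uIcc_of_le hx] at ht
  rw [abs_of_nonpos (by linarith [ht.2])]
  linarith [ht.2]

theorem eq_of_le (hR : 0 < R) (hφ : IsCutoff R φ) {x : ℝ} (hx : R + 1 ≤ x) :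
    φ x = φ (R + 1) := by
  refine (eq_of_forall_deriv_eq_zero hφ.smooth fun t ht => hφ.deriv_eq_zero t ?_)
  rw [uIcc_of_le hx] at ht
  rw [abs_of_nonneg (by linarith [ht.1])]
  linarith [ht.1]

theorem hasCompactSupport_deriv (hφ : IsCutoff R φ) : HasCompactSupport (deriv φ) :=
  HasCompactSupport.intro isCompact_Icc (K := Icc (-(R + 1)) (R + 1)) fun x hx =>
    hφ.deriv_eq_zero x (by
      by_contra h
      push Not at h
      exact hx ⟨by linarith [neg_abs_le x], by linarith [le_abs_self x]⟩)

/-- The cutoff is constant on either side of its transition region, with values that need not agree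
or vanish. Subtracting a far translate gives a compactly supported weight that agrees with φ up to a
constant on any bounded set once n is large. -/
theorem hasCompactSupport_sub_shift (hR : 0 < R) (hφ : IsCutoff R φ) (n : ℕ) :
    HasCompactSupport fun x => φ x - φ (x - n) :=
  HasCompactSupport.intro isCompact_Icc (K := Icc (-(R + 1)) (R + 1 + n)) fun x hx => by
    have hn : (0 : ℝ) ≤ n := n.cast_nonneg
    rcases lt_or_ge x (-(R + 1)) with h | h
    · rw [hφ.eq_of_le_neg hR h.le, hφ.eq_of_le_neg hR (x := x - n) (by linarith), sub_self]
    · have : R + 1 + n < x := by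
        by_contra h'
        exact hx ⟨h, not_lt.1 h'⟩
      rw [hφ.eq_of_le hR (x := x) (by linarith), hφ.eq_of_le hR (x := x - n) (by linarith), sub_self]

theorem contDiff_shift (hφ : IsCutoff R φ) (c : ℝ) : ContDiff ℝ ∞ fun x => φ (x - c) :=
  hφ.smooth.comp (contDiff_id.sub contDiff_const)

theorem deriv_sub_shift (hφ : IsCutoff R φ) (c x : ℝ) :
    deriv (fun x => φ x - φ (x - c)) x = deriv φ x - deriv φ (x - c) := by
  have h1 := (hφ.smooth.differentiable (by simp) x).hasDerivAt
  have h2 := (hφ.smooth.differentiable (by simp) (x - c)).hasDerivAt.comp_sub_const x c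
  exact (h1.sub h2).deriv

theorem eventually_shift (hR : 0 < R) (hφ : IsCutoff R φ) (x : ℝ) :
    ∀ᶠ n : ℕ in atTop, φ (x - n) = φ (-(R + 1)) ∧ deriv φ (x - n) = 0 := by
  filter_upwards [eventually_ge_atTop ⌈x + (R + 1)⌉₊] with n hn
  have h1 : x + (R + 1) ≤ n := (Nat.le_ceil _).trans (by exact_mod_cast hn)
  refine ⟨hφ.eq_of_le_neg hR (by linarith), hφ.deriv_eq_zero _ ?_⟩
  rw [abs_of_nonpos (by linarith)]
  linarith

/-- The constant in the coercivity estimate for `D^α`. -/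
noncomputable def commConst (α : ℝ) (φ : ℝ → ℝ) : ℝ :=
  14 * (2 * Real.pi) ^ α * ∫ ζ, ‖𝓕 (fun x => ((deriv φ x : ℝ) : ℂ)) ζ‖ * |ζ| ^ α

theorem commConst_nonneg (α : ℝ) (φ : ℝ → ℝ) : 0 ≤ commConst α φ :=
  mul_nonneg (by positivity) (integral_nonneg fun _ => by positivity)

/-- Translation does not change the modulus of a Fourier transform, so the derivative of the shifted
difference costs at most twice that of φ. This is uniform in n and explains 14 = 2·7 in `commConst`.
-/
theorem norm_commutator_shift_le (hR : 0 < R) (hφ : IsCutoff R φ) {α : ℝ} {F : ℝ → ℂ}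
    (hα₁ : 1 ≤ α) (hα₂ : α ≤ 2) (W : WeightL2 (1 + α) F) {w wx h d : ℝ → ℂ}
    (hw : w = 𝓕⁻ F) (hwx : wx = 𝓕⁻ (fun ξ : ℝ => 2 * Real.pi * Complex.I * ξ * F ξ))
    (hh : h = 𝓕⁻ (fun ξ : ℝ => dsym α ξ * F ξ))
    (hd : d = 𝓕⁻ (fun ξ : ℝ => dsym (α / 2) ξ * F ξ)) (n : ℕ) :
    ‖((∫ x, ((deriv φ x - deriv φ (x - n) : ℝ) : ℂ) * (h x * conj (w x))) +
        ∫ x, ((φ x - φ (x - n) : ℝ) : ℂ) * (h x * conj (wx x))) +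
      conj ((∫ x, ((deriv φ x - deriv φ (x - n) : ℝ) : ℂ) * (h x * conj (w x))) +
        ∫ x, ((φ x - φ (x - n) : ℝ) : ℂ) * (h x * conj (wx x))) -
      (1 + α) * ∫ x, ((deriv φ x - deriv φ (x - n) : ℝ) : ℂ) * (d x * conj (d x))‖ ≤
    commConst α φ * ∫ ξ, ‖F ξ‖ ^ 2 := by
  have := norm_commutator_le hα₁ hα₂ W (Φ := fun x => φ x - φ (x - n))
    (hφ.smooth.sub (hφ.contDiff_shift n)) (hφ.hasCompactSupport_sub_shift hR n) hw hwx hh hd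
  simp only [hφ.deriv_sub_shift] at this
  refine this.trans ?_
  have hF0 : 0 ≤ ∫ ξ, ‖F ξ‖ ^ 2 := integral_nonneg fun _ => by positivity
  refine mul_le_mul_of_nonneg_right ?_ hF0
  have s1 : ContDiff ℝ ∞ (fun x => ((deriv φ x : ℝ) : ℂ)) :=
    Complex.ofRealCLM.contDiff.comp hφ.smooth.deriv'
  have c1 : HasCompactSupport (fun x => ((deriv φ x : ℝ) : ℂ)) :=
    hφ.hasCompactSupport_deriv.comp_left (g := fun t : ℝ => (t : ℂ)) rfl
  have i1 := integrable_norm_fourier_mul_rpow s1 c1 (s := α) (by linarith)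
  have j1 : Integrable (fun x => ((deriv φ x : ℝ) : ℂ)) :=
    s1.continuous.integrable_of_hasCompactSupport c1
  have j2 : Integrable (fun x => ((deriv φ (x - n) : ℝ) : ℂ)) := j1.comp_sub_right n
  have key : ∀ ζ, ‖𝓕 (fun x => ((deriv φ x - deriv φ (x - n) : ℝ) : ℂ)) ζ‖ ≤
      2 * ‖𝓕 (fun x => ((deriv φ x : ℝ) : ℂ)) ζ‖ := by
    intro ζ
    have e : 𝓕 (fun x => ((deriv φ x - deriv φ (x - n) : ℝ) : ℂ)) ζ =
        𝓕 (fun x => ((deriv φ x : ℝ) : ℂ)) ζ - 𝓕 (fun x => ((deriv φ (x - n) : ℝ) : ℂ)) ζ := by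
      simp only [Complex.ofReal_sub]
      simp only [Real.fourier_eq', smul_eq_mul]
      rw [← integral_sub]
      · simp only [mul_sub]
      · exact j1.bdd_mul (c := 1) (by fun_prop) (ae_of_all _ fun x => by
          rw [Complex.norm_exp]; simp)
      · exact j2.bdd_mul (c := 1) (by fun_prop) (ae_of_all _ fun x => by
          rw [Complex.norm_exp]; simp)
    rw [e]
    refine (norm_sub_le _ _).trans ?_
    rw [norm_fourier_comp_sub (fun x => ((deriv φ x : ℝ) : ℂ)) n ζ]
    linarith
  have : ∫ ζ, ‖𝓕 (fun x => ((deriv φ x - deriv φ (x - n) : ℝ) : ℂ)) ζ‖ * |ζ| ^ α ≤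
      ∫ ζ, 2 * (‖𝓕 (fun x => ((deriv φ x : ℝ) : ℂ)) ζ‖ * |ζ| ^ α) := by
    apply integral_mono_of_nonneg (ae_of_all _ fun _ => by positivity) (i1.const_mul 2)
    refine ae_of_all _ fun ζ => ?_
    simp only []
    rw [← mul_assoc]
    gcongr
    exact key ζ
  rw [integral_const_mul] at this
  rw [commConst]
  have h7 : 0 < 7 * (2 * Real.pi) ^ α := by positivity
  nlinarith

end IsCutoff

end

end FracKdV

/-! ### Coercivity of the dispersive term for the cutoff itself. -/

namespace FracKdV

section

open scoped ComplexConjugate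

theorem MemLp.integrable_mul_conj {f g : ℝ → ℂ} (hf : MemLp f 2 volume) (hg : MemLp g 2 volume) :
    Integrable fun x => f x * conj (g x) :=
  hf.integrable_mul hg.star

theorem tendsto_integral_ofReal_mul {a : ℕ → ℝ → ℝ} {b : ℝ → ℝ} {k : ℝ → ℂ} (hk : Integrable k)
    {C : ℝ} (hm : ∀ n, Measurable (a n)) (hb : ∀ n x, |a n x| ≤ C)
    (h : ∀ x, ∀ᶠ n in atTop, a n x = b x) :
    Tendsto (fun n => ∫ x, (a n x : ℂ) * k x) atTop (𝓝 (∫ x, (b x : ℂ) * k x)) := by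
  refine tendsto_integral_of_dominated_convergence (fun x => C * ‖k x‖) (fun n => ?_)
    (hk.norm.const_mul C) (fun n => ae_of_all _ fun x => ?_) (ae_of_all _ fun x => ?_)
  · exact (hm n).complex_ofReal.aestronglyMeasurable.mul hk.1
  · rw [norm_mul, Complex.norm_real]
    exact mul_le_mul_of_nonneg_right (hb n x) (norm_nonneg _)
  · refine tendsto_const_nhds.congr' ?_
    filter_upwards [h x] with n hn
    rw [hn]

namespace IsCutoff

variable {R α : ℝ} {φ : ℝ → ℝ} {F : ℝ → ℂ}

/-- Dominated convergence as n tends to infinity. The limit weight is φ minus its value at the far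
left, and the constant drops out because ⟨D^α w, wₓ⟩ has real part 0. -/
theorem abs_commutator_le (hR : 0 < R) (hφ : IsCutoff R φ)
    (hα₁ : 1 ≤ α) (hα₂ : α ≤ 2) (W : WeightL2 (1 + α) F) {w wx h d : ℝ → ℂ}
    (hw : w = 𝓕⁻ F) (hwx : wx = 𝓕⁻ (fun ξ : ℝ => 2 * Real.pi * Complex.I * ξ * F ξ))
    (hh : h = 𝓕⁻ (fun ξ : ℝ => dsym α ξ * F ξ))
    (hd : d = 𝓕⁻ (fun ξ : ℝ => dsym (α / 2) ξ * F ξ)) :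
    |2 * ((∫ x, (deriv φ x : ℝ) * (h x * conj (w x))) +
        ∫ x, (φ x : ℂ) * (h x * conj (wx x))).re -
      (1 + α) * ∫ x, deriv φ x * ‖d x‖ ^ 2| ≤ commConst α φ * ∫ ξ, ‖F ξ‖ ^ 2 := by
  have Fw : IsFT w F := hw ▸ IsFT.fourierInv_of_integrable (W.memLp (by linarith)) (W.integrable (by linarith))
  have Fwx : IsFT wx _ := hwx ▸ IsFT.fourierInv_of_integrable (W.memLp_deriv hα₁) (W.integrable_deriv hα₁)
  have Fh : IsFT h _ := hh ▸ IsFT.fourierInv_of_integrable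
    (W.memLp_dsym (σ := α) (by linarith) (by linarith)) (W.integrable_dsym (by linarith) le_rfl)
  have Fd : IsFT d _ := hd ▸ IsFT.fourierInv_of_integrable
    (W.memLp_dsym (σ := α / 2) (by linarith) (by linarith))
    (W.integrable_dsym (by linarith) (by linarith))
  have i1 := MemLp.integrable_mul_conj Fh.memLp_left Fw.memLp_left
  have i2 := MemLp.integrable_mul_conj Fh.memLp_left Fwx.memLp_left
  have i3 := MemLp.integrable_mul_conj Fd.memLp_left Fd.memLp_left
  have mφ : Measurable φ := hφ.smooth.continuous.measurable
  have mψ : Measurable (deriv φ) := measurable_deriv φ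
  have bψ : ∀ (n : ℕ) x, |deriv φ x - deriv φ (x - n)| ≤ 1 := fun n x => by
    rw [abs_le]
    constructor <;> linarith [hφ.deriv_nonneg x, hφ.deriv_le_one x, hφ.deriv_nonneg (x - n),
      hφ.deriv_le_one (x - n)]
  have bφ : ∀ (n : ℕ) x, |φ x - φ (x - n)| ≤ 2 + 2 * R := fun n x => by
    rw [abs_le]
    constructor <;> linarith [hφ.one_le x, hφ.le x, hφ.one_le (x - n), hφ.le (x - n)]
  have eψ : ∀ x, ∀ᶠ n : ℕ in atTop, deriv φ x - deriv φ (x - n) = deriv φ x := fun x => by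
    filter_upwards [hφ.eventually_shift hR x] with n hn
    rw [hn.2, sub_zero]
  have eφ : ∀ x, ∀ᶠ n : ℕ in atTop, φ x - φ (x - n) = φ x - φ (-(R + 1)) := fun x => by
    filter_upwards [hφ.eventually_shift hR x] with n hn
    rw [hn.1]
  have t1 := tendsto_integral_ofReal_mul i1 (a := fun n x => deriv φ x - deriv φ (x - n))
    (fun n => by fun_prop) bψ eψ
  have t2 := tendsto_integral_ofReal_mul i2 (a := fun n x => φ x - φ (x - n))
    (fun n => by fun_prop) bφ eφ
  have t3 := tendsto_integral_ofReal_mul i3 (a := fun n x => deriv φ x - deriv φ (x - n))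
    (fun n => by fun_prop) bψ eψ
  have t := (((t1.add t2).add ((Complex.continuous_conj.tendsto _).comp (t1.add t2))).sub
    (t3.const_mul (1 + α : ℂ))).norm
  have hle := le_of_tendsto t (Eventually.of_forall fun n =>
    hφ.norm_commutator_shift_le hR hα₁ hα₂ W hw hwx hh hd n)
  -- On the Fourier side the integrand is purely imaginary: the symbol of D^α is real and that of ∂ₓ
  -- imaginary.
  have e0 : (∫ x, h x * conj (wx x)).re = 0 := by
    rw [Fh.integral_mul_conj Fwx]
    have := integral_re (f := fun ξ => dsym α ξ * F ξ * conj (2 * Real.pi * Complex.I * ξ * F ξ))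
      (MemLp.integrable_mul_conj Fh.memLp_right Fwx.memLp_right)
    simp only [RCLike.re_to_complex] at this
    rw [← this]
    apply integral_eq_zero_of_ae
    refine ae_of_all _ fun ξ => ?_
    have e : dsym α ξ * F ξ * conj (2 * Real.pi * Complex.I * ξ * F ξ) =
        ((-((2 * Real.pi * |ξ|) ^ α * (2 * Real.pi) * ξ * ‖F ξ‖ ^ 2) : ℝ) : ℂ) * Complex.I := by
      have : F ξ * conj (F ξ) = ((‖F ξ‖ ^ 2 : ℝ) : ℂ) := by
        rw [Complex.mul_conj, Complex.normSq_eq_norm_sq]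
      simp only [map_mul, Complex.conj_I, Complex.conj_ofReal, map_ofNat, dsym]
      push_cast at this ⊢
      linear_combination (-((2 * Real.pi * |ξ|) ^ α : ℝ) * (2 * Real.pi) * ξ * Complex.I : ℂ) * this
    simp only []
    rw [e, Complex.re_ofReal_mul, Complex.I_re, mul_zero]
    rfl
  have e2 : ∫ x, ((φ x - φ (-(R + 1)) : ℝ) : ℂ) * (h x * conj (wx x)) =
      (∫ x, (φ x : ℂ) * (h x * conj (wx x))) - φ (-(R + 1)) * ∫ x, h x * conj (wx x) := by
    rw [← integral_const_mul, ← integral_sub]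
    · congr 1
      ext x
      push_cast
      ring
    · exact i2.bdd_mul (c := 2 + 2 * R) mφ.complex_ofReal.aestronglyMeasurable (ae_of_all _ fun x => by
        rw [Complex.norm_real, Real.norm_of_nonneg (by linarith [hφ.one_le x])]
        exact hφ.le x)
    · exact i2.const_mul _
  have e3 : ∫ x, ((deriv φ x : ℝ) : ℂ) * (d x * conj (d x)) =
      ((∫ x, deriv φ x * ‖d x‖ ^ 2 : ℝ) : ℂ) := by
    rw [← integral_complex_ofReal]
    congr 1
    ext x
    rw [Complex.mul_conj, Complex.normSq_eq_norm_sq]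
    push_cast
    rfl
  rw [e2, e3] at hle
  have h4 := (Complex.abs_re_le_norm _).trans hle
  refine le_trans (le_of_eq ?_) h4
  congr 1
  simp only [Complex.add_re, Complex.sub_re, Complex.conj_re, Complex.mul_re, Complex.ofReal_re,
    Complex.ofReal_im, e0, Complex.one_re, Complex.one_im, Complex.add_im]
  ring

end IsCutoff

theorem L2Deriv.add {f g f' g' : ℝ → ℝ} (h : L2Deriv f g) (h' : L2Deriv f' g') :
    L2Deriv (fun x => f x + f' x) (fun x => g x + g' x) := by
  obtain ⟨N, hN, hd⟩ := h.deriv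
  obtain ⟨N', hN', hd'⟩ := h'.deriv
  exact ⟨h.cont.add h'.cont, ⟨N ∪ N', hN.union hN', fun x hx =>
    (hd x fun h => hx (Or.inl h)).add (hd' x fun h => hx (Or.inr h))⟩,
    h.memLp.add h'.memLp, h.memLp_deriv.add h'.memLp_deriv⟩

theorem MemLp.bdd_mul_continuous {χ f : ℝ → ℝ} {C : ℝ} (hχ : Continuous χ) (hb : ∀ x, |χ x| ≤ C)
    (hf : MemLp f 2 volume) : MemLp (fun x => χ x * f x) 2 volume :=
  MemLp.of_le_mul (c := C) hf (hχ.aestronglyMeasurable.mul hf.1) (ae_of_all _ fun x => by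
    rw [norm_mul]
    exact mul_le_mul_of_nonneg_right (hb x) (norm_nonneg _))

theorem L2Deriv.smooth_mul {f g χ : ℝ → ℝ} {C C' : ℝ} (h : L2Deriv f g) (hχ : ContDiff ℝ ∞ χ)
    (hb : ∀ x, |χ x| ≤ C) (hb' : ∀ x, |_root_.deriv χ x| ≤ C') :
    L2Deriv (fun x => χ x * f x) (fun x => _root_.deriv χ x * f x + χ x * g x) := by
  obtain ⟨N, hN, hd⟩ := h.deriv
  exact ⟨hχ.continuous.mul h.cont, ⟨N, hN, fun x hx =>
    (hχ.differentiable (by simp) x).hasDerivAt.mul (hd x hx)⟩,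
    MemLp.bdd_mul_continuous hχ.continuous hb h.memLp,
    (MemLp.bdd_mul_continuous (hχ.continuous_deriv (by simp)) hb' h.memLp).add
      (MemLp.bdd_mul_continuous hχ.continuous hb h.memLp_deriv)⟩

theorem IsCutoff.abs_le {R : ℝ} {φ : ℝ → ℝ} (hφ : IsCutoff R φ) (x : ℝ) : |φ x| ≤ 2 + 2 * R := by
  rw [abs_of_nonneg (by linarith [hφ.one_le x])]
  exact hφ.le x

theorem IsCutoff.abs_deriv_le {R : ℝ} {φ : ℝ → ℝ} (hφ : IsCutoff R φ) (x : ℝ) : |deriv φ x| ≤ 1 := by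
  rw [abs_of_nonneg (hφ.deriv_nonneg x)]
  exact hφ.deriv_le_one x

theorem HasCompactSupport.exists_abs_le {f : ℝ → ℝ} (hf : Continuous f) (hc : HasCompactSupport f) :
    ∃ C, ∀ x, |f x| ≤ C :=
  hc.exists_bound_of_continuous hf

section

variable {α R Δ : ℝ} {r : ℕ} {v : ℝ → ℝ} {φ : ℝ → ℝ}

theorem exists_isFT_of_mem_feSpace (hv : v ∈ feSpace α r Δ) :
    ∃ F, IsFT (fun x => (v x : ℂ)) F ∧ WeightL2 (1 + α) F := memH_iff.1 hv.1

theorem l2Deriv_of_mem_feSpace (hα₁ : 1 ≤ α) (hΔ : 0 < Δ) (hv : v ∈ feSpace α r Δ) :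
    L2Deriv v (deriv v) := by
  obtain ⟨P, hP⟩ := exists_feRep hα₁ hΔ hv
  rw [hP.deriv_eq hΔ]
  exact hP.l2Deriv hΔ

theorem hasDerivAt_of_mem_feSpace (hα₁ : 1 ≤ α) (hΔ : 0 < Δ) (hv : v ∈ feSpace α r Δ) (x : ℝ) :
    HasDerivAt v (deriv v x) x := by
  obtain ⟨P, hP⟩ := exists_feRep hα₁ hΔ hv
  rw [hP.deriv_eq hΔ]
  exact hP.hasDerivAt hΔ x

theorem exists_l2Deriv_deriv_of_mem_feSpace (hα₁ : 1 ≤ α) (hΔ : 0 < Δ) (hv : v ∈ feSpace α r Δ) :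
    ∃ g, L2Deriv (deriv v) g := by
  obtain ⟨P, hP⟩ := exists_feRep hα₁ hΔ hv
  rw [hP.deriv_eq hΔ]
  exact ⟨_, hP.l2Deriv' hΔ⟩

theorem deriv_cutoff_mul (hφ : IsCutoff R φ) (hα₁ : 1 ≤ α) (hΔ : 0 < Δ) (hv : v ∈ feSpace α r Δ) :
    deriv (fun x => φ x * v x) = fun x => deriv φ x * v x + φ x * deriv v x := by
  ext x
  exact ((hφ.smooth.differentiable (by simp) x).hasDerivAt.mul
    (hasDerivAt_of_mem_feSpace hα₁ hΔ hv x)).deriv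

theorem l2Deriv_cutoff_mul (hφ : IsCutoff R φ) (hα₁ : 1 ≤ α) (hΔ : 0 < Δ) (hv : v ∈ feSpace α r Δ) :
    L2Deriv (fun x => φ x * v x) (deriv (fun x => φ x * v x)) := by
  rw [deriv_cutoff_mul hφ hα₁ hΔ hv]
  exact (l2Deriv_of_mem_feSpace hα₁ hΔ hv).smooth_mul hφ.smooth hφ.abs_le hφ.abs_deriv_le

theorem exists_l2Deriv_deriv_cutoff_mul (hφ : IsCutoff R φ) (hα₁ : 1 ≤ α) (hΔ : 0 < Δ)
    (hv : v ∈ feSpace α r Δ) : ∃ g, L2Deriv (deriv (fun x => φ x * v x)) g := by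
  rw [deriv_cutoff_mul hφ hα₁ hΔ hv]
  obtain ⟨g, hg⟩ := exists_l2Deriv_deriv_of_mem_feSpace hα₁ hΔ hv
  have hs : ContDiff ℝ ∞ (deriv φ) := hφ.smooth.deriv'
  obtain ⟨C, hC⟩ := HasCompactSupport.exists_abs_le (hs.continuous_deriv (by simp))
    hφ.hasCompactSupport_deriv.deriv
  exact ⟨_, ((l2Deriv_of_mem_feSpace hα₁ hΔ hv).smooth_mul hs hφ.abs_deriv_le hC).add
    (hg.smooth_mul hφ.smooth hφ.abs_le hφ.abs_deriv_le)⟩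

theorem fracD_of_weightL2 {F : ℝ → ℂ} {σ : ℝ} (hα₁ : 1 ≤ α) (hF : IsFT (fun x => (v x : ℂ)) F)
    (W : WeightL2 (1 + α) F) (hσ : 0 ≤ σ) (hσα : σ ≤ α) :
    IsFT (fun x => (fracD σ v x : ℂ)) (fun ξ => dsym σ ξ * F ξ) ∧
      (fun x => (fracD σ v x : ℂ)) =ᵐ[volume] 𝓕⁻ (fun ξ => dsym σ ξ * F ξ) := by
  have hm := W.memLp_dsym (σ := σ) hσ (by linarith)
  have h := fracD_ae_eq hF (W.integrable (by linarith)) hm (W.integrable_dsym hσ hσα)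
  exact ⟨(fracDLp_isFT hF hm).congr_left h.2.symm, h.1⟩

/-- By Plancherel half of the derivatives move from `V` to `v`. It is enough that `V` lies in H¹,
since α/2 ≤ 1; taking the real part of D^{α/2} V is harmless because the other factor is real. -/
theorem dot_fracD {F : ℝ → ℂ} {V g : ℝ → ℝ} (hα₁ : 1 ≤ α) (hα₂ : α ≤ 2)
    (hF : IsFT (fun x => (v x : ℂ)) F) (W : WeightL2 (1 + α) F) (hV : L2Deriv V g) :
    dot (fracD (α / 2) v) (fracD (α / 2) V) = dot (fracD α v) V := by
  obtain ⟨G, hG⟩ := IsFT.exists_of_memLp (f := fun x => (V x : ℂ)) hV.memLp.ofReal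
  have WG : WeightL2 (0 + 1) G := WeightL2.of_deriv (weightL2_zero.2 hG.memLp_right)
    (weightL2_zero.2 (hV.isFT hG).memLp_right)
  have h1 := (fracD_of_weightL2 hα₁ hF W (σ := α / 2) (by linarith) (by linarith)).1
  have h2 := (fracD_of_weightL2 hα₁ hF W (σ := α) (by linarith) le_rfl).1
  have h3 := fracDLp_isFT hG (WG.memLp_dsym (σ := α / 2) (by linarith) (by linarith))
  have e1 := h3.integral_mul_conj h1
  have e2 := hG.integral_mul_conj h2
  have e3 : ∫ ξ, dsym (α / 2) ξ * G ξ * conj (dsym (α / 2) ξ * F ξ) =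
      ∫ ξ, G ξ * conj (dsym α ξ * F ξ) := by
    congr 1
    ext ξ
    have : (2 * Real.pi * |ξ|) ^ α = (2 * Real.pi * |ξ|) ^ (α / 2) * (2 * Real.pi * |ξ|) ^ (α / 2) := by
      rw [← Real.rpow_add_of_nonneg (by positivity) (by linarith) (by linarith)]; congr 1; ring
    simp only [map_mul, dsym, Complex.conj_ofReal, this]
    push_cast
    ring
  rw [e3, ← e2] at e1
  have i1 := integral_re (MemLp.integrable_mul_conj h3.memLp_left h1.memLp_left)
  have i2 := integral_re (MemLp.integrable_mul_conj hG.memLp_left h2.memLp_left)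
  rw [e1, ← i2] at i1
  simp only [Complex.conj_ofReal, RCLike.re_to_complex, Complex.re_mul_ofReal, Complex.ofReal_re] at i1
  rw [dot, dot]
  simp only [mul_comm (fracD _ v _)]
  exact i1

theorem integral_norm_sq_eq {f : ℝ → ℝ} {F : ℝ → ℂ} (h : IsFT (fun x => (f x : ℂ)) F) :
    ∫ ξ, ‖F ξ‖ ^ 2 = ∫ x, f x ^ 2 := by
  have := h.integral_mul_conj h
  simp only [Complex.mul_conj, Complex.normSq_eq_norm_sq] at this
  rw [integral_complex_ofReal, integral_complex_ofReal, Complex.ofReal_inj] at this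
  simpa using this.symm

/-- This is the local smoothing gain: the commutator estimate in real form, with (φv)ₓ expanded by
the product rule. -/
theorem le_dot_fracD (hR : 0 < R) (hφ : IsCutoff R φ) (hα₁ : 1 ≤ α) (hα₂ : α ≤ 2) (hΔ : 0 < Δ)
    (hv : v ∈ feSpace α r Δ) :
    (1 + α) / 2 * (∫ x, deriv φ x * fracD (α / 2) v x ^ 2) - IsCutoff.commConst α φ / 2 * ∫ x, v x ^ 2 ≤
      dot (fracD (α / 2) v) (fracD (α / 2) (deriv fun x => φ x * v x)) := by
  obtain ⟨F, hF, W⟩ := exists_isFT_of_mem_feSpace hv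
  obtain ⟨g, hg⟩ := exists_l2Deriv_deriv_cutoff_mul hφ hα₁ hΔ hv
  rw [dot_fracD hα₁ hα₂ hF W hg, deriv_cutoff_mul hφ hα₁ hΔ hv]
  have h1 := fracD_of_weightL2 hα₁ hF W (σ := α / 2) (by linarith) (by linarith)
  have h2 := fracD_of_weightL2 hα₁ hF W (σ := α) (by linarith) le_rfl
  have d1 := l2Deriv_of_mem_feSpace hα₁ hΔ hv
  have a1 := hF.unique_left (IsFT.fourierInv_of_integrable (W.memLp (by linarith)) (W.integrable (by linarith)))
  have a2 := (d1.isFT hF).unique_left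
    (IsFT.fourierInv_of_integrable (W.memLp_deriv hα₁) (W.integrable_deriv hα₁))
  have key := hφ.abs_commutator_le hR hα₁ hα₂ W rfl rfl rfl rfl
  rw [integral_norm_sq_eq hF] at key
  have e1 : ∫ x, deriv φ x * ‖𝓕⁻ (fun ξ : ℝ => dsym (α / 2) ξ * F ξ) x‖ ^ 2 =
      ∫ x, deriv φ x * fracD (α / 2) v x ^ 2 := by
    apply integral_congr_ae
    filter_upwards [h1.2] with x hx
    rw [← hx, Complex.norm_real, Real.norm_eq_abs, sq_abs]
  have m2 : MemLp (fracD α v) 2 volume := by simpa using h2.1.memLp_left.re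
  have j1 : Integrable (fun x => deriv φ x * (fracD α v x * v x)) :=
    (m2.integrable_mul d1.memLp).bdd_mul (c := 1)
      (hφ.smooth.continuous_deriv (by simp)).aestronglyMeasurable (ae_of_all _ hφ.abs_deriv_le)
  have j2 : Integrable (fun x => φ x * (fracD α v x * deriv v x)) :=
    (m2.integrable_mul d1.memLp_deriv).bdd_mul (c := 2 + 2 * R)
      hφ.smooth.continuous.aestronglyMeasurable (ae_of_all _ hφ.abs_le)
  have e2 : (∫ x, ((deriv φ x : ℝ) : ℂ) * (𝓕⁻ (fun ξ : ℝ => dsym α ξ * F ξ) x * conj (𝓕⁻ F x))) =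
      ((∫ x, deriv φ x * (fracD α v x * v x) : ℝ) : ℂ) := by
    rw [← integral_complex_ofReal]
    apply integral_congr_ae
    filter_upwards [h2.2, a1] with x hx hx1
    rw [← hx, ← hx1, Complex.conj_ofReal]
    push_cast
    rfl
  have e3 : (∫ x, (φ x : ℂ) * (𝓕⁻ (fun ξ : ℝ => dsym α ξ * F ξ) x *
      conj (𝓕⁻ (fun ξ : ℝ => 2 * Real.pi * Complex.I * ξ * F ξ) x))) =
      ((∫ x, φ x * (fracD α v x * deriv v x) : ℝ) : ℂ) := by
    rw [← integral_complex_ofReal]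
    apply integral_congr_ae
    filter_upwards [h2.2, a2] with x hx hx1
    rw [← hx, ← hx1, Complex.conj_ofReal]
    push_cast
    rfl
  rw [e1, e2, e3, ← Complex.ofReal_add, Complex.ofReal_re, ← integral_add j1 j2] at key
  have e4 : dot (fracD α v) (fun x => deriv φ x * v x + φ x * deriv v x) =
      ∫ x, (deriv φ x * (fracD α v x * v x) + φ x * (fracD α v x * deriv v x)) := by
    rw [dot]
    congr 1
    ext x
    ring
  rw [e4]
  have := (abs_le.1 key).1
  linarith

end

end

end FracKdV

/-! ### Convolution estimates: Young's inequality and a trilinear bound. -/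

namespace FracKdV

section

open scoped ComplexConjugate

theorem fourier_mul_fourierInv {g F : ℝ → ℂ} (hg : Integrable g) (hF : Integrable F) (ξ : ℝ) :
    𝓕 (fun x => g x * 𝓕⁻ F x) ξ = ∫ η, 𝓕 g (ξ - η) * F η := by
  let T : ℝ → ℝ → ℂ := fun x η =>
    Complex.exp ((2 * Real.pi * x * (η - ξ) : ℝ) * Complex.I) * (g x * F η)
  have hT : Integrable (Function.uncurry T) (volume.prod volume) := by
    refine (hg.mul_prod hF).bdd_mul (c := 1) ?_ (ae_of_all _ fun q => ?_)
    · exact (by fun_prop : Continuous fun q : ℝ × ℝ =>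
        Complex.exp ((2 * Real.pi * q.1 * (q.2 - ξ) : ℝ) * Complex.I)).aestronglyMeasurable
    · rw [Complex.norm_exp_ofReal_mul_I]
  have hswap := integral_integral_swap hT
  have e1 : ∀ x, ∫ η, T x η = Complex.exp ((-2 * Real.pi * (x * ξ) : ℝ) * Complex.I) * (g x * 𝓕⁻ F x) := by
    intro x
    rw [Real.fourierInv_eq', ← integral_const_mul, ← integral_const_mul]
    congr 1
    ext η
    simp only [T, smul_eq_mul, RCLike.inner_apply, conj_trivial]
    have : Complex.exp ((2 * Real.pi * x * (η - ξ) : ℝ) * Complex.I) =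
        Complex.exp ((-2 * Real.pi * (x * ξ) : ℝ) * Complex.I) *
          Complex.exp ((2 * Real.pi * (x * η) : ℝ) * Complex.I) := by
      rw [← Complex.exp_add]; congr 1; push_cast; ring
    rw [this]
    ring
  have e2 : ∀ η, ∫ x, T x η = 𝓕 g (ξ - η) * F η := by
    intro η
    rw [Real.fourier_eq', ← integral_mul_const]
    congr 1
    ext x
    simp only [T, smul_eq_mul, RCLike.inner_apply, conj_trivial]
    rw [← mul_assoc (Complex.exp _)]
    congr 3
    push_cast
    ring
  simp only [e1, e2] at hswap
  rw [← hswap, Real.fourier_eq']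
  congr 1
  ext x
  simp only [smul_eq_mul, RCLike.inner_apply, conj_trivial]
  rw [mul_comm ξ x]

/-- Young's inequality `L¹ * L² → L²` for a function dominated by a convolution. -/
theorem integral_norm_sq_le_of_le_convolution {ρ : ℝ → ℝ} {F : ℝ → ℂ} {D : ℝ → ℂ}
    (hρ : Integrable ρ) (hρ0 : ∀ x, 0 ≤ ρ x) (hF : MemLp F 2 volume) {k : ℝ → ℝ → ℂ}
    (hk : ∀ ξ η, ‖k ξ η‖ ≤ ρ (ξ - η) * ‖F η‖) (hD : ∀ ξ, D ξ = ∫ η, k ξ η) :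
    ∫ ξ, ‖D ξ‖ ^ 2 ≤ (∫ x, ρ x) ^ 2 * ∫ ξ, ‖F ξ‖ ^ 2 := by
  set c := ∫ x, ρ x with hc
  have hc0 : 0 ≤ c := integral_nonneg hρ0
  have hf : Integrable fun x => ‖F x‖ ^ 2 := (memLp_two_iff_integrable_sq_norm hF.1).1 hF
  have i1 := integrable_sub_mul_snd hρ hf
  have key : ∀ᵐ ξ, ‖D ξ‖ ^ 2 ≤ c * ∫ η, ρ (ξ - η) * ‖F η‖ ^ 2 := by
    filter_upwards [i1.prod_right_ae] with ξ hξ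
    set I := ∫ η, ρ (ξ - η) * ‖F η‖ ^ 2 with hI
    have hI0 : 0 ≤ I := integral_nonneg fun η => mul_nonneg (hρ0 _) (by positivity)
    have hρξ : Integrable fun η => ρ (ξ - η) := hρ.comp_sub_left ξ
    -- A weighted arithmetic-geometric mean with a free parameter `t` stands in for Cauchy–Schwarz;
    -- optimising `t` gives ‖D ξ‖² ≤ c I.
    have main : ∀ t : ℝ, 0 < t → 2 * ‖D ξ‖ ≤ t * c + t⁻¹ * I := by
      intro t ht
      have := norm_integral_le_of_norm_le ((hρξ.const_mul (t / 2)).add (hξ.const_mul (t⁻¹ / 2)))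
        (f := k ξ) (ae_of_all _ fun η => by
          refine (hk ξ η).trans ?_
          have h1 : ‖F η‖ ≤ t / 2 + t⁻¹ / 2 * ‖F η‖ ^ 2 := by
            have : t / 2 + t⁻¹ / 2 * ‖F η‖ ^ 2 - ‖F η‖ = t⁻¹ / 2 * (t - ‖F η‖) ^ 2 := by
              field_simp; ring
            have : 0 ≤ t⁻¹ / 2 * (t - ‖F η‖) ^ 2 := by positivity
            linarith
          have := mul_le_mul_of_nonneg_left h1 (hρ0 (ξ - η))
          simp only [Pi.add_apply]
          linarith)
      rw [integral_add' (hρξ.const_mul (t / 2)) (hξ.const_mul (t⁻¹ / 2)), integral_const_mul, integral_const_mul,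
        integral_sub_left_eq_self ρ volume ξ, ← hD, ← hI, ← hc] at this
      linarith
    set x := ‖D ξ‖ with hx
    have hx0 : 0 ≤ x := norm_nonneg _
    rcases hx0.eq_or_lt with h0 | h0
    · rw [← h0]; simp only [ne_eq, OfNat.ofNat_ne_zero, not_false_eq_true, zero_pow]; positivity
    · rcases hc0.eq_or_lt with h1 | h1
      · exfalso
        -- If the kernel has mass 0, this choice of `t` contradicts ‖D ξ‖ > 0.
        have := main ((I + 1) / x) (by positivity)
        rw [← h1, mul_zero, zero_add, inv_div, div_mul_eq_mul_div, le_div_iff₀ (by positivity)] at this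
        nlinarith
      · have := main (x / c) (by positivity)
        rw [div_mul_cancel₀ _ h1.ne', inv_div, div_mul_eq_mul_div] at this
        have h2 : x ≤ c * I / x := by linarith
        rw [le_div_iff₀ h0] at h2
        nlinarith
  calc ∫ ξ, ‖D ξ‖ ^ 2 ≤ ∫ ξ, c * ∫ η, ρ (ξ - η) * ‖F η‖ ^ 2 :=
        integral_mono_of_nonneg (ae_of_all _ fun _ => by positivity) (i1.integral_prod_left.const_mul c) key
    _ = c * ∫ p : ℝ × ℝ, ρ (p.1 - p.2) * ‖F p.2‖ ^ 2 ∂(volume.prod volume) := by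
        rw [integral_const_mul, integral_prod _ i1]
    _ = _ := by rw [integral_sub_mul_snd hρ hf]; ring

/-- The weight used for the Sobolev embedding into `L⁴`. -/
theorem integrable_one_add_abs_rpow : Integrable fun ξ : ℝ => (1 + |ξ|) ^ (-(3 / 2) : ℝ) := by
  have := integrable_one_add_norm (E := ℝ) (μ := volume) (r := 3 / 2) (by simp; norm_num)
  simpa using this

/-- Inserting s² = m(ξ-η) m(ξ) and splitting the product gives one term with both weighted norms and
one with |F|²/(m m). The latter is integrable because m^{-2} = (1+|ξ|)^{-3/2} is. Weighting the
split by G + 1, with G the weighted norm of `f₁`, makes the final bound linear in G when `f₁ = f₂`.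
-/
theorem norm_integral_mul_mul_le {f₁ f₂ F : ℝ → ℂ} {m : ℝ → ℝ} (hm : m = fun ξ => (1 + |ξ|) ^ (3 / 4 : ℝ))
    (h1 : Integrable fun ξ => m ξ * ‖f₁ ξ‖ ^ 2) (h2 : Integrable fun ξ => m ξ * ‖f₂ ξ‖ ^ 2)
    (hF : MemLp F 2 volume) :
    ‖∫ p : ℝ × ℝ, f₁ (p.1 - p.2) * (F p.2 * conj (f₂ p.1)) ∂(volume.prod volume)‖ ≤
      ((∫ ξ, m ξ * ‖f₁ ξ‖ ^ 2) * (∫ ξ, m ξ * ‖f₂ ξ‖ ^ 2) / ((∫ ξ, m ξ * ‖f₁ ξ‖ ^ 2) + 1) +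
        ((∫ ξ, m ξ * ‖f₁ ξ‖ ^ 2) + 1) * ((∫ ξ : ℝ, (1 + |ξ|) ^ (-(3 / 2) : ℝ)) * ∫ ξ, ‖F ξ‖ ^ 2)) / 2 := by
  have hf : Integrable fun x => ‖F x‖ ^ 2 := (memLp_two_iff_integrable_sq_norm hF.1).1 hF
  set G := ∫ ξ, m ξ * ‖f₁ ξ‖ ^ 2 with hG
  have hm0 : ∀ ξ, 0 < m ξ := fun ξ => by rw [hm]; positivity
  have hG0 : 0 ≤ G := integral_nonneg fun ξ => by have := hm0 ξ; positivity
  set wt : ℝ → ℝ := fun ξ => (1 + |ξ|) ^ (-(3 / 2) : ℝ) with hwt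
  have hwm : ∀ ξ, (m ξ)⁻¹ ^ 2 = wt ξ := by
    intro ξ
    rw [hm, hwt]
    simp only []
    rw [← Real.rpow_neg (by positivity), ← Real.rpow_natCast, ← Real.rpow_mul (by positivity)]
    norm_num
  have hwi : Integrable wt := integrable_one_add_abs_rpow
  have i1 := (integrable_sub_mul_fst h1 h2).const_mul (1 / (2 * (G + 1)))
  have i2 := (integrable_sub_mul_snd hwi hf).const_mul ((G + 1) / 4)
  have i3 : Integrable (fun p : ℝ × ℝ => (G + 1) / 4 * (wt p.1 * ‖F p.2‖ ^ 2)) (volume.prod volume) :=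
    (hwi.mul_prod hf).const_mul _
  have := norm_integral_le_of_norm_le ((i1.add i2).add i3)
    (f := fun p : ℝ × ℝ => f₁ (p.1 - p.2) * (F p.2 * conj (f₂ p.1))) (ae_of_all _ fun p => by
      simp only [norm_mul, RCLike.norm_conj, Pi.add_apply, ← hwm]
      have ha := hm0 (p.1 - p.2)
      have hb := hm0 p.1
      set a := m (p.1 - p.2)
      set b := m p.1
      set x := ‖f₁ (p.1 - p.2)‖
      set y := ‖f₂ p.1‖
      set z := ‖F p.2‖
      have hs : (√(a * b)) ^ 2 = a * b := Real.sq_sqrt (by positivity)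
      set s := √(a * b) with hsdef
      have hs0 : 0 < s := Real.sqrt_pos.2 (by positivity)
      have e1 : x * (z * y) = (s * (x * y)) * (z / s) := by field_simp
      have e2 : (s * (x * y)) * (z / s) ≤
          ((s * (x * y)) ^ 2 / (G + 1) + (G + 1) * (z / s) ^ 2) / 2 := by
        have hg : 0 < G + 1 := by linarith
        have : ((s * (x * y)) ^ 2 / (G + 1) + (G + 1) * (z / s) ^ 2) / 2 - (s * (x * y)) * (z / s) =
          ((s * (x * y)) - (G + 1) * (z / s)) ^ 2 / (2 * (G + 1)) := by
          field_simp
          ring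
        have h3 : 0 ≤ ((s * (x * y)) - (G + 1) * (z / s)) ^ 2 / (2 * (G + 1)) := by positivity
        linarith
      have e3 : (z / s) ^ 2 ≤ (a⁻¹ ^ 2 + b⁻¹ ^ 2) / 2 * z ^ 2 := by
        rw [div_pow, hs, div_eq_mul_inv, mul_comm, mul_inv]
        gcongr
        nlinarith [sq_nonneg (a⁻¹ - b⁻¹)]
      have hg : 0 < G + 1 := by linarith
      have e4 : (s * (x * y)) ^ 2 / (G + 1) / 2 = 1 / (2 * (G + 1)) * (a * x ^ 2 * (b * y ^ 2)) := by
        rw [mul_pow, hs]; field_simp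
      rw [e1]
      nlinarith)
  refine this.trans (le_of_eq ?_)
  rw [integral_add' (i1.add i2) i3, integral_add' i1 i2, integral_const_mul, integral_const_mul,
    integral_const_mul, integral_sub_mul_fst h1 h2, integral_sub_mul_snd hwi hf,
    integral_prod_mul wt (fun x => ‖F x‖ ^ 2)]
  field_simp
  ring

end

end FracKdV

/-! ### Absorbing the cubic term into the smoothing term. -/

namespace FracKdV

section

open scoped ComplexConjugate

theorem rpow_three_fourths_le {s ε : ℝ} (hs : 0 ≤ s) (hε : 0 < ε) :
    s ^ (3 / 4 : ℝ) ≤ ε * s + ε⁻¹ ^ 3 := by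
  obtain ⟨t, ht, rfl⟩ : ∃ t : ℝ, 0 ≤ t ∧ s = t ^ 4 :=
    ⟨s ^ (1 / 4 : ℝ), by positivity, by
      rw [← Real.rpow_natCast, ← Real.rpow_mul hs]; norm_num⟩
  have e : (t ^ 4) ^ (3 / 4 : ℝ) = t ^ 3 := by
    rw [← Real.rpow_natCast, ← Real.rpow_mul ht, ← Real.rpow_natCast]; norm_num
  rw [e]
  rcases le_total t ε⁻¹ with h | h
  · have : t ^ 3 ≤ ε⁻¹ ^ 3 := by gcongr
    have : 0 ≤ ε * t ^ 4 := by positivity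
    linarith
  · have h1 : 1 ≤ ε * t := by
      have := mul_le_mul_of_nonneg_left h hε.le
      rwa [mul_inv_cancel₀ hε.ne'] at this
    have : 0 ≤ t ^ 3 := by positivity
    have : 0 ≤ ε⁻¹ ^ 3 := by positivity
    nlinarith

/-- The exponent 3/4 is below 1 ≤ α, so this weight is of lower order than the smoothing symbol and
can be given an arbitrarily small coefficient; yet twice 3/4 exceeds 1, as the trilinear bound
needs. -/
theorem weight_le_dsym {α ε : ℝ} (hα₁ : 1 ≤ α) (hε : 0 < ε) (ξ : ℝ) :
    (1 + |ξ|) ^ (3 / 4 : ℝ) ≤ ε * ‖dsym (α / 2) ξ‖ ^ 2 + (2 * ε + ε⁻¹ ^ 3) := by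
  have h1 := rpow_three_fourths_le (s := 1 + |ξ|) (by positivity) hε
  have h2 : ‖dsym (α / 2) ξ‖ ^ 2 = (2 * Real.pi * |ξ|) ^ α := by
    rw [dsym, Complex.norm_real, Real.norm_of_nonneg (by positivity), ← Real.rpow_natCast,
      ← Real.rpow_mul (by positivity)]
    congr 1
    push_cast
    ring
  have h3 : |ξ| ≤ 1 + (2 * Real.pi * |ξ|) ^ α := by
    have hp : |ξ| ≤ 2 * Real.pi * |ξ| := by nlinarith [Real.pi_gt_three, abs_nonneg ξ]
    rcases le_total |ξ| 1 with h | h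
    · have : 0 ≤ (2 * Real.pi * |ξ|) ^ α := by positivity
      linarith
    · have := Real.rpow_le_rpow_of_exponent_le (h.trans hp) hα₁
      rw [Real.rpow_one] at this
      linarith
  rw [h2]
  nlinarith

theorem IsFT.integral_norm_sq {f F : ℝ → ℂ} (h : IsFT f F) : ∫ ξ, ‖F ξ‖ ^ 2 = ∫ x, ‖f x‖ ^ 2 := by
  have := h.integral_mul_conj h
  simp only [Complex.mul_conj, Complex.normSq_eq_norm_sq] at this
  rw [integral_complex_ofReal, integral_complex_ofReal, Complex.ofReal_inj] at this
  exact this.symm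

theorem MemLp.integrable_norm_sq {F : ℝ → ℂ} (hF : MemLp F 2 volume) : Integrable fun x => ‖F x‖ ^ 2 :=
  (memLp_two_iff_integrable_sq_norm hF.1).1 hF

section

variable {α : ℝ} {F : ℝ → ℂ} {χ : ℝ → ℝ}

theorem integrable_mul_of_memLp (hχ : Continuous χ) (hc : HasCompactSupport χ) {f : ℝ → ℂ}
    (hf : MemLp f 2 volume) :
    Integrable (fun x => (χ x : ℂ) * f x) ∧ MemLp (fun x => (χ x : ℂ) * f x) 2 volume := by
  have hχc : Continuous fun x => (χ x : ℂ) := Complex.continuous_ofReal.comp hχ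
  have hcc : HasCompactSupport fun x => (χ x : ℂ) := hc.comp_left (g := fun t : ℝ => (t : ℂ)) rfl
  refine ⟨(hχc.memLp_of_hasCompactSupport (p := 2) hcc).integrable_mul hf, ?_⟩
  obtain ⟨C, hC⟩ := HasCompactSupport.exists_abs_le hχ hc
  exact MemLp.of_le_mul (c := C) hf (hχc.aestronglyMeasurable.mul hf.1) (ae_of_all _ fun x => by
    rw [norm_mul, Complex.norm_real]
    exact mul_le_mul_of_nonneg_right (hC x) (norm_nonneg _))

/-- The constant in the commutator estimate for `D^{α/2}` and a multiplication operator. -/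
noncomputable def mulConst (α : ℝ) (χ : ℝ → ℝ) : ℝ :=
  ∫ ζ, (2 * Real.pi) ^ (α / 2) * (‖𝓕 (fun x => (χ x : ℂ)) ζ‖ * |ζ| ^ (α / 2))

/-- `‖D^{α/2}(χ w)‖² ≤ 2 ‖χ D^{α/2} w‖² + C ‖w‖²`. -/
theorem integral_dsym_mul_fourier_le (hα₁ : 1 ≤ α) (hα₂ : α ≤ 2) (W : WeightL2 (1 + α) F)
    (hχ : ContDiff ℝ ∞ χ) (hc : HasCompactSupport χ)
    (hm : MemLp (fun ξ => dsym (α / 2) ξ * 𝓕 (fun x => (χ x : ℂ) * 𝓕⁻ F x) ξ) 2 volume) :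
    ∫ ξ, ‖dsym (α / 2) ξ * 𝓕 (fun x => (χ x : ℂ) * 𝓕⁻ F x) ξ‖ ^ 2 ≤
      2 * (∫ x, ‖(χ x : ℂ) * 𝓕⁻ (fun ξ => dsym (α / 2) ξ * F ξ) x‖ ^ 2) +
        2 * (mulConst α χ ^ 2 * ∫ ξ, ‖F ξ‖ ^ 2) := by
  have hF := W.integrable (by linarith)
  have hd := W.integrable_dsym (σ := α / 2) (by linarith) (by linarith)
  have hd2 := W.memLp_dsym (σ := α / 2) (by linarith) (by linarith)
  have cχ : HasCompactSupport (fun x => (χ x : ℂ)) := hc.comp_left (g := fun t : ℝ => (t : ℂ)) rfl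
  have sχ : ContDiff ℝ ∞ (fun x => (χ x : ℂ)) := Complex.ofRealCLM.contDiff.comp hχ
  have iχ : Integrable (fun x => (χ x : ℂ)) := sχ.continuous.integrable_of_hasCompactSupport cχ
  obtain ⟨j1, j2⟩ := integrable_mul_of_memLp hχ.continuous hc
    (IsFT.fourierInv_of_integrable hd2 hd).memLp_left
  have FB := IsFT.of_integrable j2 j1
  rw [← FB.integral_norm_sq]
  set A : ℝ → ℂ := fun ξ => dsym (α / 2) ξ * 𝓕 (fun x => (χ x : ℂ) * 𝓕⁻ F x) ξ with hA
  set B : ℝ → ℂ := 𝓕 (fun x => (χ x : ℂ) * 𝓕⁻ (fun ξ => dsym (α / 2) ξ * F ξ) x) with hB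
  have hρ := (integrable_norm_fourier_mul_rpow sχ cχ (s := α / 2) (by linarith)).const_mul
    ((2 * Real.pi) ^ (α / 2))
  -- The difference of D^{α/2}(χw) and χ D^{α/2} w has the kernel χ̂(ξ-η)(|ξ|^{α/2} - |η|^{α/2}) up
  -- to a constant. As α/2 ≤ 1 it is dominated by a convolution kernel, so Young's inequality bounds
  -- it on L².
  have hD := integral_norm_sq_le_of_le_convolution (D := fun ξ => A ξ - B ξ)
    (k := fun ξ η => 𝓕 (fun x => (χ x : ℂ)) (ξ - η) * ((dsym (α / 2) ξ - dsym (α / 2) η) * F η))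
    hρ (fun _ => by positivity) (W.memLp (by linarith)) (fun ξ η => ?_) (fun ξ => ?_)
  · have iD : Integrable fun ξ => ‖A ξ - B ξ‖ ^ 2 := MemLp.integrable_norm_sq (hm.sub FB.memLp_right)
    have iB := MemLp.integrable_norm_sq FB.memLp_right
    calc ∫ ξ, ‖A ξ‖ ^ 2 ≤ ∫ ξ, (2 * ‖B ξ‖ ^ 2 + 2 * ‖A ξ - B ξ‖ ^ 2) := by
          apply integral_mono (MemLp.integrable_norm_sq hm) ((iB.const_mul 2).add (iD.const_mul 2))
          intro ξ
          have h1 : ‖A ξ‖ ≤ ‖B ξ‖ + ‖A ξ - B ξ‖ := by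
            have := norm_add_le (B ξ) (A ξ - B ξ)
            rwa [add_sub_cancel] at this
          simp only [Pi.add_apply]
          nlinarith [norm_nonneg (A ξ), sq_nonneg (‖B ξ‖ - ‖A ξ - B ξ‖)]
      _ = 2 * (∫ ξ, ‖B ξ‖ ^ 2) + 2 * ∫ ξ, ‖A ξ - B ξ‖ ^ 2 := by
          rw [integral_add (iB.const_mul 2) (iD.const_mul 2), integral_const_mul, integral_const_mul]
      _ ≤ _ := by
          gcongr
          exact hD
  · rw [norm_mul, norm_mul, ← mul_assoc]
    refine mul_le_mul_of_nonneg_right ?_ (norm_nonneg _)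
    rw [dsym_eq, dsym_eq, ← Complex.ofReal_sub, Complex.norm_real, ← mul_sub, norm_mul,
      Real.norm_of_nonneg (by positivity), Real.norm_eq_abs]
    have := abs_rpow_sub_rpow_le (a := α / 2) (by linarith) (by linarith) ξ η
    calc _ ≤ ‖𝓕 (fun x => (χ x : ℂ)) (ξ - η)‖ * ((2 * Real.pi) ^ (α / 2) * |ξ - η| ^ (α / 2)) := by gcongr
      _ = _ := by ring
  · simp only [hA, hB]
    rw [fourier_mul_fourierInv iχ hF, fourier_mul_fourierInv iχ hd, ← integral_const_mul, ← integral_sub]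
    · congr 1
      ext η
      ring
    · have := (hF.bdd_mul (c := ∫ x, ‖(χ x : ℂ)‖)
        ((continuous_fourier iχ).comp (continuous_const.sub continuous_id)).aestronglyMeasurable
        (ae_of_all _ fun η => norm_fourier_le _ _) : Integrable fun η => 𝓕 (fun x => (χ x : ℂ)) (ξ - η) * F η)
      exact this.const_mul _
    · exact hd.bdd_mul (c := ∫ x, ‖(χ x : ℂ)‖)
        ((continuous_fourier iχ).comp (continuous_const.sub continuous_id)).aestronglyMeasurable
        (ae_of_all _ fun η => norm_fourier_le _ _)

end

theorem WeightL2.integrable_rpow_mul_sq {F : ℝ → ℂ} (W : WeightL2 1 F) :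
    Integrable fun ξ : ℝ => (1 + |ξ|) ^ (3 / 4 : ℝ) * ‖F ξ‖ ^ 2 := by
  have h := (MemLp.integrable_norm_sq W).const_mul 2
  refine h.mono' ?_ (ae_of_all _ fun ξ => ?_)
  · exact (by fun_prop : Measurable fun ξ : ℝ => (1 + |ξ|) ^ (3 / 4 : ℝ)).aestronglyMeasurable.mul
      (W.aestronglyMeasurable.norm.pow 2)
  · rw [Real.norm_of_nonneg (by positivity), norm_mul, mul_pow, Complex.norm_real,
      Real.norm_of_nonneg (by positivity), ← Real.sqrt_eq_rpow, Real.sq_sqrt (by positivity), ← mul_assoc]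
    gcongr
    calc (1 + |ξ|) ^ (3 / 4 : ℝ) ≤ (1 + |ξ|) ^ (1 : ℝ) :=
          Real.rpow_le_rpow_of_exponent_le (by linarith [abs_nonneg ξ]) (by norm_num)
      _ = 1 + |ξ| := Real.rpow_one _
      _ ≤ _ := by rw [Real.norm_eq_abs]; nlinarith [sq_nonneg (|ξ| - 1), abs_nonneg ξ]

/-- The integral is ∫ f² v with f = √φₓ v. It is linear in the weighted norm of f, and that norm is
a small multiple of ‖D^{α/2} f‖² plus lower order terms; smoothness of √φₓ allows it to be commuted
through D^{α/2}. -/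
theorem IsCutoff.abs_integral_cube_le {R α : ℝ} {φ : ℝ → ℝ} (hφ : IsCutoff R φ) (hα₁ : 1 ≤ α)
    (hα₂ : α ≤ 2) (r : ℕ) {M : ℝ} (hM : 0 ≤ M) :
    ∃ C, 0 ≤ C ∧ ∀ Δ : ℝ, 0 < Δ → ∀ v ∈ feSpace α r Δ, ∫ x, v x ^ 2 ≤ M →
      |∫ x, deriv φ x * v x ^ 3| ≤ (∫ x, deriv φ x * fracD (α / 2) v x ^ 2) + C := by
  set χ : ℝ → ℝ := fun x => √(deriv φ x) with hχ
  have sχ : ContDiff ℝ ∞ χ := hφ.sqrt_smooth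
  have cχ : HasCompactSupport χ := hφ.sqrt_compact
  have hχ2 : ∀ x, χ x ^ 2 = deriv φ x := fun x => Real.sq_sqrt (hφ.deriv_nonneg x)
  have hχ0 : ∀ x, 0 ≤ χ x := fun x => Real.sqrt_nonneg _
  have hχ1 : ∀ x, |χ x| ≤ 1 := fun x => by
    rw [abs_of_nonneg (hχ0 x)]
    exact Real.sqrt_le_one.2 (hφ.deriv_le_one x)
  obtain ⟨C', hC'⟩ := HasCompactSupport.exists_abs_le (sχ.continuous_deriv (by simp)) cχ.deriv
  set c := ∫ ξ : ℝ, (1 + |ξ|) ^ (-(3 / 2) : ℝ) with hc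
  have hc0 : 0 ≤ c := integral_nonneg fun _ => by positivity
  -- The cubic term is at most κ(G + 1), and ‖D^{α/2} f‖² contributes 2Q; the choice ε = 1/(2κ)
  -- makes the final coefficient of Q equal to 1.
  set κ := 1 + c * M with hκ
  have hκ0 : 0 < κ := by positivity
  set ε := (2 * κ)⁻¹ with hε
  have hε0 : 0 < ε := by positivity
  refine ⟨mulConst α χ ^ 2 * M + κ * ((2 * ε + ε⁻¹ ^ 3) * M + 1), by positivity, fun Δ hΔ v hv hvM => ?_⟩
  obtain ⟨F, hF, W⟩ := exists_isFT_of_mem_feSpace hv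
  have iF := W.integrable (by linarith)
  have Fw := IsFT.fourierInv_of_integrable (W.memLp (by linarith)) iF
  have ew := hF.unique_left Fw
  have hd := (fracD_of_weightL2 hα₁ hF W (σ := α / 2) (by linarith) (by linarith)).2
  have hF2 : ∫ ξ, ‖F ξ‖ ^ 2 ≤ M := by rw [integral_norm_sq_eq hF]; exact hvM
  have dv := (l2Deriv_of_mem_feSpace hα₁ hΔ hv).smooth_mul sχ hχ1 hC'
  obtain ⟨j1, j2⟩ := integrable_mul_of_memLp sχ.continuous cχ Fw.memLp_left
  set f : ℝ → ℂ := fun x => (χ x : ℂ) * 𝓕⁻ F x with hf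
  have ef : f =ᵐ[volume] fun x => ((χ x * v x : ℝ) : ℂ) := by
    filter_upwards [ew] with x hx
    simp only [hf]
    rw [← hx]
    push_cast
    rfl
  have Ff0 := IsFT.of_integrable j2 j1
  have Ff := Ff0.congr_left ef
  have W1 : WeightL2 (0 + 1) (𝓕 f) := WeightL2.of_deriv (weightL2_zero.2 Ff.memLp_right)
    (weightL2_zero.2 (dv.isFT Ff).memLp_right)
  rw [zero_add] at W1
  have if' := W1.integrable (by norm_num)
  have e2 := Ff.unique_left (IsFT.fourierInv_of_integrable Ff.memLp_right if')
  have im := W1.integrable_rpow_mul_sq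
  have md := W1.memLp_dsym (σ := α / 2) (by linarith) (by linarith)
  have hX := integral_dsym_mul_fourier_le hα₁ hα₂ W sχ cχ md
  have hQ : ∫ x, ‖(χ x : ℂ) * 𝓕⁻ (fun ξ => dsym (α / 2) ξ * F ξ) x‖ ^ 2 =
      ∫ x, deriv φ x * fracD (α / 2) v x ^ 2 := by
    apply integral_congr_ae
    filter_upwards [hd] with x hx
    rw [← hx, norm_mul, Complex.norm_real, Complex.norm_real, mul_pow, Real.norm_eq_abs,
      Real.norm_eq_abs, sq_abs, sq_abs, hχ2]
  rw [hQ] at hX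
  have hf2 : ∫ ξ, ‖𝓕 f ξ‖ ^ 2 ≤ M := by
    rw [integral_norm_sq_eq Ff]
    refine le_trans ?_ hvM
    apply integral_mono_of_nonneg (ae_of_all _ fun _ => by positivity)
      ((memLp_two_iff_integrable_sq (l2Deriv_of_mem_feSpace hα₁ hΔ hv).memLp.1).1
        (l2Deriv_of_mem_feSpace hα₁ hΔ hv).memLp)
    refine ae_of_all _ fun x => ?_
    simp only [mul_pow, hχ2]
    nlinarith [hφ.deriv_le_one x, sq_nonneg (v x)]
  have hG : ∫ ξ : ℝ, (1 + |ξ|) ^ (3 / 4 : ℝ) * ‖𝓕 f ξ‖ ^ 2 ≤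
      ε * (∫ ξ, ‖dsym (α / 2) ξ * 𝓕 f ξ‖ ^ 2) + (2 * ε + ε⁻¹ ^ 3) * ∫ ξ, ‖𝓕 f ξ‖ ^ 2 := by
    have k1 := (MemLp.integrable_norm_sq md).const_mul ε
    have k2 := (MemLp.integrable_norm_sq Ff.memLp_right).const_mul (2 * ε + ε⁻¹ ^ 3)
    rw [← integral_const_mul, ← integral_const_mul, ← integral_add k1 k2]
    apply integral_mono im (k1.add k2)
    intro ξ
    simp only [Pi.add_apply, norm_mul, mul_pow]
    have := mul_le_mul_of_nonneg_right (weight_le_dsym hα₁ hε0 ξ) (sq_nonneg ‖𝓕 f ξ‖)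
    linarith
  have hI : ((∫ x, deriv φ x * v x ^ 3 : ℝ) : ℂ) =
      ∫ p : ℝ × ℝ, 𝓕 f (p.1 - p.2) * (F p.2 * conj (𝓕 f p.1)) ∂(volume.prod volume) := by
    rw [← integral_mul_fourierInv_mul_conj j1 iF if', ← integral_complex_ofReal]
    apply integral_congr_ae
    filter_upwards [ew, ef, e2] with x h1 h2 h3
    rw [h2, ← h1, ← h3, ← hχ2, Complex.conj_ofReal]
    push_cast
    ring
  have hT := norm_integral_mul_mul_le rfl im im (W.memLp (by linarith) : MemLp F 2 volume)
  rw [← hI, Complex.norm_real, Real.norm_eq_abs, ← hc] at hT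
  set G := ∫ ξ : ℝ, (1 + |ξ|) ^ (3 / 4 : ℝ) * ‖𝓕 f ξ‖ ^ 2 with hGdef
  have hG0 : 0 ≤ G := integral_nonneg fun _ => by positivity
  have hF20 : 0 ≤ ∫ ξ, ‖F ξ‖ ^ 2 := integral_nonneg fun _ => by positivity
  set Q := ∫ x, deriv φ x * fracD (α / 2) v x ^ 2
  set X := ∫ ξ, ‖dsym (α / 2) ξ * 𝓕 f ξ‖ ^ 2
  have s1 : G * G / (G + 1) ≤ G := by
    rw [div_le_iff₀ (by linarith)]; nlinarith
  have s2 : (G + 1) * (c * ∫ ξ, ‖F ξ‖ ^ 2) ≤ (G + 1) * (c * M) := by gcongr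
  have s3 : |∫ x, deriv φ x * v x ^ 3| ≤ κ * (G + 1) := by
    have : 0 ≤ c * M := by positivity
    nlinarith
  have s4 : G ≤ ε * (2 * Q + 2 * (mulConst α χ ^ 2 * M)) + (2 * ε + ε⁻¹ ^ 3) * M := by
    refine hG.trans ?_
    gcongr
    refine hX.trans ?_
    gcongr
  have s5 : κ * (ε * (2 * Q + 2 * (mulConst α χ ^ 2 * M))) = Q + mulConst α χ ^ 2 * M := by
    rw [hε]; field_simp
  have s6 : κ * (G + 1) ≤ κ * (ε * (2 * Q + 2 * (mulConst α χ ^ 2 * M)) + (2 * ε + ε⁻¹ ^ 3) * M + 1) := by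
    gcongr
  linarith

end

end FracKdV

/-! ### L² norms, Lax–Milgram, and the bilinear form at a fixed mesh width. -/

namespace FracKdV

section

/-- The `L²` norm as a real number. -/
noncomputable def l2n (f : ℝ → ℝ) : ℝ := (eLpNorm f 2 volume).toReal

section

variable {f g : ℝ → ℝ}

theorem l2n_nonneg (f : ℝ → ℝ) : 0 ≤ l2n f := ENNReal.toReal_nonneg

theorem l2n_sq (hf : MemLp f 2 volume) : l2n f ^ 2 = ∫ x, f x ^ 2 := toReal_eLpNorm_sq hf

theorem l2n_add_le (hf : MemLp f 2 volume) (hg : MemLp g 2 volume) :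
    l2n (fun x => f x + g x) ≤ l2n f + l2n g := by
  rw [l2n, l2n, l2n, ← ENNReal.toReal_add hf.2.ne hg.2.ne]
  exact ENNReal.toReal_mono (ENNReal.add_ne_top.2 ⟨hf.2.ne, hg.2.ne⟩)
    (eLpNorm_add_le hf.1 hg.1 (by norm_num))

theorem l2n_const_mul (c : ℝ) (f : ℝ → ℝ) : l2n (fun x => c * f x) = |c| * l2n f := by
  have := eLpNorm_const_smul c f 2 (volume : Measure ℝ)
  rw [l2n, l2n]
  change (eLpNorm (c • f) 2 volume).toReal = _
  rw [this, ENNReal.toReal_mul]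
  simp

theorem l2n_sub_le (hf : MemLp f 2 volume) (hg : MemLp g 2 volume) :
    l2n (fun x => f x - g x) ≤ l2n f + l2n g := by
  rw [l2n, l2n, l2n, ← ENNReal.toReal_add hf.2.ne hg.2.ne]
  exact ENNReal.toReal_mono (ENNReal.add_ne_top.2 ⟨hf.2.ne, hg.2.ne⟩)
    (eLpNorm_sub_le hf.1 hg.1 (by norm_num))

theorem l2n_le_mul {C : ℝ} (hC : 0 ≤ C) (hg : MemLp g 2 volume) (h : ∀ x, |f x| ≤ C * |g x|) :
    l2n f ≤ C * l2n g := by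
  have h1 : eLpNorm f 2 volume ≤ ENNReal.ofReal C * eLpNorm g 2 volume :=
    eLpNorm_le_mul_eLpNorm_of_ae_le_mul (ae_of_all _ h) 2
  have := ENNReal.toReal_mono (ENNReal.mul_ne_top ENNReal.ofReal_ne_top hg.2.ne) h1
  rwa [ENNReal.toReal_mul, ENNReal.toReal_ofReal hC] at this

theorem norm_toLp_eq (hf : MemLp f 2 volume) : ‖hf.toLp f‖ = l2n f := Lp.norm_toLp f hf

theorem abs_dot_le (hf : MemLp f 2 volume) (hg : MemLp g 2 volume) :
    |dot f g| ≤ l2n f * l2n g := by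
  have h := abs_real_inner_le_norm (hf.toLp f) (hg.toLp g)
  rw [norm_toLp_eq, norm_toLp_eq] at h
  have e : inner ℝ (hf.toLp f) (hg.toLp g) = dot f g := by
    rw [L2.inner_def, dot]
    apply integral_congr_ae
    filter_upwards [hf.coeFn_toLp, hg.coeFn_toLp] with x h1 h2
    rw [h1, h2]
    simp [mul_comm]
  rwa [e] at h

theorem dot_add_left {f' : ℝ → ℝ} (hf : MemLp f 2 volume) (hf' : MemLp f' 2 volume)
    (hg : MemLp g 2 volume) : dot (fun x => f x + f' x) g = dot f g + dot f' g := by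
  simp only [dot, add_mul]
  exact integral_add (hf.integrable_mul hg) (hf'.integrable_mul hg)

theorem dot_add_right {g' : ℝ → ℝ} (hf : MemLp f 2 volume) (hg : MemLp g 2 volume)
    (hg' : MemLp g' 2 volume) : dot f (fun x => g x + g' x) = dot f g + dot f g' := by
  simp only [dot, mul_add]
  exact integral_add (hf.integrable_mul hg) (hf.integrable_mul hg')

theorem dot_const_mul_left (c : ℝ) (f g : ℝ → ℝ) : dot (fun x => c * f x) g = c * dot f g := by
  simp only [dot, mul_assoc]
  exact integral_const_mul c _

theorem dot_const_mul_right (c : ℝ) (f g : ℝ → ℝ) : dot f (fun x => c * g x) = c * dot f g := by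
  simp only [dot, mul_left_comm _ c]
  exact integral_const_mul c _

theorem dot_congr_left {f' : ℝ → ℝ} (h : f =ᵐ[volume] f') (g : ℝ → ℝ) : dot f g = dot f' g :=
  integral_congr_ae (by filter_upwards [h] with x hx; rw [hx])

end

/-- Lax–Milgram for a vector space that embeds onto a closed subspace of a Hilbert space. -/
theorem exists_lax_milgram {V H : Type*} [AddCommGroup V] [Module ℝ V] [NormedAddCommGroup H]
    [InnerProductSpace ℝ H] [CompleteSpace H] (J : V →ₗ[ℝ] H) (hJ : Function.Injective J)
    (hcl : IsClosed (LinearMap.range J : Set H)) (a : V →ₗ[ℝ] V →ₗ[ℝ] ℝ) {C c : ℝ}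
    (hC : ∀ v w, |a v w| ≤ C * ‖J v‖ * ‖J w‖) (hc : 0 < c) (hcoer : ∀ v, c * ‖J v‖ ^ 2 ≤ a v v)
    (l : V →ₗ[ℝ] ℝ) {C' : ℝ} (hl : ∀ v, |l v| ≤ C' * ‖J v‖) : ∃ e, ∀ v, a e v = l v := by
  let E : V ≃ₗ[ℝ] LinearMap.range J := LinearEquiv.ofInjective J hJ
  have hE : ∀ y : LinearMap.range J, J (E.symm y) = y := fun y => by
    have : (E (E.symm y) : H) = J (E.symm y) := rfl
    rw [← this, LinearEquiv.apply_symm_apply]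
  have : CompleteSpace (LinearMap.range J) := hcl.completeSpace_coe
  let B : LinearMap.range J →L[ℝ] LinearMap.range J →L[ℝ] ℝ :=
    LinearMap.mkContinuous₂ (a.compl₁₂ E.symm.toLinearMap E.symm.toLinearMap) C fun x y => by
      have := hC (E.symm x) (E.symm y)
      rw [hE, hE] at this
      exact this
  have hB : ∀ x y, B x y = a (E.symm x) (E.symm y) := fun x y => rfl
  have hco : IsCoercive B := ⟨c, hc, fun x => by
    have := hcoer (E.symm x)
    rw [hE] at this
    rw [hB, mul_assoc, ← sq]
    exact this⟩
  let l' : LinearMap.range J →L[ℝ] ℝ := LinearMap.mkContinuous (l ∘ₗ E.symm.toLinearMap) C' fun x => by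
    have := hl (E.symm x)
    rw [hE] at this
    exact this
  let z := (InnerProductSpace.toDual ℝ (LinearMap.range J)).symm l'
  refine ⟨E.symm (hco.continuousLinearEquivOfBilin.symm z), fun v => ?_⟩
  have h1 := hco.continuousLinearEquivOfBilin_apply (hco.continuousLinearEquivOfBilin.symm z) (E v)
  rw [ContinuousLinearEquiv.apply_symm_apply, InnerProductSpace.toDual_symm_apply, hB,
    LinearEquiv.symm_apply_apply] at h1
  rw [← h1]
  change l (E.symm (E v)) = l v
  rw [LinearEquiv.symm_apply_apply]

section

variable {α Δ R : ℝ} {r : ℕ} {φ : ℝ → ℝ} {v w : ℝ → ℝ}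

/-- The finite element space as a vector space. -/
def feSubmodule (r : ℕ) (hα₁ : 1 ≤ α) (hα₂ : α < 2) (hΔ : 0 < Δ) : Submodule ℝ (ℝ → ℝ) where
  carrier := feSpace α r Δ
  add_mem' hv hw := by
    obtain ⟨P, hP⟩ := exists_feRep hα₁ hΔ hv
    obtain ⟨Q, hQ⟩ := exists_feRep hα₁ hΔ hw
    exact (hP.add hQ).mem_feSpace hα₁ hα₂ hΔ
  smul_mem' c v hv := by
    obtain ⟨P, hP⟩ := exists_feRep hα₁ hΔ hv
    exact (hP.smul c).mem_feSpace hα₁ hα₂ hΔ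
  zero_mem' := by
    have : FERep α r Δ (0 : ℝ → ℝ) (fun _ => 0) :=
      ⟨by simp, by ext x; simp [pp], MemLp.zero, by intro j; simp, by intro j; simp, by intro _ j; simp⟩
    exact this.mem_feSpace hα₁ hα₂ hΔ

theorem memLp_of_mem_feSpace (hα₁ : 1 ≤ α) (hΔ : 0 < Δ) (hv : v ∈ feSpace α r Δ) : MemLp v 2 volume :=
  (l2Deriv_of_mem_feSpace hα₁ hΔ hv).memLp

theorem memLp_cutoff_mul (hφ : IsCutoff R φ) (hv : MemLp v 2 volume) :
    MemLp (fun x => φ x * v x) 2 volume :=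
  MemLp.bdd_mul_continuous hφ.smooth.continuous hφ.abs_le hv

theorem memLp_fracD (hα₁ : 1 ≤ α) {σ : ℝ} (hσ : 0 ≤ σ) (hσα : σ ≤ α) (hv : v ∈ feSpace α r Δ) :
    MemLp (fracD σ v) 2 volume := by
  obtain ⟨F, hF, W⟩ := exists_isFT_of_mem_feSpace hv
  simpa using (fracD_of_weightL2 hα₁ hF W hσ hσα).1.memLp_left.re

/-- The bilinear form `⟨D^α w, (φ v)ₓ⟩`. -/
noncomputable def bform (α : ℝ) (φ w v : ℝ → ℝ) : ℝ := dot (fracD α w) (deriv fun x => φ x * v x)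

theorem dot_fracD_eq_bform (hφ : IsCutoff R φ) (hα₁ : 1 ≤ α) (hα₂ : α ≤ 2) (hΔ : 0 < Δ)
    (hw : w ∈ feSpace α r Δ) (hv : v ∈ feSpace α r Δ) :
    dot (fracD (α / 2) w) (fracD (α / 2) (deriv fun x => φ x * v x)) = bform α φ w v := by
  obtain ⟨F, hF, W⟩ := exists_isFT_of_mem_feSpace hw
  obtain ⟨g, hg⟩ := exists_l2Deriv_deriv_cutoff_mul hφ hα₁ hΔ hv
  exact dot_fracD hα₁ hα₂ hF W hg

theorem fracD_add (hα₁ : 1 ≤ α) (hα₂ : α < 2) (hΔ : 0 < Δ) (hv : v ∈ feSpace α r Δ)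
    (hw : w ∈ feSpace α r Δ) :
    fracD α (v + w) =ᵐ[volume] fun x => fracD α v x + fracD α w x := by
  obtain ⟨F, hF, W⟩ := exists_isFT_of_mem_feSpace hv
  obtain ⟨G, hG, W'⟩ := exists_isFT_of_mem_feSpace hw
  obtain ⟨K, hK, W''⟩ := exists_isFT_of_mem_feSpace ((feSubmodule r hα₁ hα₂ hΔ).add_mem hv hw)
  have h1 := (fracD_of_weightL2 hα₁ hF W (σ := α) (by linarith) le_rfl).1
  have h2 := (fracD_of_weightL2 hα₁ hG W' (σ := α) (by linarith) le_rfl).1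
  have h3 := (fracD_of_weightL2 hα₁ hK W'' (σ := α) (by linarith) le_rfl).1
  have hFG := hF.add hG
  have e : K =ᵐ[volume] fun ξ => F ξ + G ξ := by
    apply hK.unique_right
    refine hFG.congr_left (ae_of_all _ fun x => ?_)
    simp
  have e' : (fun ξ => dsym α ξ * F ξ + dsym α ξ * G ξ) =ᵐ[volume] fun ξ => dsym α ξ * K ξ := by
    filter_upwards [e] with ξ h
    rw [h]
    ring
  filter_upwards [h3.unique_left ((h1.add h2).congr_right e')] with x hx
  exact_mod_cast hx

theorem fracD_smul (hα₁ : 1 ≤ α) (hα₂ : α < 2) (hΔ : 0 < Δ) (c : ℝ) (hv : v ∈ feSpace α r Δ) :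
    fracD α (c • v) =ᵐ[volume] fun x => c * fracD α v x := by
  obtain ⟨F, hF, W⟩ := exists_isFT_of_mem_feSpace hv
  obtain ⟨K, hK, W''⟩ := exists_isFT_of_mem_feSpace ((feSubmodule r hα₁ hα₂ hΔ).smul_mem c hv)
  have h1 := (fracD_of_weightL2 hα₁ hF W (σ := α) (by linarith) le_rfl).1
  have h3 := (fracD_of_weightL2 hα₁ hK W'' (σ := α) (by linarith) le_rfl).1
  have e : K =ᵐ[volume] fun ξ => c * F ξ := by
    apply hK.unique_right
    refine (hF.const_mul c).congr_left (ae_of_all _ fun x => ?_)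
    simp
  have e' : (fun ξ => c * (dsym α ξ * F ξ)) =ᵐ[volume] fun ξ => dsym α ξ * K ξ := by
    filter_upwards [e] with ξ h
    rw [h]
    ring
  filter_upwards [h3.unique_left ((h1.const_mul c).congr_right e')] with x hx
  exact_mod_cast hx

theorem deriv_cutoff_mul_add (hφ : IsCutoff R φ) (hα₁ : 1 ≤ α) (hα₂ : α < 2) (hΔ : 0 < Δ)
    (hv : v ∈ feSpace α r Δ) (hw : w ∈ feSpace α r Δ) :
    (deriv fun x => φ x * (v + w) x) = fun x => deriv (fun x => φ x * v x) x +
      deriv (fun x => φ x * w x) x := by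
  rw [deriv_cutoff_mul hφ hα₁ hΔ ((feSubmodule r hα₁ hα₂ hΔ).add_mem hv hw),
    deriv_cutoff_mul hφ hα₁ hΔ hv, deriv_cutoff_mul hφ hα₁ hΔ hw]
  ext x
  rw [deriv_add (hasDerivAt_of_mem_feSpace hα₁ hΔ hv x).differentiableAt
    (hasDerivAt_of_mem_feSpace hα₁ hΔ hw x).differentiableAt]
  simp only [Pi.add_apply]
  ring

theorem deriv_cutoff_mul_smul (c : ℝ) :
    (deriv fun x => φ x * (c • v) x) = fun x => c * deriv (fun x => φ x * v x) x := by
  ext x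
  rw [← deriv_const_mul_field]
  congr 1
  ext y
  simp only [Pi.smul_apply, smul_eq_mul]
  ring

theorem memLp_deriv_cutoff_mul (hφ : IsCutoff R φ) (hα₁ : 1 ≤ α) (hΔ : 0 < Δ)
    (hv : v ∈ feSpace α r Δ) : MemLp (deriv fun x => φ x * v x) 2 volume :=
  (l2Deriv_cutoff_mul hφ hα₁ hΔ hv).memLp_deriv

/-- Inverse estimates, with constants that depend on the mesh width. -/
theorem exists_inverse_bounds (hα₁ : 1 ≤ α) (hα₂ : α ≤ 2) (hΔ : 0 < Δ) (r : ℕ) :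
    ∃ C, 0 ≤ C ∧ ∀ v ∈ feSpace α r Δ, l2n (deriv v) ≤ C * l2n v ∧ l2n (fracD α v) ≤ C * l2n v := by
  obtain ⟨C, hC⟩ := exists_cell_bound r
  have hC0 := hC.1
  set b := √(C / Δ ^ 2) with hb
  have hb2 : b ^ 2 = C / Δ ^ 2 := Real.sq_sqrt (by positivity)
  have hb0 : 0 ≤ b := Real.sqrt_nonneg _
  have step : ∀ P : ℤ → Polynomial ℝ, (∀ j, (P j).natDegree ≤ r) → MemLp (pp Δ P) 2 volume →
      l2n (pp Δ fun j => Polynomial.derivative (P j)) ≤ b * l2n (pp Δ P) := by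
    intro P hP hm
    have hm' := memLp_pp_derivative hΔ hP hm
    have := sqInt_pp_derivative_le hC hΔ hP
    rw [sqInt_eq_ofReal hm, sqInt_eq_ofReal hm', ← ENNReal.ofReal_mul (by positivity),
      ENNReal.ofReal_le_ofReal_iff (by have := integral_nonneg (μ := volume) (f := fun x => pp Δ P x ^ 2) (fun x => sq_nonneg _); positivity),
      ← l2n_sq hm, ← l2n_sq hm', ← hb2, ← mul_pow] at this
    exact le_of_sq_le_sq this (mul_nonneg hb0 (l2n_nonneg _))
  refine ⟨2 + 2 * b ^ 2 + b, by positivity, fun v hv => ?_⟩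
  obtain ⟨P, hP⟩ := exists_feRep hα₁ hΔ hv
  have s1 := step P hP.degree (hP.eq ▸ hP.memLp)
  have s2 := step _ (fun j => natDegree_derivative_le_of_le (hP.degree j)) (hP.l2Deriv hΔ).memLp_deriv
  rw [← hP.eq] at s1
  have hn := l2n_nonneg v
  constructor
  · rw [hP.deriv_eq hΔ]
    refine s1.trans ?_
    gcongr
    nlinarith
  · obtain ⟨F, hF, W⟩ := exists_isFT_of_mem_feSpace hv
    have h1 := (fracD_of_weightL2 hα₁ hF W (σ := α) (by linarith) le_rfl).1
    have F2 := (hP.l2Deriv' hΔ).isFT ((hP.l2Deriv hΔ).isFT hF)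
    have hm : MemLp (fracD α v) 2 volume := memLp_fracD hα₁ (by linarith) le_rfl hv
    have key : ∫ ξ, ‖dsym α ξ * F ξ‖ ^ 2 ≤ 2 * (∫ ξ, ‖F ξ‖ ^ 2) +
        2 * ∫ ξ : ℝ, ‖2 * Real.pi * Complex.I * ξ * (2 * Real.pi * Complex.I * ξ * F ξ)‖ ^ 2 := by
      have k1 := (MemLp.integrable_norm_sq hF.memLp_right).const_mul 2
      have k2 := (MemLp.integrable_norm_sq F2.memLp_right).const_mul 2
      rw [← integral_const_mul, ← integral_const_mul, ← integral_add k1 k2]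
      apply integral_mono (MemLp.integrable_norm_sq h1.memLp_right) (k1.add k2)
      intro ξ
      simp only [Pi.add_apply, norm_mul, Complex.norm_I, Complex.norm_real, Real.norm_eq_abs,
        abs_of_pos Real.pi_pos, Complex.norm_ofNat, mul_one, dsym]
      have hp : 0 ≤ 2 * Real.pi * |ξ| := by positivity
      set s := 2 * Real.pi * |ξ| with hs
      -- Since α ≤ 2, D^α is controlled by v and vₓₓ, and the second derivative by two inverse
      -- inequalities on the cells.
      have hle : s ^ α ≤ 1 + s ^ 2 := by
        rcases le_total s 1 with h | h
        · have := Real.rpow_le_one hp h (by linarith : 0 ≤ α)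
          nlinarith
        · have := Real.rpow_le_rpow_of_exponent_le h hα₂
          rw [Real.rpow_two] at this
          linarith
      have h0 : 0 ≤ s ^ α := by positivity
      rw [abs_of_nonneg h0, mul_pow]
      have h2 : (s ^ α) ^ 2 ≤ 2 + 2 * (s ^ 2) ^ 2 := by
        nlinarith [sq_nonneg (1 - s ^ 2)]
      have h3 := mul_le_mul_of_nonneg_right h2 (sq_nonneg ‖F ξ‖)
      linarith
    rw [integral_norm_sq_eq h1, integral_norm_sq_eq hF, integral_norm_sq_eq F2, ← l2n_sq hm,
      ← l2n_sq hP.memLp, ← l2n_sq (hP.l2Deriv' hΔ).memLp_deriv] at key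
    have s3 := s2.trans (mul_le_mul_of_nonneg_left s1 hb0)
    have s4 := pow_le_pow_left₀ (l2n_nonneg _) s3 2
    apply le_of_sq_le_sq _ (by positivity)
    nlinarith [sq_nonneg (l2n v), sq_nonneg b, mul_nonneg (sq_nonneg b) (sq_nonneg (l2n v)), mul_nonneg hb0 (sq_nonneg (l2n v)), mul_nonneg (pow_nonneg hb0 3) (sq_nonneg (l2n v)), mul_nonneg (pow_nonneg hb0 4) (sq_nonneg (l2n v))]

theorem l2n_deriv_cutoff_mul_le (hφ : IsCutoff R φ) (hR : 0 < R) (hα₁ : 1 ≤ α) (hΔ : 0 < Δ)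
    (hv : v ∈ feSpace α r Δ) :
    l2n (deriv fun x => φ x * v x) ≤ l2n v + (2 + 2 * R) * l2n (deriv v) := by
  have d := l2Deriv_of_mem_feSpace hα₁ hΔ hv
  rw [deriv_cutoff_mul hφ hα₁ hΔ hv]
  refine (l2n_add_le (MemLp.bdd_mul_continuous (hφ.smooth.continuous_deriv (by simp)) hφ.abs_deriv_le d.memLp)
    (MemLp.bdd_mul_continuous hφ.smooth.continuous hφ.abs_le d.memLp_deriv)).trans ?_
  gcongr
  · have := l2n_le_mul (f := fun x => deriv φ x * v x) zero_le_one d.memLp (fun x => by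
      rw [abs_mul]
      exact mul_le_mul_of_nonneg_right (hφ.abs_deriv_le x) (abs_nonneg _))
    rwa [one_mul] at this
  · exact l2n_le_mul (by linarith) d.memLp_deriv (fun x => by
      rw [abs_mul]
      exact mul_le_mul_of_nonneg_right (hφ.abs_le x) (abs_nonneg _))

/-- The constant may blow up with the mesh. It is only used qualitatively, for the continuity of the
form in Lax–Milgram and for passing to the limit in the iteration. -/
theorem exists_bform_bound (hφ : IsCutoff R φ) (hR : 0 < R) (hα₁ : 1 ≤ α) (hα₂ : α ≤ 2) (hΔ : 0 < Δ)
    (r : ℕ) : ∃ C, 0 ≤ C ∧ ∀ v ∈ feSpace α r Δ, l2n (deriv fun x => φ x * v x) ≤ C * l2n v ∧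
      ∀ w ∈ feSpace α r Δ, |bform α φ w v| ≤ C * l2n w * l2n v := by
  obtain ⟨C, hC0, hC⟩ := exists_inverse_bounds hα₁ hα₂ hΔ r
  set D := 1 + (2 + 2 * R) * C with hD
  have hD0 : 0 ≤ D := by positivity
  refine ⟨D + C * D, by positivity, fun v hv => ?_⟩
  have h1 : l2n (deriv fun x => φ x * v x) ≤ D * l2n v := by
    refine (l2n_deriv_cutoff_mul_le hφ hR hα₁ hΔ hv).trans ?_
    have := mul_le_mul_of_nonneg_left (hC v hv).1 (by linarith : 0 ≤ 2 + 2 * R)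
    rw [hD]
    linarith
  have hv0 := l2n_nonneg v
  refine ⟨h1.trans (by gcongr; nlinarith), fun w hw => ?_⟩
  have hw0 := l2n_nonneg w
  refine (abs_dot_le (memLp_fracD hα₁ (by linarith) le_rfl hw) (memLp_deriv_cutoff_mul hφ hα₁ hΔ hv)).trans ?_
  calc _ ≤ (C * l2n w) * (D * l2n v) := by
        gcongr
        · exact l2n_nonneg _
        · exact (hC w hw).2
    _ = C * D * l2n w * l2n v := by ring
    _ ≤ _ := by gcongr; linarith

end

end

end FracKdV

/-! ### Projection onto the finite element space; linearity of the form; sup bounds. -/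

namespace FracKdV

section

section

variable {α Δ : ℝ} {r : ℕ}

/-- The embedding of the finite element space into `L²`. -/
noncomputable def feEmbedding (r : ℕ) (hα₁ : 1 ≤ α) (hα₂ : α < 2) (hΔ : 0 < Δ) :
    feSubmodule r hα₁ hα₂ hΔ →ₗ[ℝ] Lp ℝ 2 (volume : Measure ℝ) where
  toFun v := (memLp_of_mem_feSpace hα₁ hΔ v.2).toLp v
  map_add' _ _ := rfl
  map_smul' _ _ := rfl

theorem norm_feEmbedding (hα₁ : 1 ≤ α) (hα₂ : α < 2) (hΔ : 0 < Δ) (v : feSubmodule r hα₁ hα₂ hΔ) :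
    ‖feEmbedding r hα₁ hα₂ hΔ v‖ = l2n v :=
  norm_toLp_eq (memLp_of_mem_feSpace hα₁ hΔ v.2)

/-- Finite element functions are continuous, so equality almost everywhere is equality. -/
theorem feEmbedding_injective (hα₁ : 1 ≤ α) (hα₂ : α < 2) (hΔ : 0 < Δ) :
    Function.Injective (feEmbedding r hα₁ hα₂ hΔ) := by
  intro v w h
  have h1 := (MemLp.toLp_eq_toLp_iff (memLp_of_mem_feSpace hα₁ hΔ v.2)
    (memLp_of_mem_feSpace hα₁ hΔ w.2)).1 h
  exact Subtype.ext ((Continuous.ae_eq_iff_eq volume (l2Deriv_of_mem_feSpace hα₁ hΔ v.2).cont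
    (l2Deriv_of_mem_feSpace hα₁ hΔ w.2).cont).1 h1)

theorem isClosed_range_feEmbedding (hα₁ : 1 ≤ α) (hα₂ : α < 2) (hΔ : 0 < Δ) :
    IsClosed (LinearMap.range (feEmbedding r hα₁ hα₂ hΔ) : Set (Lp ℝ 2 (volume : Measure ℝ))) := by
  apply IsSeqClosed.isClosed
  intro y f hy hf
  choose v hv using hy
  have hlim : Tendsto (fun n => eLpNorm ((v n : ℝ → ℝ) - (f : ℝ → ℝ)) 2 volume) atTop (𝓝 0) := by
    have := (Lp.tendsto_Lp_iff_tendsto_eLpNorm' _ _).1 hf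
    refine this.congr fun n => ?_
    apply eLpNorm_congr_ae
    rw [← hv n]
    exact (memLp_of_mem_feSpace hα₁ hΔ (v n).2).coeFn_toLp.sub ae_eq_rfl
  obtain ⟨w, hw, hwf⟩ := exists_mem_feSpace_of_tendsto hα₁ hα₂ hΔ (fun n => (v n).2) (Lp.memLp f) hlim
  refine ⟨⟨w, hw⟩, ?_⟩
  exact Lp.ext ((memLp_of_mem_feSpace hα₁ hΔ hw).coeFn_toLp.trans hwf)

theorem exists_form_solution (hα₁ : 1 ≤ α) (hα₂ : α < 2) (hΔ : 0 < Δ)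
    (a : feSubmodule r hα₁ hα₂ hΔ →ₗ[ℝ] feSubmodule r hα₁ hα₂ hΔ →ₗ[ℝ] ℝ) {C c : ℝ}
    (hC : ∀ v w : feSubmodule r hα₁ hα₂ hΔ, |a v w| ≤ C * l2n v * l2n w) (hc : 0 < c) (hcoer : ∀ v : feSubmodule r hα₁ hα₂ hΔ, c * l2n v ^ 2 ≤ a v v)
    (l : feSubmodule r hα₁ hα₂ hΔ →ₗ[ℝ] ℝ) {C' : ℝ} (hl : ∀ v : feSubmodule r hα₁ hα₂ hΔ, |l v| ≤ C' * l2n v) :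
    ∃ e, ∀ v, a e v = l v := by
  apply exists_lax_milgram (feEmbedding r hα₁ hα₂ hΔ) (feEmbedding_injective hα₁ hα₂ hΔ)
    (isClosed_range_feEmbedding hα₁ hα₂ hΔ) a (C := C) (c := c) (C' := C') _ hc _ l _
  · intro v w
    rw [norm_feEmbedding, norm_feEmbedding]
    exact hC v w
  · intro v
    rw [norm_feEmbedding]
    exact hcoer v
  · intro v
    rw [norm_feEmbedding]
    exact hl v

theorem dot_self {f : ℝ → ℝ} (hf : MemLp f 2 volume) : dot f f = l2n f ^ 2 := by
  rw [l2n_sq hf, dot]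
  congr 1
  ext x
  ring

theorem exists_isL2Projection (hα₁ : 1 ≤ α) (hα₂ : α < 2) (hΔ : 0 < Δ) (r : ℕ) {u₀ : ℝ → ℝ}
    (hu : MemLp u₀ 2 volume) : ∃ u, IsL2Projection α r Δ u₀ u := by
  have hm : ∀ v : feSubmodule r hα₁ hα₂ hΔ, MemLp (v : ℝ → ℝ) 2 volume := fun v =>
    memLp_of_mem_feSpace hα₁ hΔ v.2
  let a : feSubmodule r hα₁ hα₂ hΔ →ₗ[ℝ] feSubmodule r hα₁ hα₂ hΔ →ₗ[ℝ] ℝ :=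
    LinearMap.mk₂ ℝ (fun v w : feSubmodule r hα₁ hα₂ hΔ => dot v w) (fun v v' w => dot_add_left (hm v) (hm v') (hm w))
      (fun c v w => dot_const_mul_left c v w) (fun v w w' => dot_add_right (hm v) (hm w) (hm w'))
      (fun c v w => dot_const_mul_right c v w)
  let l : feSubmodule r hα₁ hα₂ hΔ →ₗ[ℝ] ℝ :=
    { toFun := fun v : feSubmodule r hα₁ hα₂ hΔ => dot u₀ v
      map_add' := fun v w => dot_add_right hu (hm v) (hm w)
      map_smul' := fun c v => dot_const_mul_right c u₀ v }
  obtain ⟨e, he⟩ := exists_form_solution hα₁ hα₂ hΔ a (C := 1) (c := 1) (C' := l2n u₀)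
    (fun v w => by rw [one_mul]; exact abs_dot_le (hm v) (hm w)) one_pos
    (fun v => by rw [one_mul]; exact (dot_self (hm v)).ge) l (fun v => abs_dot_le hu (hm v))
  exact ⟨e, e.2, fun v hv => he ⟨v, hv⟩⟩

theorem l2n_le_of_isL2Projection (hα₁ : 1 ≤ α) (hΔ : 0 < Δ) {u₀ u : ℝ → ℝ} (hu : MemLp u₀ 2 volume)
    (h : IsL2Projection α r Δ u₀ u) : l2n u ≤ l2n u₀ := by
  have hm := memLp_of_mem_feSpace hα₁ hΔ h.1
  have h1 := h.2 u h.1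
  rw [dot_self hm] at h1
  have h2 := (le_abs_self _).trans (abs_dot_le hu hm)
  rw [← h1] at h2
  have h3 := l2n_nonneg u
  have h4 := l2n_nonneg u₀
  nlinarith

end

section

variable {α Δ R : ℝ} {r : ℕ} {φ : ℝ → ℝ} {u v w w' : ℝ → ℝ}

theorem bform_add_left (hφ : IsCutoff R φ) (hα₁ : 1 ≤ α) (hα₂ : α < 2) (hΔ : 0 < Δ)
    (hw : w ∈ feSpace α r Δ) (hw' : w' ∈ feSpace α r Δ) (hv : v ∈ feSpace α r Δ) :
    bform α φ (w + w') v = bform α φ w v + bform α φ w' v := by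
  rw [bform, dot_congr_left (fracD_add hα₁ hα₂ hΔ hw hw'), dot_add_left
    (memLp_fracD hα₁ (by linarith) le_rfl hw) (memLp_fracD hα₁ (by linarith) le_rfl hw')
    (memLp_deriv_cutoff_mul hφ hα₁ hΔ hv)]
  rfl

theorem bform_smul_left (hα₁ : 1 ≤ α) (hα₂ : α < 2) (hΔ : 0 < Δ) (c : ℝ)
    (hw : w ∈ feSpace α r Δ) (v : ℝ → ℝ) : bform α φ (c • w) v = c * bform α φ w v := by
  rw [bform, dot_congr_left (fracD_smul hα₁ hα₂ hΔ c hw), dot_const_mul_left]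
  rfl

theorem bform_add_right (hφ : IsCutoff R φ) (hα₁ : 1 ≤ α) (hα₂ : α < 2) (hΔ : 0 < Δ)
    (hw : w ∈ feSpace α r Δ) (hv : v ∈ feSpace α r Δ) (hw' : w' ∈ feSpace α r Δ) :
    bform α φ w (v + w') = bform α φ w v + bform α φ w w' := by
  rw [bform, deriv_cutoff_mul_add hφ hα₁ hα₂ hΔ hv hw', dot_add_right
    (memLp_fracD hα₁ (by linarith) le_rfl hw) (memLp_deriv_cutoff_mul hφ hα₁ hΔ hv)
    (memLp_deriv_cutoff_mul hφ hα₁ hΔ hw')]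
  rfl

theorem bform_smul_right (c : ℝ) (w v : ℝ → ℝ) : bform α φ w (c • v) = c * bform α φ w v := by
  rw [bform, deriv_cutoff_mul_smul, dot_const_mul_right]
  rfl

/-- On [x, x+1] the function stays above |v x| - B in modulus, and the interval has length 1, so the
L² norm is at least that large. -/
theorem abs_le_l2n_add {g : ℝ → ℝ} {B : ℝ} (h : L2Deriv v g) (hB : ∀ x, |g x| ≤ B) (x : ℝ) :
    |v x| ≤ l2n v + B := by
  by_contra! hlt
  have hB0 : 0 ≤ B := (abs_nonneg _).trans (hB x)
  have h0 := l2n_nonneg v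
  set c := |v x| - B with hc
  have hv2 : Integrable fun y => v y ^ 2 := (memLp_two_iff_integrable_sq h.memLp.1).1 h.memLp
  have h1 : ∀ y ∈ Icc x (x + 1), c ^ 2 ≤ v y ^ 2 := by
    intro y hy
    have e := h.ftc x y
    have b := intervalIntegral.norm_integral_le_of_norm_le_const (f := g) (a := x) (b := y) (C := B)
      (fun t _ => hB t)
    rw [e, Real.norm_eq_abs] at b
    have : B * |y - x| ≤ B := by
      rw [abs_of_nonneg (by linarith [hy.1])]
      nlinarith [hy.2]
    have h2 := abs_sub_abs_le_abs_sub (v x) (v y)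
    rw [abs_sub_comm] at h2
    rw [← sq_abs (v y)]
    exact pow_le_pow_left₀ (by linarith) (by linarith) 2
  have h2 : c ^ 2 ≤ ∫ y in Icc x (x + 1), v y ^ 2 := by
    have := setIntegral_mono_on (f := fun _ => c ^ 2) (by simp) hv2.integrableOn measurableSet_Icc h1
    simpa using this
  have h3 := setIntegral_le_integral hv2 (s := Icc x (x + 1)) (ae_of_all _ fun y => sq_nonneg _)
  rw [← l2n_sq h.memLp] at h3
  have : c ≤ l2n v := le_of_sq_le_sq (h2.trans h3) h0
  linarith

/-- The inverse inequality bounds vₓ, and then v by the preceding lemma. After multiplication by the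
time step the first summand is small with T, and the second is exactly the CFL quantity. -/
theorem abs_deriv_cutoff_mul_le (hφ : IsCutoff R φ) (hR : 0 < R) (hα₁ : 1 ≤ α) (hΔ : 0 < Δ)
    (hv : v ∈ feSpace α r Δ) {C₂ : ℝ} (hC : IsInverseConstant α r C₂) (x : ℝ) :
    |deriv (fun x => φ x * v x) x| ≤ (1 + (3 + 2 * R) * (√C₂ / Δ ^ (3 / 2 : ℝ))) * l2n v := by
  have hd : ∀ x, |deriv v x| ≤ √C₂ / Δ ^ (3 / 2 : ℝ) * l2n v := hC.2 Δ hΔ v hv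
  have hs := abs_le_l2n_add (l2Deriv_of_mem_feSpace hα₁ hΔ hv) hd x
  rw [deriv_cutoff_mul hφ hα₁ hΔ hv]
  refine (abs_add_le _ _).trans ?_
  rw [abs_mul, abs_mul]
  have h1 : |deriv φ x| * |v x| ≤ 1 * (l2n v + √C₂ / Δ ^ (3 / 2 : ℝ) * l2n v) := by
    gcongr
    exact hφ.abs_deriv_le x
  have h2 : |φ x| * |deriv v x| ≤ (2 + 2 * R) * (√C₂ / Δ ^ (3 / 2 : ℝ) * l2n v) := by
    gcongr
    · exact hφ.abs_le x
    · exact hd x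
  linarith

end

end

end FracKdV

/-! ### One time step: a priori bound, contraction, and linear solvability. -/

namespace FracKdV

section

/-- The standing assumptions under which one time step of length `τ` is studied. -/
structure StepHyp (α : ℝ) (r : ℕ) (R : ℝ) (φ : ℝ → ℝ) (Δ τ ε : ℝ) : Prop where
  cutoff : IsCutoff R φ
  R_pos : 0 < R
  one_le : 1 ≤ α
  lt_two : α < 2
  mesh_pos : 0 < Δ
  step_pos : 0 < τ
  eps_nonneg : 0 ≤ ε
  sup_le : ∀ v ∈ feSpace α r Δ, ∀ x, τ * |deriv (fun x => φ x * v x) x| ≤ ε * l2n v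
  small : τ * IsCutoff.commConst α φ ≤ 1 / 4

/-- The left-hand side of the linearised scheme. -/
noncomputable def stepForm (α : ℝ) (φ : ℝ → ℝ) (τ : ℝ) (u w w' v : ℝ → ℝ) : ℝ :=
  dot w' (fun x => φ x * v x)
    - τ / 2 * dot (fun x => ((w x + u x) / 2) ^ 2) (deriv fun x => φ x * v x)
    + τ * bform α φ (fun x => (w' x + u x) / 2) v

namespace StepHyp

variable {α R Δ τ ε : ℝ} {r : ℕ} {φ : ℝ → ℝ} {u v w w' : ℝ → ℝ}

theorem add_mem (h : StepHyp α r R φ Δ τ ε) (hv : v ∈ feSpace α r Δ) (hw : w ∈ feSpace α r Δ) :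
    v + w ∈ feSpace α r Δ := (feSubmodule r h.one_le h.lt_two h.mesh_pos).add_mem hv hw

theorem sub_mem (h : StepHyp α r R φ Δ τ ε) (hv : v ∈ feSpace α r Δ) (hw : w ∈ feSpace α r Δ) :
    v - w ∈ feSpace α r Δ := (feSubmodule r h.one_le h.lt_two h.mesh_pos).sub_mem hv hw

theorem smul_mem (h : StepHyp α r R φ Δ τ ε) (c : ℝ) (hv : v ∈ feSpace α r Δ) :
    c • v ∈ feSpace α r Δ := (feSubmodule r h.one_le h.lt_two h.mesh_pos).smul_mem c hv

theorem mid_eq (w u : ℝ → ℝ) : (fun x => (w x + u x) / 2) = (1 / 2 : ℝ) • (w + u) := by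
  ext x
  simp only [Pi.smul_apply, Pi.add_apply, smul_eq_mul]
  ring

theorem mid_mem (h : StepHyp α r R φ Δ τ ε) (hw : w ∈ feSpace α r Δ) (hu : u ∈ feSpace α r Δ) :
    (fun x => (w x + u x) / 2) ∈ feSpace α r Δ := by
  rw [mid_eq]
  exact h.smul_mem _ (h.add_mem hw hu)

theorem memLp (h : StepHyp α r R φ Δ τ ε) (hv : v ∈ feSpace α r Δ) : MemLp v 2 volume :=
  memLp_of_mem_feSpace h.one_le h.mesh_pos hv

theorem bform_mid (h : StepHyp α r R φ Δ τ ε) (hw : w ∈ feSpace α r Δ) (hu : u ∈ feSpace α r Δ)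
    (hv : v ∈ feSpace α r Δ) :
    bform α φ (fun x => (w x + u x) / 2) v = (bform α φ w v + bform α φ u v) / 2 := by
  rw [mid_eq, bform_smul_left h.one_le h.lt_two h.mesh_pos _ (h.add_mem hw hu),
    bform_add_left h.cutoff h.one_le h.lt_two h.mesh_pos hw hu hv]
  ring

theorem bform_sub (h : StepHyp α r R φ Δ τ ε) (hw : w ∈ feSpace α r Δ) (hu : u ∈ feSpace α r Δ)
    (hv : v ∈ feSpace α r Δ) : bform α φ (w - u) v = bform α φ w v - bform α φ u v := by
  have := bform_add_left h.cutoff h.one_le h.lt_two h.mesh_pos (h.sub_mem hw hu) hu hv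
  rw [sub_add_cancel] at this
  linarith

theorem l2n_mid_le (hw : MemLp w 2 volume) (hu : MemLp u 2 volume) :
    l2n (fun x => (w x + u x) / 2) ≤ (l2n w + l2n u) / 2 := by
  have e : (fun x => (w x + u x) / 2) = fun x => (1 / 2 : ℝ) * (w x + u x) := by ext x; ring
  rw [e, l2n_const_mul, abs_of_pos (by norm_num)]
  linarith [l2n_add_le hw hu]

theorem l2n_sq_le_dot (hφ : IsCutoff R φ) (hv : MemLp v 2 volume) :
    l2n v ^ 2 ≤ dot v (fun x => φ x * v x) := by
  rw [l2n_sq hv, dot]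
  apply integral_mono ((memLp_two_iff_integrable_sq hv.1).1 hv) (hv.integrable_mul (memLp_cutoff_mul hφ hv))
  intro x
  simp only [Pi.mul_apply]
  nlinarith [hφ.one_le x, sq_nonneg (v x)]

theorem dot_le_l2n_sq (hφ : IsCutoff R φ) (hv : MemLp v 2 volume) :
    dot v (fun x => φ x * v x) ≤ (2 + 2 * R) * l2n v ^ 2 := by
  rw [l2n_sq hv, dot, ← integral_const_mul]
  apply integral_mono (hv.integrable_mul (memLp_cutoff_mul hφ hv))
    (((memLp_two_iff_integrable_sq hv.1).1 hv).const_mul _)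
  intro x
  simp only [Pi.mul_apply]
  nlinarith [hφ.le x, sq_nonneg (v x)]

theorem le_bform_self (h : StepHyp α r R φ Δ τ ε) (hv : v ∈ feSpace α r Δ) :
    (1 + α) / 2 * (∫ x, deriv φ x * fracD (α / 2) v x ^ 2) - IsCutoff.commConst α φ / 2 * l2n v ^ 2 ≤
      bform α φ v v := by
  rw [← dot_fracD_eq_bform h.cutoff h.one_le h.lt_two.le h.mesh_pos hv hv, l2n_sq (h.memLp hv)]
  exact le_dot_fracD h.R_pos h.cutoff h.one_le h.lt_two.le h.mesh_pos hv

theorem integral_deriv_mul_nonneg (hφ : IsCutoff R φ) (f : ℝ → ℝ) :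
    0 ≤ ∫ x, deriv φ x * f x ^ 2 :=
  integral_nonneg fun x => mul_nonneg (hφ.deriv_nonneg x) (sq_nonneg _)

/-- The smoothing part is nonnegative and can be dropped here; the lower order part is small because
τ times the commutator constant is at most 1/4. -/
theorem neg_le_step_mul_bform (h : StepHyp α r R φ Δ τ ε) (hv : v ∈ feSpace α r Δ) :
    -(1 / 8 * l2n v ^ 2) ≤ τ * bform α φ v v := by
  have h1 := h.le_bform_self hv
  have h2 := integral_deriv_mul_nonneg h.cutoff (fracD (α / 2) v)
  have h3 : 0 ≤ (1 + α) / 2 * (∫ x, deriv φ x * fracD (α / 2) v x ^ 2) :=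
    mul_nonneg (by linarith [h.one_le]) h2
  have h4 : -(IsCutoff.commConst α φ / 2 * l2n v ^ 2) ≤ bform α φ v v := by linarith
  have h5 := mul_le_mul_of_nonneg_left h4 h.step_pos.le
  have h6 := mul_le_mul_of_nonneg_right h.small (sq_nonneg (l2n v))
  nlinarith

theorem continuous_deriv_cutoff_mul (h : StepHyp α r R φ Δ τ ε) (hv : v ∈ feSpace α r Δ) :
    Continuous (deriv fun x => φ x * v x) := by
  obtain ⟨g, hg⟩ := exists_l2Deriv_deriv_cutoff_mul h.cutoff h.one_le h.mesh_pos hv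
  exact hg.cont

theorem memLp_mul_deriv (h : StepHyp α r R φ Δ τ ε) (hv : v ∈ feSpace α r Δ) {g : ℝ → ℝ}
    (hg : MemLp g 2 volume) : MemLp (fun x => deriv (fun x => φ x * v x) x * g x) 2 volume :=
  MemLp.bdd_mul_continuous (C := ε * l2n v / τ) (h.continuous_deriv_cutoff_mul hv) (fun x => by
    rw [le_div_iff₀ h.step_pos, mul_comm]
    exact h.sup_le v hv x) hg

theorem integrable_mul_mul_deriv (h : StepHyp α r R φ Δ τ ε) (hv : v ∈ feSpace α r Δ) {f g : ℝ → ℝ}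
    (hf : MemLp f 2 volume) (hg : MemLp g 2 volume) :
    Integrable fun x => f x * g x * deriv (fun x => φ x * v x) x := by
  refine (hf.integrable_mul (h.memLp_mul_deriv hv hg)).congr (ae_of_all _ fun x => ?_)
  simp only [Pi.mul_apply]
  ring

/-- Nonlinear terms are estimated with the derivative on the test function in L^∞, where the CFL
condition pays for it, and the two remaining factors in L². -/
theorem step_mul_abs_dot_le (h : StepHyp α r R φ Δ τ ε) (hv : v ∈ feSpace α r Δ) {f g : ℝ → ℝ}
    (hf : MemLp f 2 volume) (hg : MemLp g 2 volume) :
    τ * |dot (fun x => f x * g x) (deriv fun x => φ x * v x)| ≤ ε * l2n v * l2n f * l2n g := by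
  have e : τ * dot (fun x => f x * g x) (deriv fun x => φ x * v x) =
      dot f (fun x => τ * (deriv (fun x => φ x * v x) x * g x)) := by
    rw [dot_const_mul_right]
    congr 1
    rw [dot, dot]
    congr 1
    ext x
    ring
  rw [show ∀ y, τ * |y| = |τ * y| from fun y => by rw [abs_mul, abs_of_pos h.step_pos], e]
  refine (abs_dot_le hf ((h.memLp_mul_deriv hv hg).const_mul τ)).trans ?_
  have := l2n_le_mul (f := fun x => τ * (deriv (fun x => φ x * v x) x * g x)) (C := ε * l2n v)
    (mul_nonneg h.eps_nonneg (l2n_nonneg _)) hg (fun x => by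
      rw [abs_mul, abs_mul, abs_of_pos h.step_pos, ← mul_assoc]
      exact mul_le_mul_of_nonneg_right (h.sup_le v hv x) (abs_nonneg _))
  calc _ ≤ l2n f * (ε * l2n v * l2n g) := mul_le_mul_of_nonneg_left this (l2n_nonneg _)
    _ = _ := by ring

theorem dot_sub_left {f f' g : ℝ → ℝ} (hf : MemLp f 2 volume) (hf' : MemLp f' 2 volume)
    (hg : MemLp g 2 volume) : dot (f - f') g = dot f g - dot f' g := by
  simp only [dot, Pi.sub_apply, sub_mul]
  exact integral_sub (hf.integrable_mul hg) (hf'.integrable_mul hg)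

/-- The quadratic terms differ by a product with one factor (w₁ - w₂)/2, which yields the Lipschitz
dependence on the iterate. -/
theorem stepForm_sub (h : StepHyp α r R φ Δ τ ε) (hu : u ∈ feSpace α r Δ) (hv : v ∈ feSpace α r Δ)
    {w₁ w₁' w₂ w₂' : ℝ → ℝ} (h1 : w₁ ∈ feSpace α r Δ) (h1' : w₁' ∈ feSpace α r Δ)
    (h2 : w₂ ∈ feSpace α r Δ) (h2' : w₂' ∈ feSpace α r Δ) :
    stepForm α φ τ u w₁ w₁' v - stepForm α φ τ u w₂ w₂' v =
      dot (w₁' - w₂') (fun x => φ x * v x) -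
        τ / 2 * dot (fun x => (w₁ x - w₂ x) / 2 * ((w₁ x + w₂ x) / 2 + u x)) (deriv fun x => φ x * v x) +
        τ / 2 * bform α φ (w₁' - w₂') v := by
  have e : dot (fun x => (w₁ x - w₂ x) / 2 * ((w₁ x + w₂ x) / 2 + u x)) (deriv fun x => φ x * v x) =
      dot (fun x => ((w₁ x + u x) / 2) ^ 2) (deriv fun x => φ x * v x) -
      dot (fun x => ((w₂ x + u x) / 2) ^ 2) (deriv fun x => φ x * v x) := by
    have m1 := h.memLp (h.mid_mem h1 hu)
    have m2 := h.memLp (h.mid_mem h2 hu)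
    rw [dot, dot, dot, ← integral_sub]
    · congr 1
      ext x
      ring
    · simpa only [sq] using h.integrable_mul_mul_deriv hv m1 m1
    · simpa only [sq] using h.integrable_mul_mul_deriv hv m2 m2
  rw [e, h.bform_sub h1' h2' hv, dot_sub_left (h.memLp h1') (h.memLp h2')
    (memLp_cutoff_mul h.cutoff (h.memLp hv)), stepForm, stepForm, h.bform_mid h1' hu hv,
    h.bform_mid h2' hu hv]
  ring

theorem l2n_half_sub (w₁ w₂ : ℝ → ℝ) : l2n (fun x => (w₁ x - w₂ x) / 2) = l2n (w₁ - w₂) / 2 := by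
  have e : (fun x => (w₁ x - w₂ x) / 2) = fun x => (1 / 2 : ℝ) * (w₁ - w₂) x := by
    ext x; simp only [Pi.sub_apply]; ring
  rw [e, l2n_const_mul, abs_of_pos (by norm_num)]
  ring

/-- The quadratic terms of two iterates. -/
theorem step_mul_abs_dot_sub_le (h : StepHyp α r R φ Δ τ ε) (hu : u ∈ feSpace α r Δ)
    (hv : v ∈ feSpace α r Δ) {w₁ w₂ : ℝ → ℝ} (h1 : w₁ ∈ feSpace α r Δ) (h2 : w₂ ∈ feSpace α r Δ)
    {N : ℝ} (nu : l2n u ≤ N) (n1 : l2n w₁ ≤ 2 * N) (n2 : l2n w₂ ≤ 2 * N) (hεN : ε * N ≤ 1 / 8) :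
    τ / 2 * |dot (fun x => (w₁ x - w₂ x) / 2 * ((w₁ x + w₂ x) / 2 + u x)) (deriv fun x => φ x * v x)| ≤
      3 / 32 * l2n v * l2n (w₁ - w₂) := by
  have m := h.memLp (h.mid_mem h1 h2)
  have md : MemLp (fun x => (w₁ x - w₂ x) / 2) 2 volume := by
    have := (h.memLp (h.sub_mem h1 h2)).const_mul (1 / 2)
    refine (memLp_congr_ae (ae_of_all _ fun x => ?_)).1 this
    simp only [Pi.sub_apply]
    ring
  have key := h.step_mul_abs_dot_le hv md (m.add (h.memLp hu))
  have b := (l2n_add_le m (h.memLp hu)).trans (add_le_add (l2n_mid_le (h.memLp h1) (h.memLp h2)) le_rfl)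
  rw [l2n_half_sub] at key
  have b' : l2n (fun x => (w₁ x + w₂ x) / 2 + u x) ≤ 3 * N := by linarith
  have hd := l2n_nonneg (w₁ - w₂)
  have hv0 := l2n_nonneg v
  have he := h.eps_nonneg
  have : ε * l2n v * (l2n (w₁ - w₂) / 2) * l2n (fun x => (w₁ x + w₂ x) / 2 + u x) ≤
      ε * l2n v * (l2n (w₁ - w₂) / 2) * (3 * N) := by gcongr
  -- The constant 3/32 is 1/2 · 1/8 · 3/2: the prefactor, the bound on εN, and half of the norm
  -- bound 3N for the second factor.
  have h3 : ε * l2n v * (l2n (w₁ - w₂) / 2) * (3 * N) = (ε * N) * (3 / 2 * (l2n v * l2n (w₁ - w₂))) := by ring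
  have h4 := mul_le_mul_of_nonneg_right hεN (by positivity : 0 ≤ 3 / 2 * (l2n v * l2n (w₁ - w₂)))
  change τ * |_| ≤ _ * l2n (fun x => (w₁ x + w₂ x) / 2 + u x) at key
  change τ * |dot (fun x => (w₁ x - w₂ x) / 2 * ((w₁ x + w₂ x) / 2 + u x)) (deriv fun x => φ x * v x)| ≤ _ at key
  linarith

/-- Testing the difference of the two equations with w₁' - w₂', of norm t, gives (15/16) t² ≤ (3/32)
t d with d = ‖w₁ - w₂‖. This is stronger than the factor 1/2 that is needed. -/
theorem contraction (h : StepHyp α r R φ Δ τ ε) (hu : u ∈ feSpace α r Δ)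
    {w₁ w₁' w₂ w₂' : ℝ → ℝ} (h1 : w₁ ∈ feSpace α r Δ) (h1' : w₁' ∈ feSpace α r Δ)
    (h2 : w₂ ∈ feSpace α r Δ) (h2' : w₂' ∈ feSpace α r Δ)
    (e : ∀ v ∈ feSpace α r Δ, stepForm α φ τ u w₁ w₁' v = stepForm α φ τ u w₂ w₂' v)
    {N : ℝ} (nu : l2n u ≤ N) (n1 : l2n w₁ ≤ 2 * N) (n2 : l2n w₂ ≤ 2 * N) (hεN : ε * N ≤ 1 / 8) :
    l2n (w₁' - w₂') ≤ 1 / 2 * l2n (w₁ - w₂) := by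
  have hs := h.sub_mem h1' h2'
  have k1 := h.stepForm_sub hu hs h1 h1' h2 h2'
  rw [e _ hs, sub_self] at k1
  have k2 := h.step_mul_abs_dot_sub_le hu hs h1 h2 nu n1 n2 hεN
  have k3 := h.neg_le_step_mul_bform hs
  have k4 := l2n_sq_le_dot h.cutoff (h.memLp hs)
  set D := dot (fun x => (w₁ x - w₂ x) / 2 * ((w₁ x + w₂ x) / 2 + u x))
    (deriv fun x => φ x * (w₁' - w₂') x)
  have k5 : τ / 2 * D ≤ τ / 2 * |D| := mul_le_mul_of_nonneg_left (le_abs_self _) (by linarith [h.step_pos])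
  have hd := l2n_nonneg (w₁ - w₂)
  have he := l2n_nonneg (w₁' - w₂')
  set d := l2n (w₁ - w₂)
  set t := l2n (w₁' - w₂')
  have : t * (15 / 16 * t - 3 / 32 * d) ≤ 0 := by nlinarith
  by_contra! hlt
  have h0 : 0 < t := by linarith
  have : 0 < 15 / 16 * t - 3 / 32 * d := by linarith
  nlinarith

theorem dot_mid (hφ : IsCutoff R φ) (hw : MemLp w 2 volume) (hu : MemLp u 2 volume) :
    dot w (fun x => φ x * ((w x + u x) / 2)) - dot u (fun x => φ x * ((w x + u x) / 2)) =
      (dot w (fun x => φ x * w x) - dot u (fun x => φ x * u x)) / 2 := by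
  have i1 : Integrable fun x => w x * (φ x * w x) := hw.integrable_mul (memLp_cutoff_mul hφ hw)
  have i2 : Integrable fun x => w x * (φ x * u x) := hw.integrable_mul (memLp_cutoff_mul hφ hu)
  have i3 : Integrable fun x => u x * (φ x * u x) := hu.integrable_mul (memLp_cutoff_mul hφ hu)
  have e1 : dot w (fun x => φ x * ((w x + u x) / 2)) =
      (dot w (fun x => φ x * w x) + ∫ x, w x * (φ x * u x)) / 2 := by
    rw [dot, dot, ← integral_add i1 i2, ← integral_div]
    congr 1; ext x; ring
  have e2 : dot u (fun x => φ x * ((w x + u x) / 2)) =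
      ((∫ x, w x * (φ x * u x)) + dot u (fun x => φ x * u x)) / 2 := by
    rw [dot, dot, ← integral_add i2 i3, ← integral_div]
    congr 1; ext x; ring
  rw [e1, e2]
  ring

/-- Testing with the midpoint of w' and u gives a² - N² ≤ (9/64) N(a+N) + (a+N)²/16 for a = ‖w'‖,
which is impossible for a > 2N. The hypothesis on `u` is in the weighted energy, because this is
what the energy estimate propagates from step to step. -/
theorem iterate_bound (h : StepHyp α r R φ Δ τ ε) (hu : u ∈ feSpace α r Δ) (hw : w ∈ feSpace α r Δ)
    (hw' : w' ∈ feSpace α r Δ)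
    (e : ∀ v ∈ feSpace α r Δ, stepForm α φ τ u w w' v = dot u (fun x => φ x * v x))
    {N : ℝ} (hN : 0 ≤ N) (nu : dot u (fun x => φ x * u x) ≤ N ^ 2) (nw : l2n w ≤ 2 * N)
    (hεN : ε * N ≤ 1 / 8) : l2n w' ≤ 2 * N := by
  have hz := h.mid_mem hw' hu
  have hp := h.memLp (h.mid_mem hw hu)
  have k1 := e _ hz
  rw [stepForm] at k1
  have k2 := dot_mid h.cutoff (h.memLp hw') (h.memLp hu)
  have k3 := h.neg_le_step_mul_bform hz
  have k4 := h.step_mul_abs_dot_le hz hp hp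
  have k5 := l2n_mid_le (h.memLp hw') (h.memLp hu)
  have k6 := l2n_mid_le (h.memLp hw) (h.memLp hu)
  have k7 := l2n_sq_le_dot h.cutoff (h.memLp hw')
  have k8 := l2n_sq_le_dot h.cutoff (h.memLp hu)
  have nu' : l2n u ≤ N := le_of_sq_le_sq (k8.trans nu) hN
  have hp0 := l2n_nonneg (fun x => (w x + u x) / 2)
  have hz0 := l2n_nonneg (fun x => (w' x + u x) / 2)
  have hw0 := l2n_nonneg w'
  have he := h.eps_nonneg
  simp only [← sq] at k4
  set a := l2n w'
  set z := l2n (fun x => (w' x + u x) / 2)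
  set p := l2n (fun x => (w x + u x) / 2)
  set D := dot (fun x => ((w x + u x) / 2) ^ 2) (deriv fun x => φ x * ((w' x + u x) / 2))
  have k9 : τ * D ≤ τ * |D| := mul_le_mul_of_nonneg_left (le_abs_self _) h.step_pos.le
  have hp1 : p ≤ 3 / 2 * N := by linarith
  have hz1 : z ≤ (a + N) / 2 := by linarith
  have q1 : ε * z * p * p ≤ ε * ((a + N) / 2) * (3 / 2 * N) * (3 / 2 * N) := by gcongr
  have q2 : ε * ((a + N) / 2) * (3 / 2 * N) * (3 / 2 * N) = (ε * N) * (9 / 8 * (N * (a + N))) := by ring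
  have q3 := mul_le_mul_of_nonneg_right hεN (by positivity : 0 ≤ 9 / 8 * (N * (a + N)))
  have q4 : z ^ 2 ≤ ((a + N) / 2) ^ 2 := pow_le_pow_left₀ hz0 hz1 2
  have main : a ^ 2 - N ^ 2 ≤ 9 / 64 * (N * (a + N)) + 1 / 4 * ((a + N) / 2) ^ 2 := by linarith
  by_contra! hlt
  nlinarith

/-- Only w' is unknown, through ⟨w', φv⟩ + (τ/2) ⟨D^α w', (φv)ₓ⟩. This form is coercive in L²
because φ ≥ 1 and the dispersive part is almost nonnegative, so Lax–Milgram applies; the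
nonlinearity and `u` go into the functional. -/
theorem exists_linear_step (h : StepHyp α r R φ Δ τ ε) (hu : u ∈ feSpace α r Δ) (hw : w ∈ feSpace α r Δ) :
    ∃ w' ∈ feSpace α r Δ, ∀ v ∈ feSpace α r Δ,
      stepForm α φ τ u w w' v = dot u (fun x => φ x * v x) := by
  obtain ⟨C, hC0, hC⟩ := exists_bform_bound h.cutoff h.R_pos h.one_le h.lt_two.le h.mesh_pos r
  let S := feSubmodule r h.one_le h.lt_two h.mesh_pos
  have hm : ∀ v : S, MemLp (v : ℝ → ℝ) 2 volume := fun v => h.memLp v.2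
  have hmφ : ∀ v : S, MemLp (fun x => φ x * (v : ℝ → ℝ) x) 2 volume := fun v => memLp_cutoff_mul h.cutoff (hm v)
  have hlφ : ∀ v : S, l2n (fun x => φ x * (v : ℝ → ℝ) x) ≤ (2 + 2 * R) * l2n v := fun v =>
    l2n_le_mul (by linarith [h.R_pos]) (hm v) fun x => by
      rw [abs_mul]
      exact mul_le_mul_of_nonneg_right (h.cutoff.abs_le x) (abs_nonneg _)
  have eadd : ∀ v v' : S, (fun x => φ x * ((v + v' : S) : ℝ → ℝ) x) =
      fun x => φ x * (v : ℝ → ℝ) x + φ x * (v' : ℝ → ℝ) x := fun v v' => by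
    ext x; simp [mul_add]
  have esmul : ∀ (c : ℝ) (v : S), (fun x => φ x * ((c • v : S) : ℝ → ℝ) x) =
      fun x => c * (φ x * (v : ℝ → ℝ) x) := fun c v => by
    ext x; simp only [Submodule.coe_smul, Pi.smul_apply, smul_eq_mul]; ring
  let a : S →ₗ[ℝ] S →ₗ[ℝ] ℝ :=
    LinearMap.mk₂ ℝ (fun e v : S => dot e (fun x => φ x * (v : ℝ → ℝ) x) + τ / 2 * bform α φ e v)
      (fun e e' v => by
        have h1 := dot_add_left (hm e) (hm e') (hmφ v)
        have h2 := bform_add_left h.cutoff h.one_le h.lt_two h.mesh_pos e.2 e'.2 v.2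
        change dot (fun x => (e : ℝ → ℝ) x + (e' : ℝ → ℝ) x) _ + τ / 2 * bform α φ ((e : ℝ → ℝ) + e') v = _
        rw [h1, h2]
        ring)
      (fun c e v => by
        have h1 := dot_const_mul_left c (e : ℝ → ℝ) (fun x => φ x * (v : ℝ → ℝ) x)
        have h2 := bform_smul_left (φ := φ) h.one_le h.lt_two h.mesh_pos c e.2 v
        change dot (fun x => c * (e : ℝ → ℝ) x) _ + τ / 2 * bform α φ (c • (e : ℝ → ℝ)) v = _
        rw [h1, h2, smul_eq_mul]
        ring)
      (fun e v v' => by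
        have h2 := bform_add_right h.cutoff h.one_le h.lt_two h.mesh_pos e.2 v.2 v'.2
        rw [eadd, dot_add_right (hm e) (hmφ v) (hmφ v')]
        change _ + τ / 2 * bform α φ e ((v : ℝ → ℝ) + v') = _
        rw [h2]
        ring)
      (fun c e v => by
        rw [esmul, dot_const_mul_right]
        change _ + τ / 2 * bform α φ e (c • (v : ℝ → ℝ)) = _
        rw [bform_smul_right, smul_eq_mul]
        ring)
  have hp := h.memLp (h.mid_mem hw hu)
  set P : ℝ → ℝ := fun x => ((w x + u x) / 2) ^ 2 with hP
  have hPd : ∀ v : S, Integrable fun x => P x * deriv (fun x => φ x * (v : ℝ → ℝ) x) x := fun v => by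
    simpa only [hP, sq] using h.integrable_mul_mul_deriv v.2 hp hp
  have dadd : ∀ v v' : S, dot P (deriv fun x => φ x * ((v : ℝ → ℝ) + (v' : ℝ → ℝ)) x) =
      dot P (deriv fun x => φ x * (v : ℝ → ℝ) x) + dot P (deriv fun x => φ x * (v' : ℝ → ℝ) x) := by
    intro v v'
    rw [deriv_cutoff_mul_add h.cutoff h.one_le h.lt_two h.mesh_pos v.2 v'.2, dot, dot, dot,
      ← integral_add (hPd v) (hPd v')]
    simp only [mul_add]
  let l : S →ₗ[ℝ] ℝ :=
    { toFun := fun v : S => dot u (fun x => φ x * (v : ℝ → ℝ) x) +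
        τ / 2 * dot P (deriv fun x => φ x * (v : ℝ → ℝ) x) - τ / 2 * bform α φ u v
      map_add' := fun v v' => by
        have h2 := bform_add_right h.cutoff h.one_le h.lt_two h.mesh_pos hu v.2 v'.2
        have h3 := dadd v v'
        have h4 := dot_add_right (h.memLp hu) (hmφ v) (hmφ v')
        have h5 : dot u (fun x => φ x * ((v + v' : S) : ℝ → ℝ) x) =
          dot u (fun x => φ x * (v : ℝ → ℝ) x) + dot u (fun x => φ x * (v' : ℝ → ℝ) x) := by
          rw [eadd]; exact h4
        change dot u (fun x => φ x * ((v + v' : S) : ℝ → ℝ) x) + τ / 2 * dot P (deriv fun x => φ x * ((v : ℝ → ℝ) + (v' : ℝ → ℝ)) x) -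
          τ / 2 * bform α φ u ((v : ℝ → ℝ) + v') = _
        rw [h2, h3, h5]
        ring
      map_smul' := fun c v => by
        have h5 : dot u (fun x => φ x * ((c • v : S) : ℝ → ℝ) x) =
            c * dot u (fun x => φ x * (v : ℝ → ℝ) x) := by
          rw [esmul, dot_const_mul_right]
        change dot u (fun x => φ x * ((c • v : S) : ℝ → ℝ) x) + τ / 2 * dot P (deriv fun x => φ x * (c • (v : ℝ → ℝ)) x) -
          τ / 2 * bform α φ u (c • (v : ℝ → ℝ)) = _
        rw [h5, bform_smul_right, deriv_cutoff_mul_smul, dot_const_mul_right, RingHom.id_apply, smul_eq_mul]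
        ring }
  have hτ := h.step_pos
  obtain ⟨e, he⟩ := exists_form_solution h.one_le h.lt_two h.mesh_pos a (C := (2 + 2 * R) + τ / 2 * C)
    (c := 1 / 2) (C' := l2n u * (2 + 2 * R) + ε / 2 * l2n (fun x => (w x + u x) / 2) ^ 2 + τ / 2 * (C * l2n u))
    (fun v w => by
      change |dot v (fun x => φ x * (w : ℝ → ℝ) x) + τ / 2 * bform α φ v w| ≤ _
      refine (abs_add_le _ _).trans ?_
      rw [abs_mul, abs_of_pos (by linarith : 0 < τ / 2)]
      have h1 := (abs_dot_le (hm v) (hmφ w)).trans (mul_le_mul_of_nonneg_left (hlφ w) (l2n_nonneg _))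
      have h2 := mul_le_mul_of_nonneg_left ((hC w w.2).2 v v.2) (by linarith : 0 ≤ τ / 2)
      linarith)
    (by norm_num)
    (fun v => by
      change _ ≤ dot v (fun x => φ x * (v : ℝ → ℝ) x) + τ / 2 * bform α φ v v
      have h1 := l2n_sq_le_dot h.cutoff (hm v)
      have h2 := h.neg_le_step_mul_bform v.2
      linarith [sq_nonneg (l2n v)]) l
    (fun v => by
      change |dot u (fun x => φ x * (v : ℝ → ℝ) x) +
        τ / 2 * dot P (deriv fun x => φ x * (v : ℝ → ℝ) x) - τ / 2 * bform α φ u v| ≤ _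
      have h1 := (abs_dot_le (h.memLp hu) (hmφ v)).trans (mul_le_mul_of_nonneg_left (hlφ v) (l2n_nonneg _))
      have h2 := mul_le_mul_of_nonneg_left ((hC v v.2).2 u hu) (by linarith : 0 ≤ τ / 2)
      have h3 := h.step_mul_abs_dot_le v.2 hp hp
      simp only [← sq] at h3
      refine (abs_sub _ _).trans ?_
      refine (add_le_add (abs_add_le _ _) le_rfl).trans ?_
      rw [abs_mul, abs_mul, abs_of_pos (by linarith : 0 < τ / 2)]
      nlinarith)
  refine ⟨e, e.2, fun v hv => ?_⟩
  have h1 : dot e (fun x => φ x * v x) + τ / 2 * bform α φ e v =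
    dot u (fun x => φ x * v x) + τ / 2 * dot P (deriv fun x => φ x * v x) - τ / 2 * bform α φ u v :=
    he ⟨v, hv⟩
  rw [stepForm, h.bform_mid e.2 hu hv]
  linarith

end StepHyp

end

end FracKdV

/-! ### Convergence of the iteration and the energy estimate. -/

namespace FracKdV

section

theorem l2n_le_of_tendsto {w : ℕ → ℝ → ℝ} {u : ℝ → ℝ} {B : ℝ} (hw : ∀ l, MemLp (w l) 2 volume)
    (hu : MemLp u 2 volume) (hB : ∀ l, l2n (w l) ≤ B)
    (ht : Tendsto (fun l => l2n (w l - u)) atTop (𝓝 0)) : l2n u ≤ B := by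
  have h1 : ∀ l, l2n u ≤ B + l2n (w l - u) := fun l => by
    have h2 := l2n_sub_le (hw l) ((hw l).sub hu)
    have e : (fun x => w l x - (w l - u) x) = u := by ext x; simp
    rw [e] at h2
    linarith [hB l]
  have h3 := ht.const_add B
  rw [add_zero] at h3
  exact ge_of_tendsto h3 (Eventually.of_forall h1)

theorem tendsto_l2n_iff {w : ℕ → ℝ → ℝ} {u : ℝ → ℝ} (hw : ∀ l, MemLp (w l) 2 volume)
    (hu : MemLp u 2 volume) : Tendsto (fun l => l2n (w l - u)) atTop (𝓝 0) ↔
      Tendsto (fun l => eLpNorm (fun x => w l x - u x) 2 volume) atTop (𝓝 0) := by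
  have := ENNReal.tendsto_toReal_iff (fi := atTop) (f := fun l => eLpNorm (w l - u) 2 volume) (x := 0)
    (fun l => ((hw l).sub hu).2.ne) ENNReal.zero_ne_top
  rw [ENNReal.toReal_zero] at this
  exact this

namespace StepHyp

variable {α R Δ τ ε : ℝ} {r : ℕ} {φ : ℝ → ℝ} {u u' v : ℝ → ℝ} {N : ℝ}

theorem isIteration_iff (h : StepHyp α r R φ Δ τ ε) (hu : u ∈ feSpace α r Δ) {w : ℕ → ℝ → ℝ} :
    IsIteration α r φ Δ τ u w ↔ w 0 = u ∧ ∀ l, w (l + 1) ∈ feSpace α r Δ ∧ ∀ v ∈ feSpace α r Δ,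
      stepForm α φ τ u (w l) (w (l + 1)) v = dot u (fun x => φ x * v x) := by
  refine and_congr Iff.rfl (forall_congr' fun l => and_congr_right fun hw => ?_)
  refine forall₂_congr fun v hv => ?_
  rw [stepForm, dot_fracD_eq_bform h.cutoff h.one_le h.lt_two.le h.mesh_pos (h.mid_mem hw hu) hv]

theorem isSchemeStep_iff (h : StepHyp α r R φ Δ τ ε) (hu : u ∈ feSpace α r Δ) :
    IsSchemeStep α r φ Δ τ u u' ↔ u' ∈ feSpace α r Δ ∧ ∀ v ∈ feSpace α r Δ,
      stepForm α φ τ u u' u' v = dot u (fun x => φ x * v x) := by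
  refine and_congr_right fun hu' => forall₂_congr fun v hv => ?_
  rw [stepForm, dot_fracD_eq_bform h.cutoff h.one_le h.lt_two.le h.mesh_pos (h.mid_mem hu' hu) hv]
  have e : dot (fun x => ((u' x + u x) / 2) ^ 2 / 2) (deriv fun x => φ x * v x) =
      1 / 2 * dot (fun x => ((u' x + u x) / 2) ^ 2) (deriv fun x => φ x * v x) := by
    rw [← dot_const_mul_left]
    congr 1
    ext x
    ring
  rw [e, ← mul_assoc, mul_one_div]

theorem iteration_bound (h : StepHyp α r R φ Δ τ ε) (hu : u ∈ feSpace α r Δ) (hN : 0 ≤ N)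
    (nu : dot u (fun x => φ x * u x) ≤ N ^ 2) (hεN : ε * N ≤ 1 / 8) {w : ℕ → ℝ → ℝ}
    (hw : IsIteration α r φ Δ τ u w) (l : ℕ) : w l ∈ feSpace α r Δ ∧ l2n (w l) ≤ 2 * N := by
  obtain ⟨h0, h1⟩ := (h.isIteration_iff hu).1 hw
  induction l with
  | zero =>
    rw [h0]
    have := le_of_sq_le_sq ((l2n_sq_le_dot h.cutoff (h.memLp hu)).trans nu) hN
    exact ⟨hu, by linarith⟩
  | succ l ih => exact ⟨(h1 l).1, h.iterate_bound hu ih.1 (h1 l).1 (h1 l).2 hN nu ih.2 hεN⟩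

theorem exists_iteration (h : StepHyp α r R φ Δ τ ε) (hu : u ∈ feSpace α r Δ) :
    ∃ w, IsIteration α r φ Δ τ u w := by
  choose! next hn1 hn2 using fun w (hw : w ∈ feSpace α r Δ) => h.exists_linear_step hu hw
  let w : ℕ → ℝ → ℝ := fun l => next^[l] u
  have hs : ∀ l, w (l + 1) = next (w l) := fun l => Function.iterate_succ_apply' next l u
  have hm : ∀ l, w l ∈ feSpace α r Δ := fun l => by
    induction l with
    | zero => exact hu
    | succ l ih => rw [hs]; exact hn1 _ ih
  refine ⟨w, (h.isIteration_iff hu).2 ⟨rfl, fun l => ?_⟩⟩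
  rw [hs]
  exact ⟨hn1 _ (hm l), hn2 _ (hm l)⟩

/-- The contraction makes the iterates a geometric Cauchy sequence in L², and the space is closed
there. -/
theorem iteration_tendsto (h : StepHyp α r R φ Δ τ ε) (hu : u ∈ feSpace α r Δ) (hN : 0 ≤ N)
    (nu : dot u (fun x => φ x * u x) ≤ N ^ 2) (hεN : ε * N ≤ 1 / 8) {w : ℕ → ℝ → ℝ}
    (hw : IsIteration α r φ Δ τ u w) :
    ∃ u' ∈ feSpace α r Δ, Tendsto (fun l => l2n (w l - u')) atTop (𝓝 0) := by
  have hb := h.iteration_bound hu hN nu hεN hw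
  have hm : ∀ l, MemLp (w l) 2 volume := fun l => h.memLp (hb l).1
  have nu' : l2n u ≤ N := le_of_sq_le_sq ((l2n_sq_le_dot h.cutoff (h.memLp hu)).trans nu) hN
  obtain ⟨h0, h1⟩ := (h.isIteration_iff hu).1 hw
  have hgeo : ∀ l, l2n (w (l + 1) - w l) ≤ l2n (w 1 - w 0) * (1 / 2) ^ l := by
    intro l
    induction l with
    | zero => simp
    | succ l ih =>
      have := h.contraction hu (hb (l + 1)).1 (hb (l + 2)).1 (hb l).1 (hb (l + 1)).1
        (fun v hv => ((h1 (l + 1)).2 v hv).trans ((h1 l).2 v hv).symm) nu' (hb (l + 1)).2 (hb l).2 hεN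
      rw [pow_succ]
      linarith
  let y : ℕ → Lp ℝ 2 (volume : Measure ℝ) := fun l => (hm l).toLp (w l)
  have hc : CauchySeq y := by
    apply cauchySeq_of_le_geometric (1 / 2) (l2n (w 1 - w 0)) (by norm_num)
    intro l
    rw [dist_comm, dist_eq_norm]
    refine le_trans (le_of_eq ?_) (hgeo l)
    exact norm_toLp_eq ((hm (l + 1)).sub (hm l))
  obtain ⟨f, hf⟩ := cauchySeq_tendsto_of_complete hc
  have hlim : Tendsto (fun n => eLpNorm (w n - (f : ℝ → ℝ)) 2 volume) atTop (𝓝 0) := by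
    have := (Lp.tendsto_Lp_iff_tendsto_eLpNorm' _ _).1 hf
    refine this.congr fun n => ?_
    exact eLpNorm_congr_ae ((hm n).coeFn_toLp.sub ae_eq_rfl)
  obtain ⟨u', hu', huf⟩ := exists_mem_feSpace_of_tendsto h.one_le h.lt_two h.mesh_pos
    (fun n => (hb n).1) (Lp.memLp f) hlim
  refine ⟨u', hu', (tendsto_l2n_iff hm (h.memLp hu')).2 (hlim.congr fun n => ?_)⟩
  exact eLpNorm_congr_ae (ae_eq_rfl.sub huf.symm)

/-- At a fixed mesh width the residual of the limit is bounded by the distances of two consecutive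
iterates from it, all terms being continuous in L². -/
theorem isSchemeStep_of_tendsto (h : StepHyp α r R φ Δ τ ε) (hu : u ∈ feSpace α r Δ) (hN : 0 ≤ N)
    (nu : dot u (fun x => φ x * u x) ≤ N ^ 2) (hεN : ε * N ≤ 1 / 8) {w : ℕ → ℝ → ℝ}
    (hw : IsIteration α r φ Δ τ u w) (hu' : u' ∈ feSpace α r Δ)
    (ht : Tendsto (fun l => l2n (w l - u')) atTop (𝓝 0)) : IsSchemeStep α r φ Δ τ u u' := by
  refine (h.isSchemeStep_iff hu).2 ⟨hu', fun v hv => ?_⟩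
  have hb := h.iteration_bound hu hN nu hεN hw
  have hm : ∀ l, MemLp (w l) 2 volume := fun l => h.memLp (hb l).1
  have nu' : l2n u ≤ N := le_of_sq_le_sq ((l2n_sq_le_dot h.cutoff (h.memLp hu)).trans nu) hN
  have nb := l2n_le_of_tendsto hm (h.memLp hu') (fun l => (hb l).2) ht
  obtain ⟨h0, h1⟩ := (h.isIteration_iff hu).1 hw
  obtain ⟨C, hC0, hC⟩ := exists_bform_bound h.cutoff h.R_pos h.one_le h.lt_two.le h.mesh_pos r
  have hτ := h.step_pos
  have key : ∀ l, |dot u (fun x => φ x * v x) - stepForm α φ τ u u' u' v| ≤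
      l2n (w (l + 1) - u') * l2n (fun x => φ x * v x) + 3 / 32 * l2n v * l2n (w l - u') +
        τ / 2 * (C * l2n (w (l + 1) - u') * l2n v) := by
    intro l
    rw [← (h1 l).2 v hv, h.stepForm_sub hu hv (hb l).1 (hb (l + 1)).1 hu' hu']
    have hs := h.sub_mem (hb (l + 1)).1 hu'
    have k1 := abs_dot_le (h.memLp hs) (memLp_cutoff_mul h.cutoff (h.memLp hv))
    have k2 := h.step_mul_abs_dot_sub_le hu hv (hb l).1 hu' nu' (hb l).2 nb hεN
    have k3 := mul_le_mul_of_nonneg_left ((hC v hv).2 _ hs) (by linarith : 0 ≤ τ / 2)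
    refine (abs_add_le _ _).trans ?_
    refine (add_le_add (abs_sub _ _) le_rfl).trans ?_
    rw [abs_mul (τ / 2), abs_mul (τ / 2), abs_of_pos (by linarith : 0 < τ / 2)]
    linarith
  have ht' := (tendsto_add_atTop_iff_nat 1).2 ht
  have lim := ((ht'.mul_const (l2n fun x => φ x * v x)).add (ht.const_mul (3 / 32 * l2n v))).add
    (((ht'.const_mul C).mul_const (l2n v)).const_mul (τ / 2))
  simp only [zero_mul, mul_zero, add_zero] at lim
  have := ge_of_tendsto lim (Eventually.of_forall key)
  have := abs_eq_zero.1 (le_antisymm this (abs_nonneg _))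
  linarith

theorem exists_step (h : StepHyp α r R φ Δ τ ε) (hu : u ∈ feSpace α r Δ) (hN : 0 ≤ N)
    (nu : dot u (fun x => φ x * u x) ≤ N ^ 2) (hεN : ε * N ≤ 1 / 8) :
    ∃ u', IsSchemeStep α r φ Δ τ u u' ∧ ∃ w, IsIteration α r φ Δ τ u w ∧
      Tendsto (fun l => eLpNorm (fun x => w l x - u' x) 2 volume) atTop (𝓝 0) := by
  obtain ⟨w, hw⟩ := h.exists_iteration hu
  obtain ⟨u', hu', ht⟩ := h.iteration_tendsto hu hN nu hεN hw
  have hb := h.iteration_bound hu hN nu hεN hw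
  exact ⟨u', h.isSchemeStep_of_tendsto hu hN nu hεN hw hu' ht, w, hw,
    (tendsto_l2n_iff (fun l => h.memLp (hb l).1) (h.memLp hu')).1 ht⟩

/-- Since (φv³)ₓ has integral 0, ∫ φ v² vₓ = -(1/3) ∫ φₓ v³. -/
theorem integral_sq_mul_deriv (h : StepHyp α r R φ Δ τ ε) (hv : v ∈ feSpace α r Δ) :
    dot (fun x => v x ^ 2) (deriv fun x => φ x * v x) = 2 / 3 * ∫ x, deriv φ x * v x ^ 3 := by
  obtain ⟨C₂, hC₂⟩ := exists_isInverseConstant h.one_le r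
  have d := l2Deriv_of_mem_feSpace h.one_le h.mesh_pos hv
  have hbd := abs_le_l2n_add d (hC₂.2 Δ h.mesh_pos v hv)
  have m2 : MemLp (fun x => v x * v x) 2 volume := MemLp.bdd_mul_continuous d.cont hbd d.memLp
  have i1 : Integrable fun x => deriv φ x * v x ^ 3 := by
    refine ((MemLp.bdd_mul_continuous (h.cutoff.smooth.continuous_deriv (by simp))
      h.cutoff.abs_deriv_le d.memLp).integrable_mul m2).congr (ae_of_all _ fun x => ?_)
    simp only [Pi.mul_apply]
    ring
  have i2 : Integrable fun x => φ x * v x ^ 2 * deriv v x := by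
    refine ((memLp_cutoff_mul h.cutoff d.memLp_deriv).integrable_mul m2).congr (ae_of_all _ fun x => ?_)
    simp only [Pi.mul_apply]
    ring
  have i3 : Integrable fun x => φ x * v x ^ 3 := by
    refine ((memLp_cutoff_mul h.cutoff d.memLp).integrable_mul m2).congr (ae_of_all _ fun x => ?_)
    simp only [Pi.mul_apply]
    ring
  have z := integral_eq_zero_of_hasDerivAt_off_countable (h := fun x => φ x * v x ^ 3)
    (k := fun x => deriv φ x * v x ^ 3 + 3 * (φ x * v x ^ 2 * deriv v x))
    (h.cutoff.smooth.continuous.mul (d.cont.pow 3)) (N := ∅) countable_empty (fun x _ => by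
      have h1 := (h.cutoff.smooth.differentiable (by simp) x).hasDerivAt
      have h2 := (hasDerivAt_of_mem_feSpace h.one_le h.mesh_pos hv x).pow 3
      exact (h1.mul h2).congr_deriv (by
        simp only [Pi.pow_apply]
        push_cast
        ring)) i3 (i1.add (i2.const_mul 3))
  rw [integral_add i1 (i2.const_mul 3), integral_const_mul] at z
  have e : dot (fun x => v x ^ 2) (deriv fun x => φ x * v x) =
      (∫ x, deriv φ x * v x ^ 3) + ∫ x, φ x * v x ^ 2 * deriv v x := by
    rw [deriv_cutoff_mul h.cutoff h.one_le h.mesh_pos hv, dot, ← integral_add i1 i2]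
    congr 1
    ext x
    ring
  rw [e]
  linarith

/-- The energy estimate for one time step. -/
theorem energy_step (h : StepHyp α r R φ Δ τ ε) (hu : u ∈ feSpace α r Δ)
    (hs : IsSchemeStep α r φ Δ τ u u') (nu : l2n u ≤ N) (nu' : l2n u' ≤ 2 * N) {C₁ : ℝ} (hC₁ : 0 ≤ C₁)
    (htri : ∀ v ∈ feSpace α r Δ, ∫ x, v x ^ 2 ≤ 9 / 4 * N ^ 2 →
      |∫ x, deriv φ x * v x ^ 3| ≤ (∫ x, deriv φ x * fracD (α / 2) v x ^ 2) + C₁) :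
    dot u' (fun x => φ x * u' x) +
      τ * (∫ x, deriv φ x * fracD (α / 2) (fun x => (u' x + u x) / 2) x ^ 2) ≤
      dot u (fun x => φ x * u x) + τ * (C₁ + 9 / 4 * IsCutoff.commConst α φ * N ^ 2) := by
  obtain ⟨hu', he⟩ := (h.isSchemeStep_iff hu).1 hs
  have hz := h.mid_mem hu' hu
  have k1 := he _ hz
  rw [stepForm, h.integral_sq_mul_deriv hz] at k1
  have k2 := dot_mid h.cutoff (h.memLp hu') (h.memLp hu)
  have k3 := h.le_bform_self hz
  have nz : l2n (fun x => (u' x + u x) / 2) ≤ 3 / 2 * N := by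
    linarith [l2n_mid_le (h.memLp hu') (h.memLp hu)]
  have nz2 := pow_le_pow_left₀ (l2n_nonneg _) nz 2
  have nz3 : l2n (fun x => (u' x + u x) / 2) ^ 2 ≤ 9 / 4 * N ^ 2 := by linarith
  have k4 := (le_abs_self _).trans (htri _ hz (by rw [← l2n_sq (h.memLp hz)]; exact nz3))
  have k5 := integral_deriv_mul_nonneg h.cutoff (fracD (α / 2) fun x => (u' x + u x) / 2)
  set Q := ∫ x, deriv φ x * fracD (α / 2) (fun x => (u' x + u x) / 2) x ^ 2
  set Z := l2n (fun x => (u' x + u x) / 2) ^ 2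
  set I := ∫ x, deriv φ x * ((u' x + u x) / 2) ^ 3
  have hc := IsCutoff.commConst_nonneg α φ
  have hτ := h.step_pos
  have k6 : IsCutoff.commConst α φ * Z ≤ IsCutoff.commConst α φ * (9 / 4 * N ^ 2) := by gcongr
  have k7 : Q ≤ (1 + α) / 2 * Q := by nlinarith [h.one_le]
  -- Twice the dispersive form yields (1+α)Q ≥ 2Q, of which the cubic term uses at most (2/3)Q; one
  -- full Q is kept for the smoothing bound.
  have k8 : 2 / 3 * I - 2 * bform α φ (fun x => (u' x + u x) / 2) (fun x => (u' x + u x) / 2) ≤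
      C₁ + 9 / 4 * IsCutoff.commConst α φ * N ^ 2 - Q := by linarith
  have k9 := mul_le_mul_of_nonneg_left k8 hτ.le
  linarith

end StepHyp

end

end FracKdV

/-! ### Induction over the time steps and choice of the parameters. -/

namespace FracKdV

section

/-- `u'` is the time step from `u` that the iteration converges to. -/
def IsIteratedStep (α : ℝ) (r : ℕ) (φ : ℝ → ℝ) (Δ τ : ℝ) (u u' : ℝ → ℝ) : Prop :=
  IsSchemeStep α r φ Δ τ u u' ∧ ∃ w : ℕ → ℝ → ℝ, IsIteration α r φ Δ τ u w ∧
    Tendsto (fun l => eLpNorm (fun x => w l x - u' x) 2 volume) atTop (𝓝 0)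

/-- The parameters of the a priori estimate: `M` bounds the initial datum, `N` the solution up to
time `T`. -/
structure RunHyp (α : ℝ) (r : ℕ) (R : ℝ) (φ : ℝ → ℝ) (Δ τ ε M N T C₁ : ℝ) : Prop where
  cutoff : IsCutoff R φ
  one_le : 1 ≤ α
  R_pos : 0 < R
  mesh_pos : 0 < Δ
  step_pos : 0 < τ
  time_pos : 0 < T
  N_nonneg : 0 ≤ N
  C_nonneg : 0 ≤ C₁
  stepHyp : τ ≤ 2 * T → StepHyp α r R φ Δ τ ε
  eps_le : ε * N ≤ 1 / 8
  bound : (2 + 2 * R) * M ^ 2 + 2 * T * (C₁ + 9 / 4 * IsCutoff.commConst α φ * N ^ 2) ≤ N ^ 2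
  trilinear : ∀ v ∈ feSpace α r Δ, ∫ x, v x ^ 2 ≤ 9 / 4 * N ^ 2 →
      |∫ x, deriv φ x * v x ^ 3| ≤ (∫ x, deriv φ x * fracD (α / 2) v x ^ 2) + C₁

namespace RunHyp

variable {α R Δ τ ε M N T C₁ : ℝ} {r : ℕ} {φ : ℝ → ℝ} {u : ℕ → ℝ → ℝ}

/-- The energy grows at most linearly, by τC' per step, provided that it is still below N² at the
start of the step; the choice of T guarantees this, so the two statements sustain each other by
induction. -/
theorem energy_sequence (h : RunHyp α r R φ Δ τ ε M N T C₁) (h0 : u 0 ∈ feSpace α r Δ)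
    (hM : l2n (u 0) ≤ M) (n : ℕ) (hn : ∀ k < n, ((k : ℝ) + 1 / 2) * τ ≤ T)
    (hs : ∀ k < n, IsIteratedStep α r φ Δ τ (u k) (u (k + 1))) :
    u n ∈ feSpace α r Δ ∧ dot (u n) (fun x => φ x * u n x) +
      τ * ∑ k ∈ Finset.range n,
        ∫ x, deriv φ x * fracD (α / 2) (fun x => (u (k + 1) x + u k x) / 2) x ^ 2 ≤ N ^ 2 := by
  have hc := IsCutoff.commConst_nonneg α φ
  set C' := C₁ + 9 / 4 * IsCutoff.commConst α φ * N ^ 2 with hC'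
  have hbd : (2 + 2 * R) * M ^ 2 + 2 * T * C' ≤ N ^ 2 := h.bound
  have hC0 : 0 ≤ C' := by have := h.C_nonneg; positivity
  have hτ := h.step_pos
  have main : u n ∈ feSpace α r Δ ∧ dot (u n) (fun x => φ x * u n x) +
      τ * ∑ k ∈ Finset.range n,
        ∫ x, deriv φ x * fracD (α / 2) (fun x => (u (k + 1) x + u k x) / 2) x ^ 2 ≤
      (2 + 2 * R) * M ^ 2 + n * τ * C' := by
    induction n with
    | zero =>
      refine ⟨h0, ?_⟩
      have h1 := StepHyp.dot_le_l2n_sq h.cutoff (memLp_of_mem_feSpace h.one_le h.mesh_pos h0)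
      have h2 := pow_le_pow_left₀ (l2n_nonneg _) hM 2
      have h3 := mul_le_mul_of_nonneg_left h2 (by linarith [h.R_pos] : 0 ≤ 2 + 2 * R)
      simp only [Finset.range_zero, Finset.sum_empty, Nat.cast_zero]
      linarith
    | succ n ih =>
      obtain ⟨hu, hE⟩ := ih (fun k hk => hn k (by omega)) (fun k hk => hs k (by omega))
      have ht := hn n (by omega)
      have hn0 : (0 : ℝ) ≤ n := n.cast_nonneg
      have st := h.stepHyp (by nlinarith)
      obtain ⟨hstep, w, hw, hlim⟩ := hs n (by omega)
      have hsum : 0 ≤ τ * ∑ k ∈ Finset.range n,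
          ∫ x, deriv φ x * fracD (α / 2) (fun x => (u (k + 1) x + u k x) / 2) x ^ 2 :=
        mul_nonneg hτ.le (Finset.sum_nonneg fun k _ => StepHyp.integral_deriv_mul_nonneg h.cutoff _)
      have hnt : n * τ * C' ≤ 2 * T * C' :=
        mul_le_mul_of_nonneg_right (by nlinarith [h.time_pos]) hC0
      have nu : dot (u n) (fun x => φ x * u n x) ≤ N ^ 2 := by linarith [hbd]
      have nu1 : l2n (u n) ≤ N :=
        le_of_sq_le_sq ((StepHyp.l2n_sq_le_dot h.cutoff (st.memLp hu)).trans nu) h.N_nonneg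
      -- The new value is bounded by 2N because it is a limit of iterates in that ball; no
      -- uniqueness for the implicit scheme is used.
      have hb := st.iteration_bound hu h.N_nonneg nu h.eps_le hw
      have nu2 := l2n_le_of_tendsto (fun l => st.memLp (hb l).1) (st.memLp hstep.1) (fun l => (hb l).2)
        ((tendsto_l2n_iff (fun l => st.memLp (hb l).1) (st.memLp hstep.1)).2 hlim)
      have := st.energy_step hu hstep nu1 nu2 h.C_nonneg h.trilinear
      refine ⟨hstep.1, ?_⟩
      rw [Finset.sum_range_succ, mul_add]
      push_cast
      rw [← hC'] at this
      linarith
  refine ⟨main.1, main.2.trans (le_trans ?_ hbd)⟩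
  -- The last step may overshoot: (n - 1/2)τ ≤ T only gives nτ ≤ T + τ/2 ≤ 2T. This is where the
  -- factor 2 in `bound` comes from.
  have : n * τ ≤ 2 * T := by
    rcases n with _ | n
    · simp only [Nat.cast_zero, zero_mul]; linarith [h.time_pos]
    · have ht := hn n (by omega)
      have hn0 : (0 : ℝ) ≤ n := n.cast_nonneg
      push_cast
      nlinarith
  linarith [mul_le_mul_of_nonneg_right this hC0]

theorem sum_nonneg (h : RunHyp α r R φ Δ τ ε M N T C₁) (u : ℕ → ℝ → ℝ) (n : ℕ) :
    0 ≤ τ * ∑ k ∈ Finset.range n,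
      ∫ x, deriv φ x * fracD (α / 2) (fun x => (u (k + 1) x + u k x) / 2) x ^ 2 :=
  mul_nonneg h.step_pos.le (Finset.sum_nonneg fun _ _ => StepHyp.integral_deriv_mul_nonneg h.cutoff _)

-- A step exists as long as the energy is below N², and the energy bound for the steps already taken
-- provides this; the steps are then chosen successively.
open Classical in
theorem exists_run (h : RunHyp α r R φ Δ τ ε M N T C₁) {v : ℝ → ℝ} (h0 : v ∈ feSpace α r Δ)
    (hM : l2n v ≤ M) : ∃ u : ℕ → ℝ → ℝ, u 0 = v ∧
      ∀ n : ℕ, ((n : ℝ) + 1 / 2) * τ ≤ T → IsIteratedStep α r φ Δ τ (u n) (u (n + 1)) := by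
  let next : (ℝ → ℝ) → ℝ → ℝ := fun a =>
    -- The default value `a` only matters beyond time T, where nothing is required.
    if hb : ∃ b, IsIteratedStep α r φ Δ τ a b then hb.choose else a
  have hnext : ∀ a, (∃ b, IsIteratedStep α r φ Δ τ a b) → IsIteratedStep α r φ Δ τ a (next a) := by
    intro a ha
    simp only [next, dif_pos ha]
    exact ha.choose_spec
  let u : ℕ → ℝ → ℝ := fun n => next^[n] v
  have hu : ∀ n, u (n + 1) = next (u n) := fun n => Function.iterate_succ_apply' next n v
  have hτ := h.step_pos
  have hmono : ∀ n k : ℕ, k < n + 1 → ((n : ℝ) + 1 / 2) * τ ≤ T → ((k : ℝ) + 1 / 2) * τ ≤ T := by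
    intro n k hk ht
    have : (k : ℝ) ≤ n := by exact_mod_cast Nat.lt_succ_iff.1 hk
    nlinarith
  have claim : ∀ n : ℕ, (∀ k < n, ((k : ℝ) + 1 / 2) * τ ≤ T) →
      ∀ k < n, IsIteratedStep α r φ Δ τ (u k) (u (k + 1)) := by
    intro n
    induction n with
    | zero => intro _ k hk; omega
    | succ n ih =>
      intro hn
      have ih' := ih fun k _ => hn k (by omega)
      intro k hk
      rcases Nat.lt_succ_iff_lt_or_eq.1 hk with hk | rfl
      · exact ih' k hk
      · obtain ⟨hk1, hk2⟩ := h.energy_sequence (u := u) h0 hM k (fun j hj => hn j (by omega)) ih'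
        have ht := hn k (by omega)
        have hk0 : (0 : ℝ) ≤ k := k.cast_nonneg
        have st := h.stepHyp (by nlinarith)
        rw [hu]
        exact hnext _ (st.exists_step hk1 h.N_nonneg (by linarith [h.sum_nonneg u k]) h.eps_le)
  exact ⟨u, rfl, fun n ht => claim (n + 1) (fun k hk => hmono n k hk ht) n (Nat.lt_succ_self n)⟩

end RunHyp

/-- On the open interval φₓ = 1, and the endpoints, where this is not assumed, have measure 0. -/
theorem setIntegral_sq_le_of_isCutoff {R : ℝ} {φ f : ℝ → ℝ} (hφ : IsCutoff R φ)
    (hf : MemLp f 2 volume) : ∫ x in Icc (-R) R, f x ^ 2 ≤ ∫ x, deriv φ x * f x ^ 2 := by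
  have i : Integrable fun x => deriv φ x * f x ^ 2 :=
    ((memLp_two_iff_integrable_sq hf.1).1 hf).bdd_mul (c := 1)
      (hφ.smooth.continuous_deriv (by simp)).aestronglyMeasurable (ae_of_all _ hφ.abs_deriv_le)
  rw [integral_Icc_eq_integral_Ioo, setIntegral_congr_fun (g := fun x => deriv φ x * f x ^ 2)
    measurableSet_Ioo fun x hx => by simp only [hφ.deriv_eq_one x (abs_lt.2 hx), one_mul]]
  exact setIntegral_le_integral i (ae_of_all _ fun x => mul_nonneg (hφ.deriv_nonneg x) (sq_nonneg _))

/-- The parameters can be chosen in terms of the norm of the initial datum alone. -/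
theorem exists_parameters {α R : ℝ} {φ : ℝ → ℝ} (hα₁ : 1 ≤ α) (hα₂ : α < 2) (r : ℕ) (hR : 0 < R)
    (hφ : IsCutoff R φ) (M : ℝ) : ∃ δ T N ε C₁ : ℝ, 0 < δ ∧ 0 < T ∧
      ∀ C₂, IsInverseConstant α r C₂ → ∀ Δ τ : ℝ, 0 < Δ → 0 < τ → τ / Δ ^ (3 / 2 : ℝ) * √C₂ ≤ δ →
        RunHyp α r R φ Δ τ ε M N T C₁ := by
  -- The initial energy is at most (2 + 2R)M², and the extra 1 is the growth allowed up to time T.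
  -- The trilinear constant is taken for norms up to (3/2)N, the size of a midpoint.
  set A := (2 + 2 * R) * M ^ 2 + 1 with hA
  have hA0 : 0 ≤ A := by positivity
  obtain ⟨C₁, hC₁, htri⟩ := hφ.abs_integral_cube_le hα₁ hα₂.le r (M := 9 / 4 * A) (by positivity)
  set N := √A with hN
  have hN2 : N ^ 2 = A := Real.sq_sqrt hA0
  have hN0 : 0 ≤ N := Real.sqrt_nonneg _
  set C₀ := IsCutoff.commConst α φ with hC₀
  have hC₀0 : 0 ≤ C₀ := IsCutoff.commConst_nonneg α φ
  set C' := C₁ + 9 / 4 * C₀ * N ^ 2 with hC'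
  have hC'0 : 0 ≤ C' := by positivity
  -- The three bounds give, in turn, total growth at most 1, τ times the commutator constant at most
  -- 1/4, and τ ≤ ε/2, all for τ ≤ 2T.
  set T := min (1 / (2 * (C' + 1))) (min (1 / (8 * (C₀ + 1))) (1 / (32 * (N + 1)))) with hT
  have T1 : T ≤ 1 / (2 * (C' + 1)) := min_le_left _ _
  have T2 : T ≤ 1 / (8 * (C₀ + 1)) := (min_le_right _ _).trans (min_le_left _ _)
  have T3 : T ≤ 1 / (32 * (N + 1)) := (min_le_right _ _).trans (min_le_right _ _)
  have T0 : 0 < T := by positivity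
  set ε := 1 / (8 * (N + 1)) with hε
  have hε0 : 0 < ε := by positivity
  -- The CFL quantity enters the sup bound with the factor 3 + 2R and may use the half of ε that τ
  -- itself leaves. All parameters are fixed before C₂ is given.
  refine ⟨ε / (2 * (3 + 2 * R)), T, N, ε, C₁, by positivity, T0, fun C₂ hC₂ Δ τ hΔ hτ hδ => ?_⟩
  refine ⟨hφ, hα₁, hR, hΔ, hτ, T0, hN0, hC₁, fun hτT => ⟨hφ, hR, hα₁, hα₂, hΔ, hτ, hε0.le, ?_, ?_⟩, ?_, ?_, ?_⟩
  · intro v hv x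
    have h1 := mul_le_mul_of_nonneg_left (abs_deriv_cutoff_mul_le hφ hR hα₁ hΔ hv hC₂ x) hτ.le
    refine h1.trans ?_
    rw [← mul_assoc]
    refine mul_le_mul_of_nonneg_right ?_ (l2n_nonneg v)
    rw [le_div_iff₀ (by positivity)] at hδ
    have h2 : τ * (√C₂ / Δ ^ (3 / 2 : ℝ)) = τ / Δ ^ (3 / 2 : ℝ) * √C₂ := by ring
    have h3 : 2 * T ≤ ε / 2 := by
      have e : 2 * (1 / (32 * (N + 1))) = ε / 2 := by rw [hε]; field_simp; norm_num
      linarith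
    calc τ * (1 + (3 + 2 * R) * (√C₂ / Δ ^ (3 / 2 : ℝ))) =
          τ + (3 + 2 * R) * (τ / Δ ^ (3 / 2 : ℝ) * √C₂) := by rw [← h2]; ring
      _ ≤ ε := by linarith
  · rw [le_div_iff₀ (by positivity)] at T2
    have h1 := mul_le_mul_of_nonneg_right hτT hC₀0
    linarith
  · rw [hε, div_mul_eq_mul_div, one_mul, div_le_div_iff₀ (by positivity) (by norm_num)]
    linarith
  · rw [le_div_iff₀ (by positivity)] at T1
    change _ + 2 * T * C' ≤ _
    rw [hN2, hA]
    linarith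
  · intro v hv hv2
    rw [hN2] at hv2
    exact htri Δ hΔ v hv hv2

/-- Only L < 1 and K ≥ 1 are used: the stated CFL condition is stronger than the bare smallness of
the CFL quantity that the argument needs. -/
theorem cfl_le {L K Y Λ c : ℝ} (hL₀ : 0 < L) (hL₁ : L < 1) (hK : K = (5 - L) / (1 - L)) (hY : 0 < Y)
    (hc : 0 < c) (h : Λ ≤ L / (2 * c * K * √Y)) : Λ * c ≤ 1 / √Y := by
  have hK1 : 1 ≤ K := by
    rw [hK, le_div_iff₀ (by linarith)]
    linarith
  have hY' : 0 < √Y := Real.sqrt_pos.2 hY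
  rw [le_div_iff₀ (by positivity)] at h
  rw [le_div_iff₀ hY']
  nlinarith

end

end FracKdV

/-! ### The theorem. -/

theorem mainTheorem3
    (α : ℝ) (hα₁ : 1 ≤ α) (hα₂ : α < 2) (r : ℕ) (hr : 2 ≤ r)
    (R : ℝ) (hR : 0 < R) (φ : ℝ → ℝ) (hφ : FracKdV.IsCutoff R φ)
    (L : ℝ) (hL₀ : 0 < L) (hL₁ : L < 1) (K : ℝ) (hK : K = (5 - L) / (1 - L)) :
    (∃ C₂ : ℝ, FracKdV.IsInverseConstant α r C₂) ∧
    ∀ M : ℝ, 0 ≤ M → ∃ Y T C : ℝ, 0 < Y ∧ 0 < T ∧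
      ∀ C₂ : ℝ, FracKdV.IsInverseConstant α r C₂ →
      ∀ u₀ : ℝ → ℝ, MemLp u₀ 2 volume → eLpNorm u₀ 2 volume = ENNReal.ofReal M →
      ∀ Δx Δt : ℝ, 0 < Δx → 0 < Δt →
        Δt / Δx ^ (3 / 2 : ℝ) ≤ L / (2 * √C₂ * K * √Y) →
        (∃ u : ℕ → ℝ → ℝ, FracKdV.IsNumericalSolution α r φ Δx Δt T u₀ u) ∧
        ∀ u : ℕ → ℝ → ℝ, FracKdV.IsNumericalSolution α r φ Δx Δt T u₀ u →
          (∀ n : ℕ, (n : ℝ) * Δt ≤ T → eLpNorm (u n) 2 volume ≤ ENNReal.ofReal C) ∧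
          (∀ N : ℕ, ((N : ℝ) + 1 / 2) * Δt ≤ T →
            Δt * ∑ n ∈ Finset.range (N + 1),
              ∫ x in Icc (-R) R,
                (FracKdV.fracD (α / 2) (fun x => (u (n + 1) x + u n x) / 2) x) ^ 2 ≤ C) := by
  refine ⟨FracKdV.exists_isInverseConstant hα₁ r, fun M hM => ?_⟩
  obtain ⟨δ, T, N, ε, C₁, hδ, hT, hpar⟩ := FracKdV.exists_parameters hα₁ hα₂ r hR hφ M
  -- Y is chosen so that 1/√Y = δ. The energy bound N² controls the smoothing sum and its root N the
  -- L² norm, so N² + N serves both.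
  refine ⟨(1 / δ) ^ 2, T, N ^ 2 + N, by positivity, hT, ?_⟩
  intro C₂ hC₂ u₀ hu₀ hM₀ Δx Δt hΔx hΔt hcfl
  have hcfl' := FracKdV.cfl_le hL₀ hL₁ hK (by positivity) (Real.sqrt_pos.2 hC₂.1) hcfl
  rw [Real.sqrt_sq (by positivity), one_div_one_div] at hcfl'
  have h := hpar C₂ hC₂ Δx Δt hΔx hΔt hcfl'
  have hl2 : FracKdV.l2n u₀ = M := by
    rw [FracKdV.l2n, hM₀, ENNReal.toReal_ofReal hM]
  have hproj : ∀ v, FracKdV.IsL2Projection α r Δx u₀ v → FracKdV.l2n v ≤ M := fun v hv =>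
    (FracKdV.l2n_le_of_isL2Projection hα₁ hΔx hu₀ hv).trans hl2.le
  have hN0 := h.N_nonneg
  constructor
  · obtain ⟨v, hv⟩ := FracKdV.exists_isL2Projection hα₁ hα₂ hΔx r hu₀
    obtain ⟨u, hu0, hu⟩ := h.exists_run hv.1 (hproj v hv)
    exact ⟨u, hu0 ▸ hv, hu⟩
  · intro u hu
    have hb : ∀ n : ℕ, (∀ k < n, ((k : ℝ) + 1 / 2) * Δt ≤ T) → _ := fun n hn =>
      h.energy_sequence hu.1.1 (hproj _ hu.1) n hn fun k hk => hu.2 k (hn k hk)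
    constructor
    · intro n hn
      -- For k < n one has k + 1/2 ≤ n, so nΔt ≤ T makes all the steps leading to `u n` admissible.
      obtain ⟨hmem, hE⟩ := hb n fun k hk => by
        have : (k : ℝ) + 1 ≤ n := by exact_mod_cast hk
        nlinarith
      have hm := FracKdV.memLp_of_mem_feSpace hα₁ hΔx hmem
      have h1 := FracKdV.StepHyp.l2n_sq_le_dot hφ hm
      have h2 : FracKdV.l2n (u n) ≤ N :=
        le_of_sq_le_sq (by linarith [h.sum_nonneg u n]) hN0
      rw [← ENNReal.ofReal_toReal hm.2.ne]
      apply ENNReal.ofReal_le_ofReal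
      change FracKdV.l2n (u n) ≤ _
      linarith [sq_nonneg N]
    · intro n hn
      have hk : ∀ k < n + 1, ((k : ℝ) + 1 / 2) * Δt ≤ T := fun k hk => by
        have : (k : ℝ) ≤ n := by exact_mod_cast Nat.lt_succ_iff.1 hk
        nlinarith
      obtain ⟨hmem, hE⟩ := hb (n + 1) hk
      have h1 := FracKdV.StepHyp.l2n_sq_le_dot hφ (FracKdV.memLp_of_mem_feSpace hα₁ hΔx hmem)
      have h2 : Δt * ∑ k ∈ Finset.range (n + 1), ∫ x in Icc (-R) R,
          (FracKdV.fracD (α / 2) (fun x => (u (k + 1) x + u k x) / 2) x) ^ 2 ≤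
          Δt * ∑ k ∈ Finset.range (n + 1),
            ∫ x, deriv φ x * FracKdV.fracD (α / 2) (fun x => (u (k + 1) x + u k x) / 2) x ^ 2 := by
        refine mul_le_mul_of_nonneg_left (Finset.sum_le_sum fun k hk' => ?_) hΔt.le
        have hkn := Finset.mem_range.1 hk'
        have mk := (hb k fun j hj => hk j (by omega)).1
        have mk' := (hb (k + 1) fun j hj => hk j (by omega)).1
        have st := h.stepHyp (by
          have := hk k hkn
          have h0 : (0 : ℝ) ≤ k := k.cast_nonneg
          nlinarith)
        exact FracKdV.setIntegral_sq_le_of_isCutoff hφ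
          (FracKdV.memLp_fracD hα₁ (by linarith) (by linarith) (st.mid_mem mk' mk))
      linarith [sq_nonneg (FracKdV.l2n (u (n + 1)))]
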